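/- Consider the randomized unit-cost real-word RAM, in which words hold real numbers and arithmetic operations, comparisons, truncation, memory accesses and drawing a uniformly random number from $[0,1]$ take unit time each. For a finite set $X$ of $n$ points with a distance function $\rho$ and a scale $\Delta>0$, the $\Delta$-bounded CKR partition of $(X,\rho)$ is the following random partition: choose a uniformly random ordering $x_{\pi(1)},\dots,x_{\pi(n)}$ of $X$ and, independently, a uniformly random number $R\in[\Delta/4,\Delta/2]$, put $$C_i=\{y\in X:\ \rho(y,x_{\pi(i)})\le R\}\setminus\bigcup_{j<i}C_j \qquad (i=1,\dots,n),$$ and take the partition $\{C_1,\dots,C_n\}\setminus\{\emptyset\}$. Theorem. There are a single program for this machine and a constant $C>0$ such that the following holds for every $\Delta>0$ and every finite undirected graph $G=(X,E,\omega)$ with positive edge weights, $n$ vertices and $m$ edges, given by adjacency lists. Let $\rho$ be the shortest-path metric of $G$ (with $\rho(u,v)=\infty$ if $u$ and $v$ are in different components). On input $G,\Delta$ the program halts with probability $1$ and outputs, as a labelling of the vertices by numbers from $\{1,\dots,n\}$, a random partition of $X$ that is distributed exactly as the $\Delta$-bounded CKR partition of $(X,\rho)$. If $n\ge 2$, its expected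 running time is at most $C\,(m\log n+n\log^2 n)$. -/

import Mathlib

open MeasureTheory
open scoped ENNReal

noncomputable section

/-! ### The shortest-path metric and the CKR partition -/

/-- The shortest-path (extended) metric of a graph with edge weights `w`: the infimum of the
weights of the walks from `u` to `v`. It is `⊤` between different connected components. -/
def shortestPathDist {V : Type*} (G : SimpleGraph V) (w : Sym2 V → ℝ) (u v : V) : ℝ≥0∞ :=
  ⨅ p : G.Walk u v, ENNReal.ofReal (p.edges.map w).sum

open Classical in
/-- The cluster `C_i`: the closed ball of radius `R` around the `i`-th center `π i`, without the
points of the clusters `C_j`, `j < i`. -/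
def ckrCluster {n : ℕ} (ρ : Fin n → Fin n → ℝ≥0∞) (π : Equiv.Perm (Fin n)) (R : ℝ)
    (i : Fin n) : Finset (Fin n) :=
  (Finset.univ.filter fun y => ρ y (π i) ≤ ENNReal.ofReal R) \
    (Finset.univ : Finset {j : Fin n // j < i}).biUnion fun j => ckrCluster ρ π R j.1
termination_by i.1
decreasing_by exact j.2

/-- The point `y` lies in `C_i` if and only if `π i` is the first center at distance at most `R`
from `y`. -/
theorem mem_ckrCluster {n : ℕ} (ρ : Fin n → Fin n → ℝ≥0∞) (π : Equiv.Perm (Fin n)) (R : ℝ)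
    (i y : Fin n) : y ∈ ckrCluster ρ π R i ↔
      ρ y (π i) ≤ ENNReal.ofReal R ∧ ∀ j < i, ¬ ρ y (π j) ≤ ENNReal.ofReal R := by
  induction i using WellFoundedLT.induction with
  | ind i ih =>
    rw [ckrCluster]
    simp only [Finset.mem_sdiff, Finset.mem_filter, Finset.mem_univ, true_and, Finset.mem_biUnion,
      Subtype.exists, not_exists]
    refine and_congr_right fun _ => ⟨fun h j => ?_, fun h j hj hy => h j hj ((ih j hj).1 hy).1⟩
    induction j using WellFoundedLT.induction with
    | ind j ihj =>
      intro hj hy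
      exact h j hj ((ih j hj).2 ⟨hy, fun k hk => ihj k hk (hk.trans hj)⟩)

/-- The partition `{C_1, …, C_n} \ {∅}`. -/
def ckrPartition {n : ℕ} (ρ : Fin n → Fin n → ℝ≥0∞) (π : Equiv.Perm (Fin n)) (R : ℝ) :
    Finset (Finset (Fin n)) :=
  (Finset.univ.image (ckrCluster ρ π R)).erase ∅

/-- The probability that the `Δ`-bounded CKR partition equals `P`, where `π` is a uniformly random
permutation and, independently, `R` is uniformly distributed in `[Δ/4, Δ/2]`. -/
def ckrProb {n : ℕ} (ρ : Fin n → Fin n → ℝ≥0∞) (Δ : ℝ) (P : Finset (Finset (Fin n))) : ℝ≥0∞ :=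
  (∑ π : Equiv.Perm (Fin n),
    ProbabilityTheory.cond volume (Set.Icc (Δ / 4) (Δ / 2)) {R : ℝ | ckrPartition ρ π R = P}) /
    (Fintype.card (Equiv.Perm (Fin n)) : ℝ≥0∞)

/-! ### A randomized unit-cost real-word RAM

Words hold real numbers. A program has registers and an unbounded random access memory, both
indexed by natural numbers; it uses only the finitely many registers that occur in its text.
Arithmetic operations, truncation, comparisons, memory accesses (also to computed addresses) and
drawing a uniformly random number from `[0, 1]` take one unit of time each. -/

namespace RAM

/-- Expressions. Constants are integers, so that a program is a finite object. -/
inductive Expr : Type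
  | const (z : ℤ)
  | reg (i : ℕ)
  | mem (a : Expr)
  | add (a b : Expr)
  | sub (a b : Expr)
  | mul (a b : Expr)
  | div (a b : Expr)
  | floor (a : Expr)

/-- Tests, built from comparisons of words. -/
inductive Test : Type
  | le (a b : Expr)
  | not (t : Test)
  | and (t u : Test)

/-- Programs. -/
inductive Prog : Type
  | skip
  | set (i : ℕ) (e : Expr)
  | store (a e : Expr)
  | random (i : ℕ)
  | seq (p q : Prog)
  | ite (t : Test) (p q : Prog)
  | while (t : Test) (p : Prog)

/-- A machine state: registers, memory, and the number of random numbers drawn so far. -/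
structure State : Type where
  reg : ℕ → ℝ
  mem : ℕ → ℝ
  drawn : ℕ

/-- The value of an expression. A word `x` used as an address refers to the memory cell `⌊x⌋`
(cell `0` if `x < 0`); division by zero yields `0`. -/
def Expr.eval (s : State) : Expr → ℝ
  | const z => (z : ℝ)
  | reg i => s.reg i
  | mem a => s.mem ⌊a.eval s⌋₊
  | add a b => a.eval s + b.eval s
  | sub a b => a.eval s - b.eval s
  | mul a b => a.eval s * b.eval s
  | div a b => a.eval s / b.eval s
  | floor a => (⌊a.eval s⌋ : ℝ)

/-- The time to evaluate an expression: one unit for every operation and operand in it. -/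
def Expr.cost : Expr → ℕ
  | const _ => 1
  | reg _ => 1
  | mem a => a.cost + 1
  | add a b => a.cost + b.cost + 1
  | sub a b => a.cost + b.cost + 1
  | mul a b => a.cost + b.cost + 1
  | div a b => a.cost + b.cost + 1
  | floor a => a.cost + 1

/-- Whether a test succeeds. -/
def Test.Holds (s : State) : Test → Prop
  | le a b => a.eval s ≤ b.eval s
  | not t => ¬ t.Holds s
  | and t u => t.Holds s ∧ u.Holds s

/-- The time to evaluate a test. -/
def Test.cost : Test → ℕ
  | le a b => a.cost + b.cost + 1
  | not t => t.cost + 1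
  | and t u => t.cost + u.cost + 1

/-- `Run ω p s t s'`: with the random numbers `ω 0, ω 1, …`, the program `p`, started in the state
`s`, halts after exactly `t` units of time in the state `s'`. -/
inductive Run (ω : ℕ → unitInterval) : Prog → State → ℕ → State → Prop
  | skip (s : State) : Run ω .skip s 1 s
  | set (i : ℕ) (e : Expr) (s : State) :
      Run ω (.set i e) s (e.cost + 1) { s with reg := Function.update s.reg i (e.eval s) }
  | store (a e : Expr) (s : State) :
      Run ω (.store a e) s (a.cost + e.cost + 1)
        { s with mem := Function.update s.mem ⌊a.eval s⌋₊ (e.eval s) }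
  | random (i : ℕ) (s : State) :
      Run ω (.random i) s 1
        { s with reg := Function.update s.reg i (ω s.drawn : ℝ), drawn := s.drawn + 1 }
  | seq {p q : Prog} {s s' s'' : State} {t t' : ℕ} :
      Run ω p s t s' → Run ω q s' t' s'' → Run ω (.seq p q) s (t + t') s''
  | ite_true {b : Test} {p q : Prog} {s s' : State} {t : ℕ} :
      b.Holds s → Run ω p s t s' → Run ω (.ite b p q) s (b.cost + t) s'
  | ite_false {b : Test} {p q : Prog} {s s' : State} {t : ℕ} :
      ¬ b.Holds s → Run ω q s t s' → Run ω (.ite b p q) s (b.cost + t) s'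
  | while_false {b : Test} {p : Prog} {s : State} :
      ¬ b.Holds s → Run ω (.while b p) s b.cost s
  | while_true {b : Test} {p : Prog} {s s' s'' : State} {t t' : ℕ} :
      b.Holds s → Run ω p s t s' → Run ω (.while b p) s' t' s'' →
        Run ω (.while b p) s (b.cost + t + t') s''

/-- Running time and final state are determined by the program, the initial state and the
random numbers. -/
theorem Run.unique {ω : ℕ → unitInterval} {p : Prog} {s s₁ : State} {t₁ : ℕ}
    (h₁ : Run ω p s t₁ s₁) : ∀ {t₂ : ℕ} {s₂ : State}, Run ω p s t₂ s₂ → t₁ = t₂ ∧ s₁ = s₂ := by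
  induction h₁ with
  | skip | set | store | random => intro t₂ s₂ h₂; cases h₂; exact ⟨rfl, rfl⟩
  | seq _ _ ih ih' =>
    intro t₂ s₂ h₂
    cases h₂ with
    | seq h h' =>
      obtain ⟨rfl, rfl⟩ := ih h
      obtain ⟨rfl, rfl⟩ := ih' h'
      exact ⟨rfl, rfl⟩
  | ite_true hb _ ih =>
    intro t₂ s₂ h₂
    cases h₂ with
    | ite_true _ h => obtain ⟨rfl, rfl⟩ := ih h; exact ⟨rfl, rfl⟩
    | ite_false hn _ => exact absurd hb hn
  | ite_false hb _ ih =>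
    intro t₂ s₂ h₂
    cases h₂ with
    | ite_true hn _ => exact absurd hn hb
    | ite_false _ h => obtain ⟨rfl, rfl⟩ := ih h; exact ⟨rfl, rfl⟩
  | while_false hb =>
    intro t₂ s₂ h₂
    cases h₂ with
    | while_false _ => exact ⟨rfl, rfl⟩
    | while_true hn _ _ => exact absurd hn hb
  | while_true hb _ _ ih ih' =>
    intro t₂ s₂ h₂
    cases h₂ with
    | while_false hn => exact absurd hb hn
    | while_true _ h h' =>
      obtain ⟨rfl, rfl⟩ := ih h
      obtain ⟨rfl, rfl⟩ := ih' h'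
      exact ⟨rfl, rfl⟩

/-- The law of an infinite sequence of independent, uniformly distributed numbers in `[0, 1]`. -/
def randomness : Measure (ℕ → unitInterval) :=
  Measure.infinitePi fun _ : ℕ => (volume : Measure unitInterval)

/-- The running time of `p` from the state `s` with the random numbers `ω`; it is `⊤` if `p` does
not halt. -/
def runningTime (p : Prog) (s : State) (ω : ℕ → unitInterval) : ℝ≥0∞ :=
  ⨅ (t : ℕ) (_ : ∃ s', Run ω p s t s'), (t : ℝ≥0∞)

/-- The expected running time of `p` from the state `s`. -/
def expectedTime (p : Prog) (s : State) : ℝ≥0∞ :=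
  ∫⁻ ω, runningTime p s ω ∂randomness

/-! ### Input and output of the machine -/

/-- The lists `adj v`, `v` a vertex, are adjacency lists of `G`: each contains every neighbor of
`v` exactly once, in an arbitrary order. -/
def IsAdjacencyList {n : ℕ} (G : SimpleGraph (Fin n)) (adj : Fin n → List (Fin n)) : Prop :=
  ∀ v, (adj v).Nodup ∧ ∀ u, u ∈ adj v ↔ G.Adj v u

/-- The memory cell at which the adjacency list of the `v`-th vertex starts; for `v = n` it is the
first cell after the input. -/
def listStart {n : ℕ} (adj : Fin n → List (Fin n)) (v : ℕ) : ℕ :=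
  n + 1 + 2 * ∑ u : Fin n with u.1 < v, (adj u).length

/-- The adjacency list representation of a weighted graph as a sequence of words: the starting
positions `listStart adj 0, …, listStart adj n`, then the adjacency lists of the vertices
`0, …, n - 1`, where a neighbor `u` of `v` is stored as `u` followed by the weight of the edge. -/
def graphWords {n : ℕ} (adj : Fin n → List (Fin n)) (w : Sym2 (Fin n) → ℝ) : List ℝ :=
  ((List.range (n + 1)).map fun v => (listStart adj v : ℝ)) ++
    (List.finRange n).flatMap fun v => (adj v).flatMap fun u : Fin n => [(u.1 : ℝ), w s(v, u)]

/-- The initial state: register `0` holds the number `n` of vertices, register `1` the scale `Δ`,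
the memory holds the graph; everything else is zero. -/
def inputState {n : ℕ} (adj : Fin n → List (Fin n)) (w : Sym2 (Fin n) → ℝ) (Δ : ℝ) : State where
  reg i := if i = 0 then (n : ℝ) else if i = 1 then Δ else 0
  mem a := (graphWords adj w).getD a 0
  drawn := 0

/-- The state `s` represents the set `P` of blocks: from the address in register `0` on, the memory
holds labels from `{1, …, n}` of the vertices `0, …, n - 1`, and the blocks are the sets of the
vertices that share a label. -/
def State.Represents {n : ℕ} (s : State) (P : Finset (Finset (Fin n))) : Prop :=
  ∃ (a : ℕ) (label : Fin n → ℕ), s.reg 0 = a ∧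
    (∀ v : Fin n, 1 ≤ label v ∧ label v ≤ n ∧ s.mem (a + v) = label v) ∧
    P = Finset.univ.image fun v => Finset.univ.filter fun u => label u = label v

/-- The probability that `p`, started in the state `s`, halts in a state that represents `P`. -/
def outputProb {n : ℕ} (p : Prog) (s : State) (P : Finset (Finset (Fin n))) : ℝ≥0∞ :=
  randomness {ω | ∃ t s', Run ω p s t s' ∧ s'.Represents P}

end RAM

end

/-!
The program computes the partition by one search per center, in the random order, that is pruned
at the distances from the earlier centers. The point is that it needs no comparison-based priority
queue, and that its result is nevertheless exact.

*Rounding.* An attempt with the scale `N` replaces an edge weight `w` by `⌊w N / Δ⌋` and the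
radius `R = x Δ` by `T = ⌊x N⌋`. A shortest walk has less than `n` edges, so that a rounded
distance `d` with `d + n ≤ T` certifies that the exact distance is at most `R`, and `T < d`
certifies that it exceeds `R` (`walkDist_le_of_dist_le`, `dist_le_of_walkDist_le`). If every
vertex gets its label from a center with `d + n ≤ T`, the labels are therefore those of the exact
CKR partition (`represents_of_certified`). Otherwise the scale is doubled and the attempt is
repeated with the same random choices; in the attempt `k` this happens with probability at most
`2⁻⁽ᵏ⁺¹⁾`, because `x` is uniformly distributed and has to fall into one of `n²` intervals of
length `n / N` (`volume_ambiguousSet_le`).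

*The queue.* The keys are integers from `{0, …, T}`, extracted in nondecreasing order, so a stack of
buckets for adjacent intervals serves as priority queue: the last bucket is split in halves until
its interval is a single number. Whenever a vertex is moved, it goes on to a later bucket,
or the interval of its bucket has been halved, so that it causes `O(log T)` moves each
time it is reached, apart from `O(1)` for each of its arcs. This is the potential `Search.pot`,
which every step lowers
(`Search.Inv.step`). At the end of a round the tentative distances are correct since no arc can be
relaxed (`Search.Inv.done`).

*The expected time.* A vertex `v` is reached in round `i` only if the `i`-th center is strictly
nearer to `v` than all earlier centers. In a random order this happens with probability at most
`1 / (i + 1)`, so that `v` is reached `H_n = O(log n)` times on average (`sum_record_le`), for any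
fixed scale and independently of `R`. As `log T = O(log n + k)` in the attempt `k`, and this
attempt takes place with probability at most `2⁻ᵏ`, the expected time is `O((m + n log n) log n)`
(`expectedTime_ckrProg`, `time_le`).

*The law of the output.* The shuffle is a bijection between the sequences of its choices and the
permutations (`shufflePerm_bijective`), so that the permutation is uniformly distributed and
independent of the random number that determines `R` (`randomness_randomPerm`).
-/

namespace CKR

open RAM

/-! ### A language of natural number commands on arrays, compiled to the machine -/

/-- The variables with natural number values that the program uses. -/
inductive Var
  | size | scale | bound | flag | round | arc | arcEnd | dist | queue | top | fresh
  | cand | key | aux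
deriving DecidableEq

/-- The register that holds a variable. Register `0` is part of the input; the registers `1`, `2`
and `3` are reserved for the three remaining components of `Env`. -/
def Var.idx : Var → ℕ
  | size => 0 | scale => 4 | bound => 5 | flag => 6 | round => 7 | arc => 8 | arcEnd => 9
  | dist => 10 | queue => 11 | top => 12 | fresh => 13 | cand => 14 | key => 15 | aux => 16

theorem Var.idx_inj {x y : Var} : x.idx = y.idx ↔ x = y := by
  refine ⟨fun h => ?_, fun h => h ▸ rfl⟩
  cases x <;> cases y <;> first | rfl | (exact absurd h (by decide))

theorem Var.idx_ne (x : Var) : x.idx ≠ 1 ∧ x.idx ≠ 2 ∧ x.idx ≠ 3 := by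
  cases x <;> decide

/-- The arrays that the program uses: a permutation of the vertices, four arrays indexed by
vertices or buckets, and the three components of the nodes of linked lists. -/
inductive Fld
  | perm | dist | label | pos | low | head | vertex | key | next
deriving DecidableEq

/-- The offset of an array; the arrays are interleaved with period `16`. -/
def Fld.idx : Fld → ℕ
  | perm => 0 | dist => 1 | label => 2 | pos => 3 | low => 4 | head => 5 | vertex => 6
  | key => 7 | next => 8

theorem Fld.idx_inj {f g : Fld} : f.idx = g.idx ↔ f = g := by
  refine ⟨fun h => ?_, fun h => h ▸ rfl⟩
  cases f <;> cases g <;> first | rfl | (exact absurd h (by decide))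

theorem Fld.idx_lt (f : Fld) : f.idx < 16 := by cases f <;> decide

/-- The values of the variables and of the arrays. -/
structure Store where
  var : Var → ℕ
  arr : Fld → ℕ → ℕ

/-- Assignment to a variable. -/
def Store.setVar (A : Store) (x : Var) (k : ℕ) : Store :=
  { A with var := Function.update A.var x k }

/-- Assignment to an array element. -/
def Store.setArr (A : Store) (f : Fld) (i k : ℕ) : Store :=
  { A with arr := Function.update A.arr f (Function.update (A.arr f) i k) }

@[simp] theorem Store.setVar_var (A : Store) (x y : Var) (k : ℕ) :
    (A.setVar x k).var y = if y = x then k else A.var y := by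
  simp [Store.setVar, Function.update_apply]

@[simp] theorem Store.setVar_arr (A : Store) (x : Var) (k : ℕ) : (A.setVar x k).arr = A.arr := rfl

@[simp] theorem Store.setArr_var (A : Store) (f : Fld) (i k : ℕ) :
    (A.setArr f i k).var = A.var := rfl

@[simp] theorem Store.setArr_arr (A : Store) (f g : Fld) (i k : ℕ) :
    (A.setArr f i k).arr g = if g = f then Function.update (A.arr f) i k else A.arr g := by
  by_cases h : g = f
  · subst h; simp [Store.setArr]
  · simp [Store.setArr, h]

/-- What the natural number commands do not change: the first address `base` of the arrays, the
memory below it, the scale `Δ` of the partition, a real number `x`, and the number of random numbers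
drawn so far. -/
structure Env where
  base : ℕ
  input : ℕ → ℝ
  scale : ℝ
  x : ℝ
  drawn : ℕ

/-- The machine state `s` represents the environment `E` and the store `A`. -/
structure Rep (E : Env) (s : State) (A : Store) : Prop where
  scale : s.reg 1 = E.scale
  x : s.reg 2 = E.x
  base : s.reg 3 = E.base
  var : ∀ y, s.reg (Var.idx y) = A.var y
  input : ∀ a < E.base, s.mem a = E.input a
  arr : ∀ f i, s.mem (E.base + 16 * i + Fld.idx f) = A.arr f i
  drawn : s.drawn = E.drawn
  scale_nonneg : 0 ≤ E.scale
  x_nonneg : 0 ≤ E.x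

/-- Terms with natural number values. `input a` is the input word `a`, rounded down; `weight a` is
the input word `a`, measured in units of `Δ / scale` and rounded down; `frac a` is `⌊x * a⌋`. -/
inductive Term
  | const (c : ℕ)
  | var (x : Var)
  | get (f : Fld) (a : Term)
  | add (a b : Term)
  | mul (a b : Term)
  | div (a b : Term)
  | input (a : Term)
  | weight (a : Term)
  | frac (a : Term)

namespace Term

/-- The value of a term. -/
noncomputable def eval (E : Env) (A : Store) : Term → ℕ
  | const c => c
  | var x => A.var x
  | get f a => A.arr f (a.eval E A)
  | add a b => a.eval E A + b.eval E A
  | mul a b => a.eval E A * b.eval E A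
  | div a b => a.eval E A / b.eval E A
  | input a => ⌊E.input (a.eval E A)⌋₊
  | weight a => ⌊E.input (a.eval E A) * A.var .scale / E.scale⌋₊
  | frac a => ⌊E.x * a.eval E A⌋₊

/-- All accesses to the input are within its bounds, to nonnegative words. -/
def Ok (E : Env) (A : Store) : Term → Prop
  | const _ => True
  | var _ => True
  | get _ a => a.Ok E A
  | add a b => a.Ok E A ∧ b.Ok E A
  | mul a b => a.Ok E A ∧ b.Ok E A
  | div a b => a.Ok E A ∧ b.Ok E A
  | input a => a.Ok E A ∧ a.eval E A < E.base ∧ 0 ≤ E.input (a.eval E A)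
  | weight a => a.Ok E A ∧ a.eval E A < E.base ∧ 0 ≤ E.input (a.eval E A)
  | frac a => a.Ok E A

/-- The address of an array element. -/
def address (f : Fld) (a : Expr) : Expr :=
  .add (.add (.reg 3) (.mul (.const 16) a)) (.const f.idx)

/-- The machine expression for a term. -/
def compile : Term → Expr
  | const c => .const c
  | var x => .reg x.idx
  | get f a => .mem (address f a.compile)
  | add a b => .add a.compile b.compile
  | mul a b => .mul a.compile b.compile
  | div a b => .floor (.div a.compile b.compile)
  | input a => .floor (.mem a.compile)
  | weight a => .floor (.div (.mul (.mem a.compile) (.reg Var.scale.idx)) (.reg 1))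
  | frac a => .floor (.mul (.reg 2) a.compile)

theorem floor_address {E : Env} {s : State} {A : Store} (h : Rep E s A) {a : Expr} {k : ℕ}
    (ha : a.eval s = k) (f : Fld) : ⌊(address f a).eval s⌋₊ = E.base + 16 * k + f.idx := by
  have : (address f a).eval s = ((E.base + 16 * k + f.idx : ℕ) : ℝ) := by
    simp [address, Expr.eval, h.base, ha]
  rw [this, Nat.floor_natCast]

theorem eval_compile {E : Env} {s : State} {A : Store} (h : Rep E s A) :
    ∀ a : Term, a.Ok E A → a.compile.eval s = a.eval E A
  | const c, _ => by simp [compile, Expr.eval, eval]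
  | var x, _ => by simp [compile, Expr.eval, eval, h.var]
  | get f a, ha => by
    simp only [compile, Expr.eval, eval]
    rw [floor_address h (eval_compile h a ha), h.arr]
  | add a b, ha => by
    simp [compile, Expr.eval, eval, eval_compile h a ha.1, eval_compile h b ha.2]
  | mul a b, ha => by
    simp [compile, Expr.eval, eval, eval_compile h a ha.1, eval_compile h b ha.2]
  | div a b, ha => by
    simp only [compile, Expr.eval, eval, eval_compile h a ha.1, eval_compile h b ha.2]
    rw [← natCast_floor_eq_intCast_floor (by positivity), Nat.floor_div_eq_div]
  | input a, ha => by
    simp only [compile, Expr.eval, eval, eval_compile h a ha.1, Nat.floor_natCast]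
    rw [h.input _ ha.2.1, ← natCast_floor_eq_intCast_floor ha.2.2]
  | weight a, ha => by
    simp only [compile, Expr.eval, eval, eval_compile h a ha.1, Nat.floor_natCast]
    rw [h.input _ ha.2.1, h.var, h.scale, ← natCast_floor_eq_intCast_floor]
    have := ha.2.2
    have := h.scale_nonneg
    positivity
  | frac a, ha => by
    simp only [compile, Expr.eval, eval, eval_compile h a ha, h.x]
    rw [← natCast_floor_eq_intCast_floor]
    have := h.x_nonneg
    positivity

/-- The truncated predecessor, as the quotient of `a²` and `a + 1`. -/
def pred (a : Term) : Term := .div (.mul a a) (.add a (.const 1))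

@[simp] theorem eval_pred (E : Env) (A : Store) (a : Term) :
    a.pred.eval E A = a.eval E A - 1 := by
  simp only [pred, eval]
  rcases Nat.eq_zero_or_pos (a.eval E A) with h | h
  · simp [h]
  · obtain ⟨k, hk⟩ : ∃ k, a.eval E A = k + 1 := ⟨a.eval E A - 1, by omega⟩
    rw [hk, Nat.div_eq_iff (by omega)]
    simp only [Nat.add_sub_cancel]
    exact ⟨by nlinarith, Nat.le_sub_of_add_le (by nlinarith)⟩

@[simp] theorem ok_pred (E : Env) (A : Store) (a : Term) : a.pred.Ok E A ↔ a.Ok E A := by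
  simp [pred, Ok]

end Term

/-- Conditions on terms. -/
inductive Cond
  | lt (a b : Term)
  | eq (a b : Term)
  | and (c d : Cond)

namespace Cond

/-- The meaning of a condition. -/
def Holds (E : Env) (A : Store) : Cond → Prop
  | lt a b => a.eval E A < b.eval E A
  | eq a b => a.eval E A = b.eval E A
  | and c d => c.Holds E A ∧ d.Holds E A

/-- All accesses to the input are within its bounds. -/
def Ok (E : Env) (A : Store) : Cond → Prop
  | lt a b => a.Ok E A ∧ b.Ok E A
  | eq a b => a.Ok E A ∧ b.Ok E A
  | and c d => c.Ok E A ∧ d.Ok E A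

/-- The machine test for a condition. -/
def compile : Cond → Test
  | lt a b => .not (.le b.compile a.compile)
  | eq a b => .and (.le a.compile b.compile) (.le b.compile a.compile)
  | and c d => .and c.compile d.compile

theorem holds_compile {E : Env} {s : State} {A : Store} (h : Rep E s A) :
    ∀ c : Cond, c.Ok E A → (c.compile.Holds s ↔ c.Holds E A)
  | lt a b, hc => by
    simp [compile, Test.Holds, Holds, Term.eval_compile h a hc.1, Term.eval_compile h b hc.2]
  | eq a b, hc => by
    simp [compile, Test.Holds, Holds, Term.eval_compile h a hc.1, Term.eval_compile h b hc.2,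
      le_antisymm_iff]
  | and c d, hc => by
    simp [compile, Test.Holds, Holds, holds_compile h c hc.1, holds_compile h d hc.2]

end Cond

/-- Commands without loops. -/
inductive Cmd
  | skip
  | set (x : Var) (a : Term)
  | put (f : Fld) (i a : Term)
  | seq (c d : Cmd)
  | ite (b : Cond) (c d : Cmd)

infixr:60 " ;; " => Cmd.seq

namespace Cmd

open Classical in
/-- The effect of a command. -/
noncomputable def run (E : Env) : Cmd → Store → Store
  | skip, A => A
  | set x a, A => A.setVar x (a.eval E A)
  | put f i a, A => A.setArr f (i.eval E A) (a.eval E A)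
  | seq c d, A => d.run E (c.run E A)
  | ite b c d, A => if b.Holds E A then c.run E A else d.run E A

open Classical in
/-- All accesses to the input are within its bounds. -/
def Ok (E : Env) : Cmd → Store → Prop
  | skip, _ => True
  | set _ a, A => a.Ok E A
  | put _ i a, A => i.Ok E A ∧ a.Ok E A
  | seq c d, A => c.Ok E A ∧ d.Ok E (c.run E A)
  | ite b c d, A => b.Ok E A ∧ if b.Holds E A then c.Ok E A else d.Ok E A

/-- The machine program for a command. -/
def compile : Cmd → Prog
  | skip => .skip
  | set x a => .set x.idx a.compile
  | put f i a => .store (Term.address f i.compile) a.compile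
  | seq c d => .seq c.compile d.compile
  | ite b c d => .ite b.compile c.compile d.compile

/-- An upper bound for the running time of a command. -/
def cost : Cmd → ℕ
  | skip => 1
  | set _ a => a.compile.cost + 1
  | put f i a => (Term.address f i.compile).cost + a.compile.cost + 1
  | seq c d => c.cost + d.cost
  | ite b c d => b.compile.cost + (c.cost + d.cost)

end Cmd

theorem Rep.setVar {E : Env} {s : State} {A : Store} (h : Rep E s A) (x : Var) (k : ℕ) :
    Rep E { s with reg := Function.update s.reg x.idx k } (A.setVar x k) := by
  obtain ⟨h1, h2, h3⟩ := x.idx_ne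
  refine ⟨?_, ?_, ?_, fun y => ?_, h.input, h.arr, h.drawn, h.scale_nonneg, h.x_nonneg⟩
  · simpa [Function.update_apply, h1.symm] using h.scale
  · simpa [Function.update_apply, h2.symm] using h.x
  · simpa [Function.update_apply, h3.symm] using h.base
  · by_cases hy : y = x
    · subst hy; simp
    · simpa [Function.update_apply, Var.idx_inj, hy] using h.var y

theorem Rep.setArr {E : Env} {s : State} {A : Store} (h : Rep E s A) (f : Fld) (i k : ℕ) :
    Rep E { s with mem := Function.update s.mem (E.base + 16 * i + f.idx) k }
      (A.setArr f i k) := by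
  refine ⟨h.scale, h.x, h.base, h.var, fun a ha => ?_, fun g j => ?_, h.drawn, h.scale_nonneg,
    h.x_nonneg⟩
  · rw [← h.input a ha]
    exact Function.update_of_ne (by omega) _ _
  · have hf := f.idx_lt
    have hg := g.idx_lt
    by_cases hgf : g = f
    · subst hgf
      by_cases hj : j = i
      · subst hj; simp
      · simp only [Store.setArr_arr, if_true]
        rw [Function.update_of_ne (by omega), Function.update_of_ne hj, h.arr]
    · have : g.idx ≠ f.idx := fun e => hgf (Fld.idx_inj.1 e)
      simp only [Store.setArr_arr, hgf, if_false]
      rw [Function.update_of_ne (by omega), h.arr]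

/-- The machine program of a command does what the command is meant to do, in time at most
`cost`. -/
theorem Cmd.run_compile (ω : ℕ → unitInterval) {E : Env} :
    ∀ (c : Cmd) {s : State} {A : Store}, Rep E s A → c.Ok E A →
      ∃ t s', Run ω c.compile s t s' ∧ t ≤ c.cost ∧ Rep E s' (c.run E A)
  | .skip, s, _, h, _ => ⟨1, s, .skip s, le_rfl, h⟩
  | .set x a, s, A, h, hc => by
    refine ⟨_, _, .set _ _ s, le_rfl, ?_⟩
    rw [Term.eval_compile h a hc]
    exact h.setVar x _
  | .put f i a, s, A, h, hc => by
    refine ⟨_, _, .store _ _ s, le_rfl, ?_⟩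
    rw [Term.eval_compile h a hc.2, Term.floor_address h (Term.eval_compile h i hc.1)]
    exact h.setArr f _ _
  | .seq c d, s, A, h, hc => by
    obtain ⟨t, s', hr, ht, h'⟩ := Cmd.run_compile ω c h hc.1
    obtain ⟨t', s'', hr', ht', h''⟩ := Cmd.run_compile ω d h' hc.2
    exact ⟨_, _, hr.seq hr', Nat.add_le_add ht ht', h''⟩
  | .ite b c d, s, A, h, hc => by
    by_cases hb : b.Holds E A
    · have hok := hc.2
      rw [if_pos hb] at hok
      obtain ⟨t, s', hr, ht, h'⟩ := Cmd.run_compile ω c h hok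
      refine ⟨_, _, .ite_true ((Cond.holds_compile h b hc.1).2 hb) hr, ?_, ?_⟩
      · simp only [Cmd.cost]; omega
      · rwa [Cmd.run, if_pos hb]
    · have hok := hc.2
      rw [if_neg hb] at hok
      obtain ⟨t, s', hr, ht, h'⟩ := Cmd.run_compile ω d h hok
      refine ⟨_, _, .ite_false (fun hn => hb ((Cond.holds_compile h b hc.1).1 hn)) hr, ?_, ?_⟩
      · simp only [Cmd.cost]; omega
      · rwa [Cmd.run, if_neg hb]

/-- A loop whose invariant `I a` is indexed by `a`, with a potential `φ a` that pays for the test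
and the body in every iteration: the loop terminates, and the potential pays for its running time.
-/
theorem exists_run_while {α : Type*} {ω : ℕ → unitInterval} {b : Test} {c : Prog}
    (I : α → State → Prop) (φ : α → ℕ)
    (hstep : ∀ a s, I a s → b.Holds s →
      ∃ a' t s', Run ω c s t s' ∧ I a' s' ∧ b.cost + t + φ a' ≤ φ a) :
    ∀ a s, I a s → ∃ a' t s', Run ω (.while b c) s t s' ∧ I a' s' ∧ ¬ b.Holds s' ∧
      t + φ a' ≤ φ a + b.cost := by
  have hpos : 0 < b.cost := by cases b <;> simp [Test.cost]
  suffices H : ∀ N a s, φ a ≤ N → I a s → ∃ a' t s', Run ω (.while b c) s t s' ∧ I a' s' ∧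
      ¬ b.Holds s' ∧ t + φ a' ≤ φ a + b.cost from fun a s => H (φ a) a s le_rfl
  intro N
  induction N with
  | zero =>
    intro a s hN ha
    by_cases hb : b.Holds s
    · obtain ⟨a', t, s', -, -, hle⟩ := hstep a s ha hb
      omega
    · exact ⟨a, _, s, .while_false hb, ha, hb, by omega⟩
  | succ N ih =>
    intro a s hN ha
    by_cases hb : b.Holds s
    · obtain ⟨a', t, s', hr, ha', hle⟩ := hstep a s ha hb
      obtain ⟨a'', t', s'', hr', ha'', hb', hle'⟩ := ih a' s' (by omega) ha'
      exact ⟨a'', _, s'', .while_true hb hr hr', ha'', hb', by omega⟩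
    · exact ⟨a, _, s, .while_false hb, ha, hb, by omega⟩

/-- The version of `exists_run_while` for represented states. -/
theorem run_while {α : Type*} {ω : ℕ → unitInterval} {c : Cond} {p : Prog}
    (I : α → Env → Store → Prop) (φ : α → ℕ)
    (hok : ∀ a E A, I a E A → c.Ok E A)
    (hstep : ∀ a E A s, I a E A → Rep E s A → c.Holds E A →
      ∃ a' E' A' t s', Run ω p s t s' ∧ Rep E' s' A' ∧ I a' E' A' ∧
        c.compile.cost + t + φ a' ≤ φ a)
    {a : α} {E : Env} {A : Store} {s : State} (ha : I a E A) (hR : Rep E s A) :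
    ∃ a' E' A' t s', Run ω (.while c.compile p) s t s' ∧ Rep E' s' A' ∧ I a' E' A' ∧
      ¬ c.Holds E' A' ∧ t + φ a' ≤ φ a + c.compile.cost := by
  obtain ⟨a', t, s', hr, ⟨E', A', hI', hR'⟩, hb, hle⟩ := exists_run_while (ω := ω)
    (b := c.compile) (c := p) (fun a s => ∃ E A, I a E A ∧ Rep E s A) φ (by
      rintro a s ⟨E, A, hI, hR⟩ hb
      obtain ⟨a', E', A', t, s', hr, hR', hI', hle⟩ :=
        hstep a E A s hI hR ((Cond.holds_compile hR c (hok a E A hI)).1 hb)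
      exact ⟨a', t, s', hr, ⟨E', A', hI', hR'⟩, hle⟩) a s ⟨E, A, ha, hR⟩
  exact ⟨a', E', A', t, s', hr, hR', hI',
    fun hc => hb ((Cond.holds_compile hR' c (hok _ _ _ hI')).2 hc), hle⟩

/-! ### One round: pruned Dijkstra search with a stack of intervals as priority queue -/

/-- The data that a round does not change: the number `n` of vertices, the largest relevant distance
`T`, the center `src` and the label `lab` of its cluster, and the graph. The arcs of the vertex `v`
are numbered by every second number from `start v` on, up to `start (v + 1)`; `tgt e` is the target
and `wt e` the integer length of the arc `e`. -/
structure Net where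
  n : ℕ
  T : ℕ
  src : ℕ
  lab : ℕ
  start : ℕ → ℕ
  tgt : ℕ → ℕ
  wt : ℕ → ℕ

/-- `e` is an arc of the vertex `v`. -/
def Net.IsArc (X : Net) (v e : ℕ) : Prop :=
  v < X.n ∧ X.start v ≤ e ∧ e < X.start (v + 1) ∧ 2 ∣ e - X.start v

/-- The arcs lead to vertices, and the arc lists consist of pairs of cells. -/
structure Net.Valid (X : Net) : Prop where
  tgt_lt : ∀ v e, X.IsArc v e → X.tgt e < X.n
  start_dvd : ∀ v < X.n, 2 ∣ X.start (v + 1) - X.start v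
  lab_pos : 0 < X.lab

/-- The state of a search. `dist` and `label` are the tentative distances and labels. An item `(v,
k)` of the queue stands for the vertex `v` with tentative distance `k`; it is out of date if `dist v
< k`. The bucket `B b`, `1 ≤ b ≤ sp`, holds items with `k ∈ [lo b, lo (b - 1))`; the items in `q`
wait for their bucket, which is `B (pos v)` or a later one. The arcs from `e` up to `e₁`, of a
vertex at distance `k`, have yet to be relaxed. -/
structure Search where
  dist : ℕ → ℕ
  label : ℕ → ℕ
  pos : ℕ → ℕ
  lo : ℕ → ℕ
  q : List (ℕ × ℕ)
  B : ℕ → List (ℕ × ℕ)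
  sp : ℕ
  e : ℕ
  e₁ : ℕ
  k : ℕ
  flag : ℕ

namespace Search

open Function (update)

/-- Relax the arc `e`. -/
def relax (X : Net) (st : Search) : Search :=
  if st.k + X.wt st.e < st.dist (X.tgt st.e) then
    { st with
      e := st.e + 2
      dist := update st.dist (X.tgt st.e) (st.k + X.wt st.e)
      label := if st.label (X.tgt st.e) = 0 then update st.label (X.tgt st.e) X.lab else st.label
      q := (X.tgt st.e, st.k + X.wt st.e) :: st.q }
  else { st with e := st.e + 2 }

/-- Treat the first waiting item `(u, c)`: drop it if it is out of date, else move it into its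
bucket or advance `pos u` towards its bucket. -/
def place (st : Search) (u c : ℕ) (q : List (ℕ × ℕ)) : Search :=
  if st.dist u < c then { st with q := q }
  else if c < st.lo (st.pos u) then { st with pos := update st.pos u (st.pos u + 1) }
  else { st with q := q, B := update st.B (st.pos u) ((u, c) :: st.B (st.pos u)) }

/-- Halve the interval of the last bucket; its items have to wait for their new bucket. -/
def split (st : Search) : Search :=
  { st with
    q := st.B st.sp
    B := update (update st.B st.sp []) (st.sp + 1) []
    lo := update (update st.lo st.sp ((st.lo st.sp + st.lo (st.sp - 1)) / 2)) (st.sp + 1)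
      (st.lo st.sp)
    sp := st.sp + 1 }

open Classical in
/-- Remove the first item `(v, c)` from the last bucket, whose interval consists of one number;
unless it is out of date, `c` is the distance of `v`, and the arcs of `v` are to be relaxed. The
flag is raised if `v` gets its label in this round at a distance too close to `T`. -/
noncomputable def settle (X : Net) (st : Search) (v c : ℕ) (l : List (ℕ × ℕ)) : Search :=
  if st.dist v < c then { st with B := update st.B st.sp l }
  else
    { st with
      B := update st.B st.sp l
      pos := update st.pos v 0
      flag := if st.label v = X.lab ∧ X.T < c + X.n then 1 else st.flag
      k := c
      e := X.start v
      e₁ := X.start (v + 1) }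

/-- One step of the search. -/
noncomputable def step (X : Net) (st : Search) : Search :=
  if st.e < st.e₁ then st.relax X
  else match st.q with
  | (u, c) :: q => st.place u c q
  | [] => match st.B st.sp with
    | [] => { st with sp := st.sp - 1 }
    | (v, c) :: l =>
      if st.lo st.sp + 1 < st.lo (st.sp - 1) then st.split else st.settle X v c l

/-- The item `p` is in the queue. -/
def Mem (st : Search) (p : ℕ × ℕ) : Prop := p ∈ st.q ∨ ∃ b, 1 ≤ b ∧ b ≤ st.sp ∧ p ∈ st.B b

/-- The invariant of a search. Here `d₀` and `l₀` are the distances and labels before the round,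
`f₀` the flag before the round, `D` are the distances from the center of the round, `S` is the set
of the settled vertices, and `cur` is the vertex settled last.

Correctness rests on `le_dist`, `live` and `relaxed`: tentative distances are never too small, and a
vertex whose distance has been lowered is waiting in the queue or has passed its distance on. The
running time rests on `lo_lt`, `len_le`, `len_pow` and on the items: no key lies below the last
interval, so that a settled vertex is never reached again, and there are at most `depth` buckets. An
item `(v, dist v)` that is up to date occurs only once; if it is in a bucket, then in `B (pos v)`.
-/
structure Inv (X : Net) (d₀ D l₀ : ℕ → ℕ) (f₀ : ℕ) (st : Search) (S : Finset ℕ) (cur : ℕ) :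
    Prop where
  dist_le : ∀ v, st.dist v ≤ d₀ v
  src_dist : st.dist X.src = 0
  le_dist : ∀ v < X.n, min (d₀ v) (D v) ≤ st.dist v
  lo_zero : st.lo 0 = X.T + 1
  lo_lt : ∀ b < st.sp, st.lo (b + 1) < st.lo b
  len_le : ∀ b, b + 1 < st.sp → st.lo (b + 1) - st.lo (b + 2) ≤ st.lo b - st.lo (b + 1)
  len_pow : ∀ b < st.sp, (st.lo b - st.lo (b + 1)) * 2 ^ b ≤ X.T + 1
  item : ∀ p, st.Mem p → p.1 < X.n ∧ st.dist p.1 ≤ p.2 ∧ st.lo st.sp ≤ p.2 ∧ p.2 < d₀ p.1 ∧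
    D p.1 ≤ p.2
  q_item : ∀ p ∈ st.q, p.2 = st.dist p.1 →
    p.1 ∉ S ∧ st.pos p.1 ≤ st.sp ∧ p.2 < st.lo (st.pos p.1 - 1)
  B_item : ∀ b, 1 ≤ b → b ≤ st.sp → ∀ p ∈ st.B b, st.lo b ≤ p.2 ∧ p.2 < st.lo (b - 1) ∧
    (p.2 = st.dist p.1 → p.1 ∉ S ∧ st.pos p.1 = b)
  q_nodup : st.q.Nodup
  B_nodup : ∀ b, 1 ≤ b → b ≤ st.sp → (st.B b).Nodup
  disjoint : ∀ p ∈ st.q, ∀ b, 1 ≤ b → b ≤ st.sp → p ∉ st.B b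
  settled : ∀ v ∈ S, v < X.n ∧ st.dist v < d₀ v ∧ st.dist v ≤ st.lo st.sp
  live : ∀ v < X.n, st.dist v < d₀ v → v ∈ S ∨ st.Mem (v, st.dist v)
  pos_ne : ∀ v, st.pos v ≠ 0 → st.Mem (v, st.dist v)
  relaxed : ∀ v ∈ S, ∀ e, X.IsArc v e → (v = cur → e < st.e) →
    st.dist (X.tgt e) ≤ st.dist v + X.wt e
  cur_end : cur ∈ S → st.e₁ = X.start (cur + 1)
  current : st.e < st.e₁ → cur ∈ S ∧ X.IsArc cur st.e ∧ st.k = st.dist cur ∧ st.k = st.lo st.sp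
  idle : st.sp = 0 → st.q = [] ∧ st.e₁ ≤ st.e
  label : ∀ v < X.n, st.label v =
    if d₀ v ≤ X.T then l₀ v else if st.dist v ≤ X.T then X.lab else 0
  flag_ne : st.flag ≠ 0 → f₀ ≠ 0 ∨ ∃ v ∈ S, st.dist v ≤ X.T ∧ X.T < st.dist v + X.n
  flag_eq : st.flag = 0 → f₀ = 0 ∧ ∀ v ∈ S, st.label v = X.lab → st.dist v + X.n ≤ X.T

/-- The hypotheses on the distances and labels before a round, and on the distances from its
center. -/
structure Setup (X : Net) (d₀ D l₀ : ℕ → ℕ) : Prop where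
  d_le : ∀ v < X.n, d₀ v ≤ X.T + 1
  d_arc : ∀ v e, X.IsArc v e → d₀ (X.tgt e) ≤ d₀ v + X.wt e
  D_arc : ∀ v e, X.IsArc v e → D (X.tgt e) ≤ D v + X.wt e
  l_ne : ∀ v < X.n, (l₀ v = 0 ↔ X.T < d₀ v)

/-- An upper bound for the number of buckets. -/
def depth (X : Net) : ℕ := Nat.clog 2 (X.T + 1) + 1

/-- The logarithm of the length of the interval of the bucket `b`. For the bucket `0`, which stands
for an item that has not been in any bucket yet, it is an upper bound of all others. -/
def size (X : Net) (lo : ℕ → ℕ) (b : ℕ) : ℕ :=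
  if b = 0 then depth X else Nat.clog 2 (lo (b - 1) - lo b)

/-- The vertices that are reached in a round. -/
def reached (X : Net) (d₀ D : ℕ → ℕ) : Finset ℕ := (Finset.range X.n).filter fun v => D v < d₀ v

open Classical in
/-- The contribution of a vertex that is not settled yet to the potential: it pays for the moves of
its item through the buckets and for its arcs. -/
noncomputable def vertexPot (X : Net) (st : Search) (v : ℕ) : ℕ :=
  3 * (size X st.lo (st.pos v) + (depth X - st.pos v)) + (if (v, st.dist v) ∈ st.q then 3 else 0) +
    6 * (X.start (v + 1) - X.start v)

/-- The potential of a search. An item pays more while it is in a bucket, since it may have to wait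
again; this is what pays for the splitting of buckets. -/
noncomputable def pot (X : Net) (d₀ D : ℕ → ℕ) (st : Search) (S : Finset ℕ) : ℕ :=
  3 * st.q.length + 5 * ∑ b ∈ Finset.range st.sp, (st.B (b + 1)).length + st.sp +
    6 * (st.e₁ - st.e) + ∑ v ∈ reached X d₀ D \ S, vertexPot X st v

section
variable {X : Net} {d₀ D l₀ : ℕ → ℕ} {f₀ : ℕ} {st : Search} {S : Finset ℕ} {cur : ℕ}

theorem Inv.lo_anti (h : Inv X d₀ D l₀ f₀ st S cur) {b c : ℕ} (hbc : b ≤ c) (hc : c ≤ st.sp) :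
    st.lo c ≤ st.lo b := by
  induction c, hbc using Nat.le_induction with
  | base => exact le_rfl
  | succ c hbc ih => exact (h.lo_lt c (by omega)).le.trans (ih (by omega))

theorem Inv.sp_le (h : Inv X d₀ D l₀ f₀ st S cur) : st.sp ≤ depth X := by
  rcases Nat.eq_zero_or_pos st.sp with h0 | h0
  · omega
  · have h1 := h.len_pow (st.sp - 1) (by omega)
    have h2 := h.lo_lt (st.sp - 1) (by omega)
    have h3 : 2 ^ (st.sp - 1) ≤ X.T + 1 :=
      le_trans (Nat.le_mul_of_pos_left _ (by omega)) h1
    have h4 : st.sp - 1 ≤ Nat.clog 2 (X.T + 1) :=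
      (Nat.pow_le_pow_iff_right one_lt_two).1 (h3.trans (Nat.le_pow_clog one_lt_two _))
    unfold depth
    omega

theorem Inv.size_succ_le (h : Inv X d₀ D l₀ f₀ st S cur) {b : ℕ} (hb : b < st.sp) :
    size X st.lo (b + 1) ≤ size X st.lo b := by
  rcases b with _ | b
  · have : Nat.clog 2 (st.lo 0 - st.lo 1) ≤ Nat.clog 2 (X.T + 1) :=
      Nat.clog_mono_right _ (by have := h.lo_zero; omega)
    simp only [size, depth, zero_add, one_ne_zero, if_false, if_true, Nat.sub_self]
    omega
  · simp only [size, Nat.add_sub_cancel, Nat.succ_ne_zero, if_false]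
    exact Nat.clog_mono_right _ (h.len_le b hb)

theorem Inv.mem_reached (h : Inv X d₀ D l₀ f₀ st S cur) {p : ℕ × ℕ} (hp : st.Mem p) :
    p.1 ∈ reached X d₀ D := by
  have := h.item p hp
  simp only [reached, Finset.mem_filter, Finset.mem_range]
  omega

/-! ### Steps that move the items of the queue -/

/-- An item that is out of date can be dropped, since the current distance of its
vertex is in the queue or has been settled. -/
theorem Inv.drop (h : Inv X d₀ D l₀ f₀ st S cur) {u c : ℕ} {q : List (ℕ × ℕ)}
    (hq : st.q = (u, c) :: q) (hc : st.dist u < c) :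
    Inv X d₀ D l₀ f₀ { st with q := q } S cur ∧
      pot X d₀ D { st with q := q } S < pot X d₀ D st S := by
  have hsub : ∀ p ∈ q, p ∈ st.q := fun p hp => by simp [hq, hp]
  have hmem : ∀ p, ({ st with q := q } : Search).Mem p → st.Mem p :=
    fun p hp => hp.imp (hsub p) id
  have hlive : ∀ v, st.Mem (v, st.dist v) → ({ st with q := q } : Search).Mem (v, st.dist v) := by
    rintro v (hv | hv)
    · refine Or.inl ?_
      rw [hq, List.mem_cons, Prod.mk.injEq] at hv
      rcases hv with ⟨rfl, hv⟩ | hv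
      · omega
      · exact hv
    · exact Or.inr hv
  refine ⟨{ h with
    item := fun p hp => h.item p (hmem p hp)
    q_item := fun p hp => h.q_item p (hsub p hp)
    q_nodup := (List.nodup_cons.1 (hq ▸ h.q_nodup)).2
    disjoint := fun p hp => h.disjoint p (hsub p hp)
    live := fun v hv hd => (h.live v hv hd).imp id (hlive v)
    pos_ne := fun v hv => hlive v (h.pos_ne v hv)
    idle := fun h0 => absurd (h.idle h0).1 (by simp [hq]) }, ?_⟩
  have hsum : ∑ v ∈ reached X d₀ D \ S, vertexPot X { st with q := q } v ≤
      ∑ v ∈ reached X d₀ D \ S, vertexPot X st v := by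
    refine Finset.sum_le_sum fun v _ => ?_
    simp only [vertexPot]
    have := hsub (v, st.dist v)
    split_ifs <;> first | omega | (exfalso; tauto)
  simp only [pot, hq, List.length_cons]
  omega

/-- An item whose key is too small for the bucket `pos u` belongs to a later bucket. The intervals
of later buckets are not longer, so that the potential of `u` decreases. -/
theorem Inv.advance (h : Inv X d₀ D l₀ f₀ st S cur) {u c : ℕ} {q : List (ℕ × ℕ)}
    (hq : st.q = (u, c) :: q) (hc : ¬ st.dist u < c) (hlo : c < st.lo (st.pos u)) :
    Inv X d₀ D l₀ f₀ { st with pos := update st.pos u (st.pos u + 1) } S cur ∧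
      pot X d₀ D { st with pos := update st.pos u (st.pos u + 1) } S < pot X d₀ D st S := by
  have hmem : (u, c) ∈ st.q := by simp [hq]
  obtain ⟨hu, hle, hlosp, hd₀, hD⟩ := h.item _ (Or.inl hmem)
  obtain rfl : c = st.dist u := by simp only at hle; omega
  obtain ⟨huS, hpos, hlt⟩ := h.q_item _ hmem rfl
  simp only at hu hle hlosp hd₀ hD huS hpos hlt
  have hpos' : st.pos u < st.sp := by
    rcases hpos.lt_or_eq with hp | hp
    · exact hp
    · rw [hp] at hlo; omega
  refine ⟨{ h with
    q_item := fun p hp he => ?_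
    B_item := fun b hb hb' p hp => ⟨(h.B_item b hb hb' p hp).1, (h.B_item b hb hb' p hp).2.1,
      fun he => ?_⟩
    pos_ne := fun v hv => ?_ }, ?_⟩
  · by_cases hpu : p.1 = u
    · simp only [hpu, Function.update_self, Nat.add_sub_cancel] at he ⊢
      exact ⟨huS, hpos', by rw [he]; exact hlo⟩
    · simpa [hpu] using h.q_item p hp he
  · by_cases hpu : p.1 = u
    · have : p = (u, st.dist u) := Prod.ext hpu (by rw [← hpu]; exact he)
      exact absurd (this ▸ hp) (h.disjoint _ hmem b hb hb')
    · simpa [hpu] using (h.B_item b hb hb' p hp).2.2 he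
  · by_cases hvu : v = u
    · subst hvu; exact Or.inl hmem
    · exact h.pos_ne v (by simpa [hvu] using hv)
  · have hlt : ∑ v ∈ reached X d₀ D \ S,
        vertexPot X { st with pos := update st.pos u (st.pos u + 1) } v <
        ∑ v ∈ reached X d₀ D \ S, vertexPot X st v := by
      have hsz := h.size_succ_le hpos'
      have hsp := h.sp_le
      refine Finset.sum_lt_sum (fun v _ => ?_) ⟨u, ?_, ?_⟩
      · by_cases hvu : v = u
        · subst hvu
          simp only [vertexPot, Function.update_self]
          omega
        · simp [vertexPot, hvu]
      · exact Finset.mem_sdiff.2 ⟨h.mem_reached (Or.inl hmem), huS⟩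
      · simp only [vertexPot, Function.update_self]
        omega
    simp only [pot]
    omega

theorem sum_length_update {B : ℕ → List (ℕ × ℕ)} {sp b : ℕ} (hb : 1 ≤ b) (hb' : b ≤ sp)
    (l : List (ℕ × ℕ)) :
    ∑ c ∈ Finset.range sp, (update B b l (c + 1)).length + (B b).length =
      ∑ c ∈ Finset.range sp, (B (c + 1)).length + l.length := by
  obtain ⟨b, rfl⟩ : ∃ a, b = a + 1 := ⟨b - 1, by omega⟩
  have hm : b ∈ Finset.range sp := Finset.mem_range.2 hb'
  rw [← Finset.add_sum_erase _ _ hm, ← Finset.add_sum_erase (Finset.range sp) _ hm]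
  have : ∑ c ∈ (Finset.range sp).erase b, (update B (b + 1) l (c + 1)).length =
      ∑ c ∈ (Finset.range sp).erase b, (B (c + 1)).length :=
    Finset.sum_congr rfl fun c hc => by
      rw [Function.update_of_ne]
      have := Finset.ne_of_mem_erase hc
      omega
  rw [this, Function.update_self]
  omega

/-- The item pays more in a bucket, but the vertex no longer pays for an item that waits. -/
theorem Inv.store (h : Inv X d₀ D l₀ f₀ st S cur) (hs : Setup X d₀ D l₀) {u c : ℕ}
    {q : List (ℕ × ℕ)} (hq : st.q = (u, c) :: q) (hc : ¬ st.dist u < c)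
    (hlo : ¬ c < st.lo (st.pos u)) :
    Inv X d₀ D l₀ f₀ { st with q := q, B := update st.B (st.pos u) ((u, c) :: st.B (st.pos u)) } S
        cur ∧
      pot X d₀ D { st with q := q, B := update st.B (st.pos u) ((u, c) :: st.B (st.pos u)) } S <
        pot X d₀ D st S := by
  have hmem : (u, c) ∈ st.q := by simp [hq]
  have hsub : ∀ p ∈ q, p ∈ st.q := fun p hp => by simp [hq, hp]
  obtain ⟨hu, hle, hlosp, hd₀, hD⟩ := h.item _ (Or.inl hmem)
  obtain rfl : c = st.dist u := by simp only at hle; omega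
  obtain ⟨huS, hpos, hlt⟩ := h.q_item _ hmem rfl
  simp only at hu hle hlosp hd₀ hD huS hpos hlt
  have hnd := h.q_nodup
  rw [hq, List.nodup_cons] at hnd
  have hpos1 : 1 ≤ st.pos u := by
    by_contra h0
    have h1 : st.pos u = 0 := by omega
    rw [h1, h.lo_zero] at hlo
    have := hs.d_le u hu
    omega
  have hB : ∀ b p, p ∈ update st.B (st.pos u) ((u, st.dist u) :: st.B (st.pos u)) b →
      (p = (u, st.dist u) ∧ b = st.pos u) ∨ p ∈ st.B b := by
    intro b p hp
    by_cases hb : b = st.pos u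
    · subst hb
      rw [Function.update_self, List.mem_cons] at hp
      exact hp.imp (fun h => ⟨h, rfl⟩) id
    · rw [Function.update_of_ne hb] at hp
      exact Or.inr hp
  have hB' : ∀ b p, p ∈ st.B b →
      p ∈ update st.B (st.pos u) ((u, st.dist u) :: st.B (st.pos u)) b := by
    intro b p hp
    by_cases hb : b = st.pos u
    · subst hb
      rw [Function.update_self, List.mem_cons]
      exact Or.inr hp
    · rwa [Function.update_of_ne hb]
  set st' : Search :=
    { st with q := q, B := update st.B (st.pos u) ((u, st.dist u) :: st.B (st.pos u)) } with hst'
  have hmemI : ∀ p, st'.Mem p ↔ st.Mem p := by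
    intro p
    constructor
    · rintro (hp | ⟨b, hb, hb', hp⟩)
      · exact Or.inl (hsub p hp)
      · rcases hB b p hp with ⟨rfl, -⟩ | hp
        · exact Or.inl hmem
        · exact Or.inr ⟨b, hb, hb', hp⟩
    · rintro (hp | ⟨b, hb, hb', hp⟩)
      · rw [hq, List.mem_cons] at hp
        rcases hp with rfl | hp
        · exact Or.inr ⟨st.pos u, hpos1, hpos, by simp [hst']⟩
        · exact Or.inl hp
      · exact Or.inr ⟨b, hb, hb', hB' b p hp⟩
  refine ⟨{ h with
    item := fun p hp => h.item p ((hmemI p).1 hp)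
    q_item := fun p hp => h.q_item p (hsub p hp)
    B_item := fun b hb hb' p hp => ?_
    q_nodup := hnd.2
    B_nodup := fun b hb hb' => ?_
    disjoint := fun p hp b hb hb' hpB => ?_
    live := fun v hv hd => (h.live v hv hd).imp id (hmemI _).2
    pos_ne := fun v hv => (hmemI _).2 (h.pos_ne v hv)
    idle := fun h0 => absurd (h.idle h0).1 (by simp [hq]) }, ?_⟩
  · rcases hB b p hp with ⟨rfl, rfl⟩ | hp
    · exact ⟨not_lt.1 hlo, hlt, fun _ => ⟨huS, rfl⟩⟩
    · exact h.B_item b hb hb' p hp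
  · simp only [hst']
    by_cases hbu : b = st.pos u
    · subst hbu
      rw [Function.update_self, List.nodup_cons]
      exact ⟨h.disjoint _ hmem _ hb hb', h.B_nodup _ hb hb'⟩
    · rw [Function.update_of_ne hbu]
      exact h.B_nodup _ hb hb'
  · rcases hB b p hpB with ⟨rfl, -⟩ | hpB
    · exact hnd.1 hp
    · exact h.disjoint p (hsub p hp) b hb hb' hpB
  · have hlt : ∑ v ∈ reached X d₀ D \ S, vertexPot X st' v + 3 ≤
        ∑ v ∈ reached X d₀ D \ S, vertexPot X st v := by
      have hu' : u ∈ reached X d₀ D \ S :=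
        Finset.mem_sdiff.2 ⟨h.mem_reached (Or.inl hmem), huS⟩
      rw [← Finset.add_sum_erase _ _ hu', ← Finset.add_sum_erase _ (vertexPot X st) hu']
      have h1 : vertexPot X st' u + 3 = vertexPot X st u := by
        simp only [vertexPot, hst', if_neg hnd.1, if_pos hmem]
        omega
      have h2 : ∑ v ∈ (reached X d₀ D \ S).erase u, vertexPot X st' v ≤
          ∑ v ∈ (reached X d₀ D \ S).erase u, vertexPot X st v := by
        refine Finset.sum_le_sum fun v _ => ?_
        simp only [vertexPot, hst']
        have := hsub (v, st.dist v)
        split_ifs <;> first | omega | (exfalso; tauto)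
      omega
    have hlen := sum_length_update (B := st.B) hpos1 hpos ((u, st.dist u) :: st.B (st.pos u))
    simp only [List.length_cons] at hlen
    simp only [pot, hq, List.length_cons, hst'] at hlt ⊢
    omega

/-- An empty last bucket can be removed: all keys lie in the intervals of earlier buckets. -/
theorem Inv.pop (h : Inv X d₀ D l₀ f₀ st S cur) (he : ¬ st.e < st.e₁) (hsp : 1 ≤ st.sp)
    (hq : st.q = []) (hB : st.B st.sp = []) :
    Inv X d₀ D l₀ f₀ { st with sp := st.sp - 1 } S cur ∧
      pot X d₀ D { st with sp := st.sp - 1 } S < pot X d₀ D st S := by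
  have hmemI : ∀ p, ({ st with sp := st.sp - 1 } : Search).Mem p ↔ st.Mem p := by
    intro p
    simp only [Mem]
    refine or_congr_right ⟨fun ⟨b, hb, hb', hp⟩ => ⟨b, hb, by omega, hp⟩,
      fun ⟨b, hb, hb', hp⟩ => ⟨b, hb, ?_, hp⟩⟩
    rcases hb'.lt_or_eq with h1 | h1
    · omega
    · rw [h1, hB] at hp; simp at hp
  have hle : st.lo st.sp ≤ st.lo (st.sp - 1) := h.lo_anti (by omega) le_rfl
  refine ⟨{ h with
    lo_lt := fun b hb => h.lo_lt b (by simp only at hb; omega)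
    len_le := fun b hb => h.len_le b (by simp only at hb; omega)
    len_pow := fun b hb => h.len_pow b (by simp only at hb; omega)
    item := fun p hp => ?_
    q_item := fun p hp => absurd hp (by simp [hq])
    B_item := fun b hb hb' => h.B_item b hb (by simp only at hb'; omega)
    B_nodup := fun b hb hb' => h.B_nodup b hb (by simp only at hb'; omega)
    disjoint := fun p hp => absurd hp (by simp [hq])
    settled := fun v hv => ⟨(h.settled v hv).1, (h.settled v hv).2.1,
      (h.settled v hv).2.2.trans hle⟩
    live := fun v hv hd => (h.live v hv hd).imp id (hmemI _).2
    pos_ne := fun v hv => (hmemI _).2 (h.pos_ne v hv)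
    current := fun h1 => absurd h1 he
    idle := fun _ => ⟨hq, not_lt.1 he⟩ }, ?_⟩
  · have hp' := (hmemI p).1 hp
    obtain ⟨h1, h2, h3, h4, h5⟩ := h.item p hp'
    refine ⟨h1, h2, ?_, h4, h5⟩
    rcases hp with hp | ⟨b, hb, hb', hp⟩
    · simp [hq] at hp
    · simp only at hb' hp ⊢
      exact (h.lo_anti hb' (by omega)).trans (h.B_item b hb (by omega) p hp).1
  · obtain ⟨sp, hsp'⟩ : ∃ a, st.sp = a + 1 := ⟨st.sp - 1, by omega⟩
    have hv : ∑ v ∈ reached X d₀ D \ S, vertexPot X { st with sp := st.sp - 1 } v =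
        ∑ v ∈ reached X d₀ D \ S, vertexPot X st v := rfl
    simp only [pot, hv]
    simp only [hsp', Nat.add_sub_cancel, Finset.sum_range_succ]
    omega

/-! ### Steps that split buckets, settle vertices and relax arcs -/

/-- When the last bucket is split, the logarithm of the length of its interval drops by one. This
pays for moving the items that are up to date; the others are moved at the expense of their place in
a bucket. -/
theorem Inv.split (h : Inv X d₀ D l₀ f₀ st S cur) (he : ¬ st.e < st.e₁) (hsp : 1 ≤ st.sp)
    (hq : st.q = []) (hB : st.B st.sp ≠ []) (hlen : st.lo st.sp + 1 < st.lo (st.sp - 1)) :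
    Inv X d₀ D l₀ f₀ st.split S cur ∧ pot X d₀ D st.split S < pot X d₀ D st S := by
  obtain ⟨s, hs⟩ : ∃ s, st.sp = s + 1 := ⟨st.sp - 1, by omega⟩
  obtain ⟨mid, hmid⟩ : ∃ m, m = (st.lo (s + 1) + st.lo s) / 2 := ⟨_, rfl⟩
  rw [hs, Nat.add_sub_cancel] at hlen
  have hlo : st.split.lo = update (update st.lo (s + 1) mid) (s + 2) (st.lo (s + 1)) := by
    simp only [Search.split, hs, Nat.add_sub_cancel, hmid]
  have hlo1 : ∀ b ≤ s, st.split.lo b = st.lo b := fun b hb => by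
    rw [hlo, Function.update_of_ne (by omega), Function.update_of_ne (by omega)]
  have hlo2 : st.split.lo (s + 1) = mid := by
    rw [hlo, Function.update_of_ne (by omega), Function.update_self]
  have hlo3 : st.split.lo (s + 2) = st.lo (s + 1) := by rw [hlo, Function.update_self]
  have hB1 : ∀ b ≤ s, st.split.B b = st.B b := fun b hb => by
    simp only [Search.split, hs]
    rw [Function.update_of_ne (by omega), Function.update_of_ne (by omega)]
  have hB2 : ∀ b, s < b → b ≤ s + 2 → st.split.B b = [] := fun b hb hb' => by
    simp only [Search.split, hs]
    rcases (by omega : b = s + 1 ∨ b = s + 2) with rfl | rfl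
    · rw [Function.update_of_ne (by omega), Function.update_self]
    · rw [Function.update_self]
  have hsp' : st.split.sp = s + 2 := by simp [Search.split, hs]
  have hq' : st.split.q = st.B (s + 1) := by simp [Search.split, hs]
  have hmemI : ∀ p, st.split.Mem p ↔ st.Mem p := by
    intro p
    simp only [Mem, hsp', hq', hs, hq]
    constructor
    · rintro (hp | ⟨b, hb, hb', hp⟩)
      · exact Or.inr ⟨s + 1, by omega, le_rfl, hp⟩
      · by_cases hbs : b ≤ s
        · exact Or.inr ⟨b, hb, by omega, hB1 b hbs ▸ hp⟩
        · rw [hB2 b (by omega) hb'] at hp; simp at hp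
    · rintro (hp | ⟨b, hb, hb', hp⟩)
      · simp at hp
      · rcases hb'.lt_or_eq with hbs | rfl
        · exact Or.inr ⟨b, hb, by omega, (hB1 b (by omega)).symm ▸ hp⟩
        · exact Or.inl hp
  have hl1 := h.lo_lt s (by omega)
  have hpow := h.len_pow s (by omega)
  have hlo_sp : st.split.lo st.split.sp = st.lo st.sp := by rw [hsp', hlo3, hs]
  refine ⟨{
    dist_le := h.dist_le
    src_dist := h.src_dist
    le_dist := h.le_dist
    lo_zero := by rw [hlo1 0 (by omega), h.lo_zero]
    lo_lt := fun b hb => ?_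
    len_le := fun b hb => ?_
    len_pow := fun b hb => ?_
    item := fun p hp => by rw [hlo_sp]; exact h.item p ((hmemI p).1 hp)
    q_item := fun p hp hpd => ?_
    B_item := fun b hb hb' p hp => ?_
    q_nodup := by rw [hq']; exact h.B_nodup _ (by omega) (by omega)
    B_nodup := fun b hb hb' => ?_
    disjoint := fun p hp b hb hb' hpB => ?_
    settled := fun v hv => by rw [hlo_sp]; exact h.settled v hv
    live := fun v hv hd => (h.live v hv hd).imp id (hmemI _).2
    pos_ne := fun v hv => (hmemI _).2 (h.pos_ne v hv)
    relaxed := h.relaxed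
    cur_end := h.cur_end
    current := fun h1 => absurd h1 he
    idle := fun h0 => by omega
    label := h.label
    flag_ne := h.flag_ne
    flag_eq := h.flag_eq }, ?_⟩
  · rw [hsp'] at hb
    rcases (by omega : b < s ∨ b = s ∨ b = s + 1) with hb | rfl | rfl
    · rw [hlo1 _ (by omega), hlo1 _ (by omega)]
      exact h.lo_lt b (by omega)
    · rw [hlo1 _ le_rfl, hlo2]; omega
    · rw [hlo2, hlo3]; omega
  · rw [hsp'] at hb
    rcases (by omega : b + 1 < s ∨ b + 1 = s ∨ b = s) with hb | rfl | rfl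
    · rw [hlo1 _ (by omega), hlo1 _ (by omega), hlo1 _ (by omega)]
      exact h.len_le b (by omega)
    · have : st.lo (b + 1) - st.lo (b + 1 + 1) ≤ st.lo b - st.lo (b + 1) := h.len_le b (by omega)
      rw [hlo1 (b + 1) le_rfl, hlo1 b (by omega), hlo2]
      omega
    · rw [hlo1 b le_rfl, hlo2, hlo3]
      omega
  · rw [hsp'] at hb
    rcases (by omega : b < s ∨ b = s ∨ b = s + 1) with hb | rfl | rfl
    · rw [hlo1 _ (by omega), hlo1 _ (by omega)]
      exact h.len_pow b (by omega)
    · rw [hlo1 _ (by omega), hlo2]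
      exact (Nat.mul_le_mul_right _ (by omega)).trans hpow
    · rw [hlo2, hlo3]
      refine le_trans ?_ hpow
      rw [pow_succ, mul_comm (2 ^ s), ← mul_assoc]
      exact Nat.mul_le_mul_right _ (by omega)
  · rw [hq'] at hp
    obtain ⟨h1, h2, h3⟩ := h.B_item (s + 1) (by omega) (by omega) p hp
    obtain ⟨h4, h5⟩ := h3 hpd
    have h6 : st.split.pos p.1 = s + 1 := h5
    rw [h6, hsp', Nat.add_sub_cancel, hlo1 _ le_rfl]
    exact ⟨h4, by omega, h2⟩
  · rw [hsp'] at hb'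
    by_cases hbs : b ≤ s
    · rw [hB1 b hbs] at hp
      rw [hlo1 b hbs, hlo1 (b - 1) (by omega)]
      exact h.B_item b hb (by omega) p hp
    · rw [hB2 b (by omega) hb'] at hp; simp at hp
  · rw [hsp'] at hb'
    by_cases hbs : b ≤ s
    · rw [hB1 b hbs]; exact h.B_nodup b hb (by omega)
    · rw [hB2 b (by omega) hb']; simp
  · rw [hsp'] at hb'
    rw [hq'] at hp
    by_cases hbs : b ≤ s
    · rw [hB1 b hbs] at hpB
      have h1 := (h.B_item _ (by omega) (by omega) p hp).2.1
      have h2 := (h.B_item b hb (by omega) p hpB).1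
      have h3 := h.lo_anti hbs (by omega)
      rw [Nat.add_sub_cancel] at h1
      omega
    · rw [hB2 b (by omega) hb'] at hpB; simp at hpB
  · have hsum : ∑ v ∈ reached X d₀ D \ S, vertexPot X st.split v ≤
        ∑ v ∈ reached X d₀ D \ S, vertexPot X st v := by
      refine Finset.sum_le_sum fun v _ => ?_
      have hpos : st.split.pos = st.pos := rfl
      have hdist : st.split.dist = st.dist := rfl
      have hsize : ∀ b ≤ s, size X st.split.lo b = size X st.lo b := fun b hb => by
        unfold size; rw [hlo1 b hb, hlo1 (b - 1) (by omega)]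
      have hpl : st.pos v ≠ 0 → (v, st.dist v) ∈ st.B (st.pos v) ∧ st.pos v ≤ s + 1 := by
        intro hv
        rcases h.pos_ne v hv with hv | ⟨b, hb, hb', hv⟩
        · simp [hq] at hv
        · obtain rfl := ((h.B_item b hb hb' _ hv).2.2 rfl).2
          exact ⟨hv, by simp only at hb'; omega⟩
      simp only [vertexPot, hq', hpos, hdist, hq, List.not_mem_nil, if_false]
      by_cases hv : st.pos v = s + 1
      · have hc : size X st.split.lo (s + 1) + 1 ≤ size X st.lo (s + 1) := by
          simp only [size, Nat.succ_ne_zero, if_false, Nat.add_sub_cancel, hlo2, hlo1 s le_rfl]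
          rw [Nat.clog_of_two_le one_lt_two (by omega : 2 ≤ st.lo s - st.lo (s + 1))]
          exact Nat.succ_le_succ (Nat.clog_mono_right _ (by omega))
        rw [hv]
        split_ifs <;> omega
      · have h1 : st.pos v ≤ s := by
          by_contra h2
          have := hpl (by omega)
          omega
        have h2 : (v, st.dist v) ∉ st.B (s + 1) := fun hm =>
          hv ((h.B_item (s + 1) (by omega) (by omega) _ hm).2.2 rfl).2
        rw [if_neg h2, hsize _ h1]
    have hlen1 : 0 < (st.B (s + 1)).length := List.length_pos_iff.2 (hs ▸ hB)
    have hBsum : ∑ b ∈ Finset.range s, (st.split.B (b + 1)).length =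
        ∑ b ∈ Finset.range s, (st.B (b + 1)).length :=
      Finset.sum_congr rfl fun b hb => by
        rw [hB1 _ (Finset.mem_range.1 hb)]
    have he1 : st.split.e = st.e := rfl
    have he2 : st.split.e₁ = st.e₁ := rfl
    simp only [pot, hsp', hs, hq', he1, he2, Finset.sum_range_succ, hBsum,
      hB2 (s + 1) (by omega) (by omega), hB2 (s + 2) (by omega) (by omega), List.length_nil, hq]
    omega

/-- The last interval consists of one number, and no key is smaller. So the first item of the last
bucket, if it is up to date, has the smallest key, and its vertex can be settled. -/
theorem Inv.settle (h : Inv X d₀ D l₀ f₀ st S cur) (hX : X.Valid) (he : ¬ st.e < st.e₁)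
    (hsp : 1 ≤ st.sp) (hq : st.q = []) {v c : ℕ} {l : List (ℕ × ℕ)}
    (hB : st.B st.sp = (v, c) :: l) (hlen : ¬ st.lo st.sp + 1 < st.lo (st.sp - 1)) :
    ∃ S' cur', Inv X d₀ D l₀ f₀ (st.settle X v c l) S' cur' ∧
      pot X d₀ D (st.settle X v c l) S' < pot X d₀ D st S := by
  have hvB : (v, c) ∈ st.B st.sp := by simp [hB]
  have hvm : st.Mem (v, c) := Or.inr ⟨st.sp, hsp, le_rfl, hvB⟩
  have hnd := h.B_nodup st.sp hsp le_rfl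
  rw [hB, List.nodup_cons] at hnd
  have hBsub : ∀ b p, p ∈ update st.B st.sp l b → p ∈ st.B b := by
    intro b p hp
    by_cases hb : b = st.sp
    · subst hb
      rw [Function.update_self] at hp
      rw [hB]; exact List.mem_cons_of_mem _ hp
    · rwa [Function.update_of_ne hb] at hp
  have hBsup : ∀ b p, p ≠ (v, c) → p ∈ st.B b → p ∈ update st.B st.sp l b := by
    intro b p hne hp
    by_cases hb : b = st.sp
    · subst hb
      rw [Function.update_self]
      rw [hB, List.mem_cons] at hp
      exact hp.resolve_left hne
    · rwa [Function.update_of_ne hb]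
  have hBnd : ∀ b, 1 ≤ b → b ≤ st.sp → (update st.B st.sp l b).Nodup := by
    intro b hb hb'
    by_cases hbs : b = st.sp
    · subst hbs
      rw [Function.update_self]; exact hnd.2
    · rw [Function.update_of_ne hbs]; exact h.B_nodup b hb hb'
  have hlensum := sum_length_update (B := st.B) hsp le_rfl l
  simp only [hB, List.length_cons] at hlensum
  obtain ⟨hv, hle, hlosp, hd₀, hD⟩ := h.item _ hvm
  simp only at hv hle hlosp hd₀ hD
  by_cases hc : st.dist v < c
  · have hst : st.settle X v c l = { st with B := update st.B st.sp l } := by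
      simp only [Search.settle, if_pos hc]
    rw [hst]
    set st' : Search := { st with B := update st.B st.sp l } with hst'
    have hmem : ∀ p, st'.Mem p → st.Mem p := fun p hp =>
      hp.imp id fun ⟨b, hb, hb', hp⟩ => ⟨b, hb, hb', hBsub b p hp⟩
    have hlive : ∀ u, st.Mem (u, st.dist u) → st'.Mem (u, st.dist u) := fun u hu =>
      hu.imp id fun ⟨b, hb, hb', hp⟩ => ⟨b, hb, hb', hBsup b _ (fun e => by
        simp only [Prod.mk.injEq] at e
        obtain ⟨rfl, e⟩ := e
        omega) hp⟩
    refine ⟨S, cur, { h with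
      item := fun p hp => h.item p (hmem p hp)
      B_item := fun b hb hb' p hp => h.B_item b hb hb' p (hBsub b p hp)
      B_nodup := hBnd
      disjoint := fun p hp => absurd hp (by simp [hst', hq])
      live := fun u hu hd => (h.live u hu hd).imp id (hlive u)
      pos_ne := fun u hu => hlive u (h.pos_ne u hu) }, ?_⟩
    have hvp : ∑ u ∈ reached X d₀ D \ S, vertexPot X st' u =
        ∑ u ∈ reached X d₀ D \ S, vertexPot X st u := rfl
    simp only [pot, hvp]
    simp only [hst']
    omega
  · obtain rfl : c = st.dist v := by omega
    have hst : st.settle X v (st.dist v) l =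
      { st with
        B := update st.B st.sp l
        pos := update st.pos v 0
        flag := if st.label v = X.lab ∧ X.T < st.dist v + X.n then 1 else st.flag
        k := st.dist v
        e := X.start v
        e₁ := X.start (v + 1) } := by
      simp only [Search.settle, if_neg hc]
    rw [hst]
    set st' : Search :=
      { st with
        B := update st.B st.sp l
        pos := update st.pos v 0
        flag := if st.label v = X.lab ∧ X.T < st.dist v + X.n then 1 else st.flag
        k := st.dist v
        e := X.start v
        e₁ := X.start (v + 1) } with hst'
    obtain ⟨hlo1, hlo2, hlv⟩ := h.B_item st.sp hsp le_rfl _ hvB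
    obtain ⟨hvS, hvpos⟩ := hlv rfl
    simp only at hlo1 hlo2 hvS hvpos
    -- The interval of the last bucket consists of one number.
    have hkey : st.dist v = st.lo st.sp := by omega
    have hmem : ∀ p, st'.Mem p → st.Mem p := fun p hp =>
      hp.imp id fun ⟨b, hb, hb', hp⟩ => ⟨b, hb, hb', hBsub b p hp⟩
    have hlive : ∀ u, u ≠ v → st.Mem (u, st.dist u) → st'.Mem (u, st.dist u) := fun u huv hu =>
      hu.imp id fun ⟨b, hb, hb', hp⟩ => ⟨b, hb, hb', hBsup b _ (fun e => by
        simp only [Prod.mk.injEq] at e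
        exact huv e.1) hp⟩
    have hlab : st.label v = X.lab → st.dist v + X.n ≤ X.T ∨ st'.flag ≠ 0 := by
      intro h1
      by_cases h2 : X.T < st.dist v + X.n
      · right; simp [hst', h1, h2]
      · left; omega
    refine ⟨insert v S, v, {
      dist_le := h.dist_le
      src_dist := h.src_dist
      le_dist := h.le_dist
      lo_zero := h.lo_zero
      lo_lt := h.lo_lt
      len_le := h.len_le
      len_pow := h.len_pow
      item := fun p hp => h.item p (hmem p hp)
      q_item := fun p hp => absurd hp (by simp [hst', hq])
      B_item := fun b hb hb' p hp => ?_
      q_nodup := h.q_nodup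
      B_nodup := hBnd
      disjoint := fun p hp => absurd hp (by simp [hst', hq])
      settled := fun u hu => ?_
      live := fun u hu hd => ?_
      pos_ne := fun u hu => ?_
      relaxed := fun u hu e hue hcur => ?_
      cur_end := fun _ => rfl
      current := fun h1 => ⟨Finset.mem_insert_self _ _,
        ⟨hv, le_rfl, h1, by simp [hst']⟩, rfl, hkey⟩
      idle := fun h0 => by simp only [hst'] at h0; omega
      label := h.label
      flag_ne := fun hf => ?_
      flag_eq := fun hf => ?_ }, ?_⟩
    · obtain ⟨h1, h2, h3⟩ := h.B_item b hb hb' p (hBsub b p hp)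
      refine ⟨h1, h2, fun hpd => ?_⟩
      obtain ⟨h4, h5⟩ := h3 hpd
      have hne : p.1 ≠ v := by
        intro hpv
        have hpe : p = (v, st.dist v) := Prod.ext hpv (by rw [← hpv]; exact hpd)
        have hbs : b = st.sp := by rw [← h5, hpv, hvpos]
        subst hbs
        simp only [hst', Function.update_self] at hp
        exact hnd.1 (hpe ▸ hp)
      exact ⟨by simp [hne, h4], by simp [hst', hne, h5]⟩
    · rcases Finset.mem_insert.1 hu with rfl | hu
      · exact ⟨hv, hd₀, hkey.le⟩
      · exact h.settled u hu
    · by_cases huv : u = v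
      · exact Or.inl (by simp [huv])
      · exact (h.live u hu hd).imp (Finset.mem_insert_of_mem) (hlive u huv)
    · by_cases huv : u = v
      · subst huv; simp [hst'] at hu
      · exact hlive u huv (h.pos_ne u (by simpa [hst', huv] using hu))
    · by_cases huv : u = v
      · have h1 : e < X.start v := hcur huv
        obtain ⟨-, h2, -⟩ := hue
        rw [huv] at h2
        omega
      · have huS := (Finset.mem_insert.1 hu).resolve_left huv
        refine h.relaxed u huS e hue fun hcu => ?_
        have h1 := h.cur_end (hcu ▸ huS)
        have h2 := hue.2.2.1
        rw [hcu] at h2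
        omega
    · by_cases h1 : st.label v = X.lab ∧ X.T < st.dist v + X.n
      · have hvT : st.dist v ≤ X.T := by
          have h2 := h.label v hv
          rw [h1.1] at h2
          by_contra h3
          have h4 : ¬ d₀ v ≤ X.T := by omega
          rw [if_neg h4, if_neg h3] at h2
          have := hX.lab_pos
          omega
        exact Or.inr ⟨v, Finset.mem_insert_self _ _, hvT, h1.2⟩
      · simp only [hst', if_neg h1] at hf
        exact (h.flag_ne hf).imp id fun ⟨u, hu, h⟩ => ⟨u, Finset.mem_insert_of_mem hu, h⟩
    · have h1 : ¬ (st.label v = X.lab ∧ X.T < st.dist v + X.n) := by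
        intro h1
        simp [hst', h1.1, h1.2] at hf
      have hf' : st.flag = 0 := by simpa only [hst', if_neg h1] using hf
      refine ⟨(h.flag_eq hf').1, fun u hu hul => ?_⟩
      rcases Finset.mem_insert.1 hu with rfl | hu
      · exact (hlab hul).resolve_right (by simp [hf])
      · exact (h.flag_eq hf').2 u hu hul
    · have hvR : v ∈ reached X d₀ D \ S := Finset.mem_sdiff.2 ⟨h.mem_reached hvm, hvS⟩
      have hR : reached X d₀ D \ insert v S = (reached X d₀ D \ S).erase v := by
        ext u; simp only [Finset.mem_sdiff, Finset.mem_insert, Finset.mem_erase]; tauto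
      have hs1 : ∑ u ∈ (reached X d₀ D \ S).erase v, vertexPot X st' u =
          ∑ u ∈ (reached X d₀ D \ S).erase v, vertexPot X st u := by
        refine Finset.sum_congr rfl fun u hu => ?_
        have huv := Finset.ne_of_mem_erase hu
        simp [vertexPot, hst', huv]
      have hs2 := Finset.add_sum_erase _ (vertexPot X st) hvR
      have hs3 : 6 * (X.start (v + 1) - X.start v) ≤ vertexPot X st v := by
        simp only [vertexPot]; omega
      simp only [pot, hR, hs1]
      simp only [hst']
      omega

/-- Relaxing an arc adds at most one item to the queue; the arc pays for it. The pointer `pos u`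
need not change, because the key of `u` only decreases. -/
theorem Inv.relax (h : Inv X d₀ D l₀ f₀ st S cur) (hX : X.Valid) (hs : Setup X d₀ D l₀)
    (he : st.e < st.e₁) :
    Inv X d₀ D l₀ f₀ (st.relax X) S cur ∧ pot X d₀ D (st.relax X) S < pot X d₀ D st S := by
  obtain ⟨hcS, hce, hk, hklo⟩ := h.current he
  have hend := h.cur_end hcS
  have he2 : st.e + 2 ≤ st.e₁ := by
    have h1 := hX.start_dvd cur hce.1
    obtain ⟨-, h2, h3, h4⟩ := hce
    omega
  have hnext : st.e + 2 < st.e₁ → X.IsArc cur (st.e + 2) := fun h1 => by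
    obtain ⟨h2, h3, h4, h5⟩ := hce
    exact ⟨h2, by omega, by omega, by omega⟩
  have hprev : ∀ e, X.IsArc cur e → e < st.e + 2 → e < st.e ∨ e = st.e := fun e h1 h2 => by
    obtain ⟨-, h3, -, h4⟩ := h1
    obtain ⟨-, h5, -, h6⟩ := hce
    omega
  have hsp : st.sp ≠ 0 := fun h0 => by have := h.idle h0; omega
  obtain ⟨u, hu⟩ : ∃ u, u = X.tgt st.e := ⟨_, rfl⟩
  obtain ⟨c, hc⟩ : ∃ c, c = st.k + X.wt st.e := ⟨_, rfl⟩
  by_cases hlt : c < st.dist u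
  · have hst : st.relax X =
      { st with
        e := st.e + 2
        dist := update st.dist u c
        label := if st.label u = 0 then update st.label u X.lab else st.label
        q := (u, c) :: st.q } := by
      simp only [Search.relax, ← hu, ← hc, if_pos hlt]
    rw [hst]
    set st' : Search :=
      { st with
        e := st.e + 2
        dist := update st.dist u c
        label := if st.label u = 0 then update st.label u X.lab else st.label
        q := (u, c) :: st.q } with hst'
    have hun : u < X.n := hu ▸ hX.tgt_lt cur st.e hce
    -- The distances of settled vertices are at most `lo sp = k ≤ c`.
    have huS : u ∉ S := fun huS => by
      have := (h.settled u huS).2.2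
      omega
    have huc : u ≠ cur := fun e => huS (e ▸ hcS)
    have hud := h.dist_le u
    have hDu : D u ≤ c := by
      have h1 := hs.D_arc cur st.e hce
      have h2 := h.le_dist cur hce.1
      have h3 := (h.settled cur hcS).2.1
      rw [← hu] at h1
      omega
    have hdu' : st'.dist u = c := by simp [hst']
    have hd' : ∀ w, w ≠ u → st'.dist w = st.dist w := fun w hw => by simp [hst', hw]
    have hdle : ∀ w, st'.dist w ≤ st.dist w := fun w => by
      by_cases hw : w = u
      · subst hw; rw [hdu']; exact hlt.le
      · rw [hd' w hw]
    have hmem : ∀ p, st'.Mem p ↔ p = (u, c) ∨ st.Mem p := fun p => by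
      simp only [Mem, hst', List.mem_cons, or_assoc]
    have hnot : ∀ k, c ≥ k → ¬ st.Mem (u, k) := fun k hk hm => by
      have := (h.item _ hm).2.1
      simp only at this
      omega
    have hposu : st.pos u ≤ st.sp ∧ c < st.lo (st.pos u - 1) := by
      by_cases h0 : st.pos u = 0
      · rw [h0]
        have h1 := h.lo_zero
        have h2 := hs.d_le u hun
        exact ⟨by omega, by simp only [Nat.zero_sub]; omega⟩
      · rcases h.pos_ne u h0 with hm | ⟨b, hb, hb', hm⟩
        · obtain ⟨-, h1, h2⟩ := h.q_item _ hm rfl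
          simp only at h1 h2
          exact ⟨h1, by omega⟩
        · obtain ⟨-, h2, h3⟩ := h.B_item b hb hb' _ hm
          have h4 := (h3 rfl).2
          simp only at h2 h4
          exact ⟨by omega, by rw [h4]; omega⟩
    have hlive : ∀ w, st.Mem (w, st.dist w) ∨ w = u → st'.Mem (w, st'.dist w) := fun w hw => by
      by_cases hwu : w = u
      · subst hwu; rw [hdu']; exact (hmem _).2 (Or.inl rfl)
      · rw [hd' w hwu]; exact (hmem _).2 (Or.inr (hw.resolve_right hwu))
    have hlabel : ∀ w < X.n, st'.label w =
        if d₀ w ≤ X.T then l₀ w else if st'.dist w ≤ X.T then X.lab else 0 := by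
      intro w hw
      have h1 := h.label w hw
      by_cases hwu : w = u
      · subst hwu
        have h2 := hs.l_ne w hw
        have h3 := hs.d_le w hw
        have h4 := hX.lab_pos
        have h5 : c ≤ X.T := by omega
        rw [hdu', if_pos h5]
        simp only [hst']
        by_cases h6 : d₀ w ≤ X.T
        · rw [if_pos h6] at h1 ⊢
          rw [if_neg (by omega), h1]
        · rw [if_neg h6] at h1 ⊢
          by_cases h7 : st.label w = 0
          · rw [if_pos h7, Function.update_self]
          · rw [if_neg h7, h1]
            split_ifs at h1 ⊢ <;> omega
      · rw [hd' w hwu, ← h1]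
        simp only [hst']
        split_ifs with h2
        · rw [Function.update_of_ne hwu]
        · rfl
    have hlabel' : ∀ w, w ≠ u → st'.label w = st.label w := fun w hw => by
      simp only [hst']
      split_ifs
      · rw [Function.update_of_ne hw]
      · rfl
    have hSu : ∀ w ∈ S, w ≠ u := fun w hw e => huS (e ▸ hw)
    refine ⟨{ h with
      dist_le := fun v => (hdle v).trans (h.dist_le v)
      src_dist := Nat.le_zero.1 ((hdle _).trans h.src_dist.le)
      le_dist := fun v hv => ?_
      item := fun p hp => ?_
      q_item := fun p hp hpd => ?_
      B_item := fun b hb hb' p hp => ?_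
      q_nodup := List.nodup_cons.2 ⟨fun hm => hnot c le_rfl (Or.inl hm), h.q_nodup⟩
      disjoint := fun p hp b hb hb' hpB => ?_
      settled := fun v hv => by rw [hd' v (hSu v hv)]; exact h.settled v hv
      live := fun v hv hd => ?_
      pos_ne := fun v hv => hlive v (Or.inl (h.pos_ne v hv))
      relaxed := fun v hv e hve hvc => ?_
      current := fun h1 => ⟨hcS, hnext h1, by rw [hd' cur huc.symm]; exact hk, hklo⟩
      idle := fun h0 => absurd h0 hsp
      label := hlabel
      flag_ne := fun hf => (h.flag_ne hf).imp id fun ⟨v, hv, h1⟩ =>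
        ⟨v, hv, by rw [hd' v (hSu v hv)]; exact h1⟩
      flag_eq := fun hf => ⟨(h.flag_eq hf).1, fun v hv hl => by
        rw [hlabel' v (hSu v hv)] at hl
        rw [hd' v (hSu v hv)]
        exact (h.flag_eq hf).2 v hv hl⟩ }, ?_⟩
    · by_cases hvu : v = u
      · subst hvu; rw [hdu']; exact (min_le_right _ _).trans hDu
      · rw [hd' v hvu]; exact h.le_dist v hv
    · rcases (hmem p).1 hp with rfl | hp
      · refine ⟨hun, hdu'.le, ?_, ?_, hDu⟩
        · simp only [hst']; omega
        · simp only; omega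
      · obtain ⟨h1, h2, h3⟩ := h.item p hp
        exact ⟨h1, (hdle _).trans h2, h3⟩
    · have hp : p = (u, c) ∨ p ∈ st.q := by simpa [hst'] using hp
      rcases hp with rfl | hp
      · exact ⟨huS, hposu⟩
      · have h1 : p.1 ≠ u := fun h1 => by
          rw [h1, hdu'] at hpd
          exact hnot p.2 hpd.le (Or.inl (by rw [← h1]; exact hp))
        exact h.q_item p hp (by rw [← hd' _ h1]; exact hpd)
    · obtain ⟨h1, h2, h3⟩ := h.B_item b hb hb' p hp
      refine ⟨h1, h2, fun hpd => ?_⟩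
      have h4 : p.1 ≠ u := fun h4 => by
        rw [h4, hdu'] at hpd
        exact hnot p.2 hpd.le (Or.inr ⟨b, hb, hb', by rw [← h4]; exact hp⟩)
      exact h3 (by rw [← hd' _ h4]; exact hpd)
    · have hp : p = (u, c) ∨ p ∈ st.q := by simpa [hst'] using hp
      rcases hp with rfl | hp
      · exact hnot c le_rfl (Or.inr ⟨b, hb, hb', hpB⟩)
      · exact h.disjoint p hp b hb hb' hpB
    · by_cases hvu : v = u
      · exact Or.inr (hlive v (Or.inr hvu))
      · rw [hd' v hvu] at hd
        exact (h.live v hv hd).imp id fun hm => hlive v (Or.inl hm)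
    · rw [hd' v (hSu v hv)]
      by_cases hvcur : v = cur ∧ e = st.e
      · obtain ⟨rfl, rfl⟩ := hvcur
        rw [← hu, hdu', hc, hk]
      · refine (hdle _).trans (h.relaxed v hv e hve fun h1 => ?_)
        subst h1
        exact (hprev e hve (hvc rfl)).resolve_right fun h2 => hvcur ⟨rfl, h2⟩
    · have huR : u ∈ reached X d₀ D \ S := by
        refine Finset.mem_sdiff.2 ⟨?_, huS⟩
        simp only [reached, Finset.mem_filter, Finset.mem_range]
        omega
      have hs1 : ∑ v ∈ (reached X d₀ D \ S).erase u, vertexPot X st' v ≤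
          ∑ v ∈ (reached X d₀ D \ S).erase u, vertexPot X st v := by
        refine Finset.sum_le_sum fun v hv => ?_
        have hvu := Finset.ne_of_mem_erase hv
        simp [vertexPot, hst', hvu]
      have hs2 : vertexPot X st' u ≤ vertexPot X st u + 3 := by
        simp only [vertexPot, hst']
        split_ifs <;> omega
      have hs3 := Finset.add_sum_erase _ (vertexPot X st) huR
      have hs4 := Finset.add_sum_erase _ (vertexPot X st') huR
      simp only [pot, ← hs3, ← hs4]
      simp only [hst', List.length_cons] at hs1 hs2 ⊢
      omega
  · have hst : st.relax X = { st with e := st.e + 2 } := by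
      simp only [Search.relax, ← hu, ← hc, if_neg hlt]
    rw [hst]
    refine ⟨{ h with
      relaxed := fun v hv e hve hvc => ?_
      current := fun h1 => ⟨hcS, hnext h1, hk, hklo⟩
      idle := fun h0 => absurd h0 hsp }, ?_⟩
    · by_cases hvcur : v = cur ∧ e = st.e
      · obtain ⟨rfl, rfl⟩ := hvcur
        have hge : st.dist u ≤ c := not_lt.1 hlt
        rw [hu, hc, hk] at hge
        exact hge
      · refine h.relaxed v hv e hve fun h1 => ?_
        subst h1
        exact (hprev e hve (hvc rfl)).resolve_right fun h2 => hvcur ⟨rfl, h2⟩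
    · have hvp : ∑ u ∈ reached X d₀ D \ S, vertexPot X { st with e := st.e + 2 } u =
        ∑ u ∈ reached X d₀ D \ S, vertexPot X st u := rfl
      simp only [pot, hvp]
      omega

/-- Every step of a search keeps the invariant and lowers the potential. -/
theorem Inv.step (h : Inv X d₀ D l₀ f₀ st S cur) (hX : X.Valid) (hs : Setup X d₀ D l₀)
    (hsp : 1 ≤ st.sp) :
    ∃ S' cur', Inv X d₀ D l₀ f₀ (st.step X) S' cur' ∧
      pot X d₀ D (st.step X) S' < pot X d₀ D st S := by
  unfold Search.step
  by_cases he : st.e < st.e₁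
  · rw [if_pos he]
    exact ⟨S, cur, h.relax hX hs he⟩
  · rw [if_neg he]
    split
    · next u c q hq =>
      unfold place
      split_ifs with hc hlo
      · exact ⟨S, cur, h.drop hq hc⟩
      · exact ⟨S, cur, h.advance hq hc hlo⟩
      · exact ⟨S, cur, h.store hs hq hc hlo⟩
    · next hq =>
      split
      · next hB => exact ⟨S, cur, h.pop he hsp hq hB⟩
      · next v c l hB =>
        by_cases hlen : st.lo st.sp + 1 < st.lo (st.sp - 1)
        · rw [if_pos hlen]
          exact ⟨S, cur, h.split he hsp hq (by simp [hB]) hlen⟩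
        · rw [if_neg hlen]
          exact h.settle hX he hsp hq hB hlen

end

/-! ### The beginning and the end of a round -/

section
variable {X : Net} {d₀ D l₀ : ℕ → ℕ} {f₀ : ℕ} {st : Search} {S : Finset ℕ} {cur : ℕ}

/-- `D` are the distances from the center: they form the largest function that vanishes at the
center, is at most `T + 1`, and increases along an arc by at most the length of the arc. -/
structure IsDist (X : Net) (D : ℕ → ℕ) : Prop where
  src : D X.src = 0
  arc : ∀ v e, X.IsArc v e → D (X.tgt e) ≤ D v + X.wt e
  max : ∀ f : ℕ → ℕ, f X.src = 0 → (∀ v < X.n, f v ≤ X.T + 1) →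
    (∀ v e, X.IsArc v e → f (X.tgt e) ≤ f v + X.wt e) → ∀ v < X.n, f v ≤ D v

/-- What a round achieves: the distances from the new center are taken into account, vertices
without a label within distance `T` get the new label, and the flag records whether one of them is
closer to the boundary than the rounding error. -/
structure Done (X : Net) (d₀ D l₀ : ℕ → ℕ) (f₀ : ℕ) (dist label pos : ℕ → ℕ) (flag : ℕ) :
    Prop where
  dist : ∀ v < X.n, dist v = min (d₀ v) (D v)
  label : ∀ v < X.n, label v = if d₀ v ≤ X.T then l₀ v else if D v ≤ X.T then X.lab else 0
  pos : ∀ v, pos v = 0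
  flag_ne : flag ≠ 0 → f₀ ≠ 0 ∨ ∃ v < X.n, D v ≤ X.T ∧ X.T < D v + X.n
  flag_eq : flag = 0 → f₀ = 0 ∧ ∀ v < X.n, X.T < d₀ v → D v ≤ X.T → D v + X.n ≤ X.T

/-- When the queue is empty, no arc can be relaxed any more, so that the tentative distances are the
true ones. -/
theorem Inv.done (h : Inv X d₀ D l₀ f₀ st S cur) (hs : Setup X d₀ D l₀)
    (hD : IsDist X D) (hsp : st.sp = 0) : Done X d₀ D l₀ f₀ st.dist st.label st.pos st.flag := by
  have hmem : ∀ p, ¬ st.Mem p := by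
    rintro p (hp | ⟨b, hb, hb', -⟩)
    · simp [(h.idle hsp).1] at hp
    · omega
  have hS : ∀ v < X.n, st.dist v < d₀ v → v ∈ S := fun v hv hd =>
    (h.live v hv hd).resolve_right (hmem _)
  have hdist : ∀ v < X.n, st.dist v = min (d₀ v) (D v) := by
    intro v hv
    refine le_antisymm (le_min (h.dist_le v) ?_) (h.le_dist v hv)
    refine hD.max st.dist h.src_dist (fun v hv => (h.dist_le v).trans (hs.d_le v hv)) ?_ v hv
    intro w e he
    by_cases hw : st.dist w < d₀ w
    · have hwS := hS w he.1 hw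
      refine h.relaxed w hwS e he fun hc => ?_
      have h1 := h.cur_end (hc ▸ hwS)
      have h2 := he.2.2.1
      have h3 := (h.idle hsp).2
      rw [hc] at h2
      omega
    · have h1 := h.dist_le w
      have h2 := hs.d_arc w e he
      have h3 := h.dist_le (X.tgt e)
      omega
  refine ⟨hdist, fun v hv => ?_, fun v => ?_, fun hf => ?_, fun hf => ?_⟩
  · rw [h.label v hv, hdist v hv]
    by_cases h1 : d₀ v ≤ X.T
    · rw [if_pos h1, if_pos h1]
    · rw [if_neg h1, if_neg h1]
      by_cases h2 : D v ≤ X.T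
      · rw [if_pos h2, if_pos ((min_le_right _ _).trans h2)]
      · rw [if_neg h2, if_neg (by omega)]
  · by_contra hv
    exact hmem _ (h.pos_ne v hv)
  · refine (h.flag_ne hf).imp id fun ⟨v, hv, h1⟩ => ?_
    obtain ⟨h2, h3, -⟩ := h.settled v hv
    rw [hdist v h2] at h1 h3
    have h4 : min (d₀ v) (D v) = D v := by omega
    rw [h4] at h1
    exact ⟨v, h2, h1⟩
  · refine ⟨(h.flag_eq hf).1, fun v hv h1 h2 => ?_⟩
    have h3 := hdist v hv
    have h4 := (h.flag_eq hf).2 v (hS v hv (by omega)) ?_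
    · omega
    · rw [h.label v hv, if_neg (by omega), if_pos (by omega)]

/-- The invariant holds at the beginning of a round. -/
theorem inv_init (hs : Setup X d₀ D l₀) (hD : IsDist X D) (hsrc : X.src < X.n)
    (st : Search) (hst1 : st.dist = update d₀ X.src 0)
    (hst2 : st.label = if l₀ X.src = 0 then update l₀ X.src X.lab else l₀)
    (hst3 : ∀ v, st.pos v = 0) (hst4 : st.lo 0 = X.T + 1) (hst5 : st.lo 1 = 0)
    (hst6 : st.q = if 0 < d₀ X.src then [(X.src, 0)] else []) (hst7 : st.B 1 = [])
    (hst8 : st.sp = 1) (hst9 : st.e = 0) (hst10 : st.e₁ = 0) (hst11 : st.flag = f₀) :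
    Inv X d₀ D l₀ f₀ st ∅ 0 ∧
      pot X d₀ D st ∅ ≤ 4 + ∑ v ∈ reached X d₀ D,
        (6 * depth X + 3 + 6 * (X.start (v + 1) - X.start v)) := by
  have hmem : ∀ p, st.Mem p ↔ p = (X.src, 0) ∧ 0 < d₀ X.src := by
    intro p
    have : ∀ b, 1 ≤ b ∧ b ≤ st.sp ∧ p ∈ st.B b ↔ False := by
      intro b
      rw [hst8]
      constructor
      · rintro ⟨h1, h2, h3⟩
        obtain rfl : b = 1 := by omega
        simp [hst7] at h3
      · exact False.elim
    simp only [Mem, this, hst6]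
    split_ifs with h <;> simp [h]
  have hd : ∀ v, st.dist v = if v = X.src then 0 else d₀ v := fun v => by
    rw [hst1, Function.update_apply]
  refine ⟨{
    dist_le := fun v => ?_
    src_dist := by simp [hd]
    le_dist := fun v hv => ?_
    lo_zero := hst4
    lo_lt := fun b hb => ?_
    len_le := fun b hb => by omega
    len_pow := fun b hb => ?_
    item := fun p hp => ?_
    q_item := fun p hp _ => ?_
    B_item := fun b hb hb' p hp => ?_
    q_nodup := by rw [hst6]; split_ifs <;> simp
    B_nodup := fun b hb hb' => ?_
    disjoint := fun p hp b hb hb' => ?_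
    settled := fun v hv => absurd hv (by simp)
    live := fun v hv hdv => Or.inr ((hmem _).2 ?_)
    pos_ne := fun v hv => absurd (hst3 v) hv
    relaxed := fun v hv => absurd hv (by simp)
    cur_end := fun hc => absurd hc (by simp)
    current := fun he => by omega
    idle := fun h0 => by omega
    label := fun v hv => ?_
    flag_ne := fun hf => Or.inl (hst11 ▸ hf)
    flag_eq := fun hf => ⟨hst11 ▸ hf, fun v hv => absurd hv (by simp)⟩ }, ?_⟩
  · rw [hd]; split_ifs <;> omega
  · rw [hd]
    split_ifs with h
    · rw [h, hD.src]; omega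
    · omega
  · obtain rfl : b = 0 := by omega
    simp only [zero_add]
    omega
  · obtain rfl : b = 0 := by omega
    simp only [zero_add, pow_zero]
    omega
  · obtain ⟨rfl, h0⟩ := (hmem p).1 hp
    have hd' := hd X.src
    rw [if_pos rfl] at hd'
    simp only [hst8, hst5, hd', hD.src]
    exact ⟨hsrc, le_rfl, le_rfl, h0, le_rfl⟩
  · obtain ⟨rfl, h0⟩ := (hmem p).1 (Or.inl hp)
    simp only [hst3, hst8, Nat.zero_sub, hst4]
    exact ⟨by simp, by omega, by omega⟩
  · obtain rfl : b = 1 := by omega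
    simp [hst7] at hp
  · obtain rfl : b = 1 := by omega
    simp [hst7]
  · obtain rfl : b = 1 := by omega
    simp [hst7]
  · rw [hd] at hdv ⊢
    split_ifs at hdv ⊢ with h
    · exact ⟨by rw [h], h ▸ hdv⟩
    · omega
  · have h1 := hs.l_ne v hv
    have h2 := hs.l_ne _ hsrc
    have h3 := hs.d_le v hv
    rw [hd, hst2]
    by_cases hvs : v = X.src
    · subst hvs
      by_cases h4 : l₀ X.src = 0
      · rw [if_pos h4, Function.update_self, if_neg (by omega), if_pos rfl, if_pos (by omega)]
      · rw [if_neg h4, if_pos (by omega)]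
    · rw [if_neg hvs]
      have h5 : (if l₀ X.src = 0 then update l₀ X.src X.lab else l₀) v = l₀ v := by
        split_ifs
        · rw [Function.update_of_ne hvs]
        · rfl
      rw [h5]
      split_ifs <;> omega
  · have hsum : ∑ v ∈ reached X d₀ D \ ∅, vertexPot X st v ≤ ∑ v ∈ reached X d₀ D,
        (6 * depth X + 3 + 6 * (X.start (v + 1) - X.start v)) := by
      rw [Finset.sdiff_empty]
      refine Finset.sum_le_sum fun v _ => ?_
      simp only [vertexPot, hst3, size, if_true]
      split_ifs <;> omega
    have hq : st.q.length ≤ 1 := by rw [hst6]; split_ifs <;> simp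
    simp only [pot, hst8, hst9, hst10, Finset.sum_range_one, zero_add, hst7, List.length_nil]
    omega

end

end Search

/-! ### The program for one round -/

section Code

open Term Var

/-- Prepend the item `(cand, key)` to the linked list that starts at the node `l`; the first node of
the new list is the node `fresh - 1`. -/
def pushNode (l : Term) : Cmd :=
  .put .vertex (var fresh) (var cand) ;; .put .key (var fresh) (var key) ;;
  .put .next (var fresh) l ;; .set fresh (add (var fresh) (const 1))

/-- Set the label of the vertex `cand` unless it has one. -/
def labelCand : Cmd :=
  .ite (.eq (get .label (var cand)) (const 0))
    (.put .label (var cand) (add (var round) (const 1))) .skip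

/-- The command for `Search.relax`. -/
def relaxCmd : Cmd :=
  .set cand (input (var arc)) ;;
  .set key (add (var dist) (weight (add (var arc) (const 1)))) ;;
  .set arc (add (var arc) (const 2)) ;;
  .ite (.lt (var key) (get .dist (var cand)))
    (.put .dist (var cand) (var key) ;; labelCand ;; .set aux (var fresh) ;;
      pushNode (var queue) ;; .set queue (var aux))
    .skip

/-- The command for `Search.place`. -/
def placeCmd : Cmd :=
  .set cand (get .vertex (var queue)) ;;
  .set key (get .key (var queue)) ;;
  .ite (.lt (get .dist (var cand)) (var key)) (.set queue (get .next (var queue)))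
  (.ite (.lt (var key) (get .low (get .pos (var cand))))
    (.put .pos (var cand) (add (get .pos (var cand)) (const 1)))
    (.set queue (get .next (var queue)) ;; .set aux (var fresh) ;;
      pushNode (get .head (get .pos (var cand))) ;; .put .head (get .pos (var cand)) (var aux)))

/-- The command for `Search.split`. -/
def splitCmd : Cmd :=
  .set queue (get .head (var top)) ;;
  .put .head (var top) (const 0) ;;
  .set aux (get .low (var top)) ;;
  .put .low (var top)
    (div (add (get .low (var top)) (get .low (pred (var top)))) (const 2)) ;;
  .set top (add (var top) (const 1)) ;;
  .put .low (var top) (var aux) ;;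
  .put .head (var top) (const 0)

/-- The command for `Search.settle`. -/
def settleCmd : Cmd :=
  .set cand (get .vertex (get .head (var top))) ;;
  .set key (get .key (get .head (var top))) ;;
  .put .head (var top) (get .next (get .head (var top))) ;;
  .ite (.lt (get .dist (var cand)) (var key)) .skip
    (.put .pos (var cand) (const 0) ;;
    .ite (.and (.eq (get .label (var cand)) (add (var round) (const 1)))
        (.lt (var bound) (add (var key) (var size)))) (.set flag (const 1)) .skip ;;
    .set dist (var key) ;; .set arc (input (var cand)) ;;
    .set arcEnd (input (add (var cand) (const 1))))

/-- The command for `Search.step`. -/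
def stepCmd : Cmd :=
  .ite (.lt (var arc) (var arcEnd)) relaxCmd
  (.ite (.lt (const 0) (var queue)) placeCmd
  (.ite (.eq (get .head (var top)) (const 0)) (.set top (pred (var top)))
  (.ite (.lt (add (get .low (var top)) (const 1)) (get .low (pred (var top)))) splitCmd
    settleCmd)))

/-- The command that starts a round. -/
def startCmd : Cmd :=
  .set cand (get .perm (var round)) ;;
  .set key (const 0) ;;
  .set queue (const 0) ;;
  .ite (.lt (const 0) (get .dist (var cand)))
    (.set aux (var fresh) ;; pushNode (const 0) ;; .set queue (var aux)) .skip ;;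
  .put .dist (var cand) (const 0) ;;
  labelCand ;;
  .put .low (const 0) (add (var bound) (const 1)) ;;
  .put .low (const 1) (const 0) ;;
  .put .head (const 1) (const 0) ;;
  .set top (const 1) ;;
  .set arc (const 0) ;;
  .set arcEnd (const 0)

end Code

/-! ### The machine representation of a search -/

/-- In the linked list structure with the components `vt`, `ky`, `nx` of the nodes, all below `fr`,
the list `l` is stored from the node `p` on. The node `0` marks the end of a list. -/
def IsList (vt ky nx : ℕ → ℕ) (fr : ℕ) : ℕ → List (ℕ × ℕ) → Prop
  | p, [] => p = 0
  | p, x :: l => 0 < p ∧ p < fr ∧ vt p = x.1 ∧ ky p = x.2 ∧ IsList vt ky nx fr (nx p) l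

theorem IsList.update {vt ky nx : ℕ → ℕ} {fr : ℕ} (a b c : ℕ) :
    ∀ {l : List (ℕ × ℕ)} {p : ℕ}, IsList vt ky nx fr p l →
      IsList (Function.update vt fr a) (Function.update ky fr b) (Function.update nx fr c) (fr + 1)
        p l
  | [], _, h => h
  | _ :: l, p, h => by
    obtain ⟨h1, h2, h3, h4, h5⟩ := h
    refine ⟨h1, by omega, ?_, ?_, ?_⟩
    · rw [Function.update_of_ne h2.ne, h3]
    · rw [Function.update_of_ne h2.ne, h4]
    · rw [Function.update_of_ne h2.ne]
      exact h5.update a b c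

theorem IsList.push {vt ky nx : ℕ → ℕ} {fr p : ℕ} {l : List (ℕ × ℕ)} (h : IsList vt ky nx fr p l)
    (h0 : 0 < fr) (a b : ℕ) :
    IsList (Function.update vt fr a) (Function.update ky fr b) (Function.update nx fr p) (fr + 1)
      fr ((a, b) :: l) :=
  ⟨h0, by omega, by simp, by simp, by rw [Function.update_self]; exact h.update a b p⟩

theorem IsList.eq_nil_iff {vt ky nx : ℕ → ℕ} {fr p : ℕ} {l : List (ℕ × ℕ)}
    (h : IsList vt ky nx fr p l) : l = [] ↔ p = 0 := by
  cases l with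
  | nil => exact ⟨fun _ => h, fun _ => rfl⟩
  | cons x l => exact ⟨fun e => absurd e (by simp), fun e => absurd e h.1.ne'⟩

/-- The network of a round that is stored in the input: the arc lists as they are given, with the
lengths in units of `scale / N`, rounded down. -/
noncomputable def Env.net (E : Env) (n N T src lab : ℕ) : Net where
  n := n
  T := T
  src := src
  lab := lab
  start v := ⌊E.input v⌋₊
  tgt e := ⌊E.input e⌋₊
  wt e := ⌊E.input (e + 1) * N / E.scale⌋₊

/-- The words of the input that describe arcs lie below `base`, and they are not negative. -/
structure Env.Good (E : Env) (n : ℕ) : Prop where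
  index : ∀ v ≤ n, v < E.base ∧ 0 ≤ E.input v
  arc : ∀ v e, v < n → ⌊E.input v⌋₊ ≤ e → e < ⌊E.input ((v + 1 : ℕ))⌋₊ → 2 ∣ e - ⌊E.input v⌋₊ →
    e + 1 < E.base ∧ 0 ≤ E.input e ∧ 0 ≤ E.input (e + 1)

/-- The store `A` holds the search state `st` and the permutation `P`. The queue and the buckets are
linked lists; nodes are allocated from `fresh` on and never reused. -/
structure Holds (n N T lab : ℕ) (P : ℕ → ℕ) (A : Store) (st : Search) : Prop where
  size : A.var .size = n
  scale : A.var .scale = N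
  bound : A.var .bound = T
  round : A.var .round + 1 = lab
  perm : A.arr .perm = P
  dist : A.arr .dist = st.dist
  label : A.arr .label = st.label
  pos : A.arr .pos = st.pos
  low : A.arr .low = st.lo
  arc : A.var .arc = st.e
  arcEnd : A.var .arcEnd = st.e₁
  key : A.var .dist = st.k
  top : A.var .top = st.sp
  flag : A.var .flag = st.flag
  fresh : 0 < A.var .fresh
  queue : IsList (A.arr .vertex) (A.arr .key) (A.arr .next) (A.var .fresh) (A.var .queue) st.q
  head : ∀ b, 1 ≤ b → b ≤ st.sp →
    IsList (A.arr .vertex) (A.arr .key) (A.arr .next) (A.var .fresh) (A.arr .head b) (st.B b)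

section
variable {E : Env} {n N T src lab : ℕ} {P : ℕ → ℕ} {A : Store} {st : Search}

theorem Holds.relax (h : Holds n N T lab P A st) (h1 : st.e + 1 < E.base) (h2 : 0 ≤ E.input st.e)
    (h3 : 0 ≤ E.input (st.e + 1)) :
    relaxCmd.Ok E A ∧ Holds n N T lab P (relaxCmd.run E A) (st.relax (E.net n N T src lab)) := by
  constructor
  · simp only [relaxCmd, Cmd.Ok, Cmd.run, Term.Ok, Term.eval, Store.setVar_var, Cond.Ok,
      Cond.Holds, pushNode, labelCand, h.arc]
    simp [h1, h2, h3, show st.e < E.base by omega]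
  · obtain ⟨u, hu⟩ : ∃ u, u = ⌊E.input st.e⌋₊ := ⟨_, rfl⟩
    obtain ⟨c, hc⟩ : ∃ c, c = st.k + ⌊E.input (st.e + 1) * N / E.scale⌋₊ := ⟨_, rfl⟩
    have hpush := h.queue.push h.fresh u c
    have hupd := fun b hb hb' => (h.head b hb hb').update u c (A.var .queue)
    by_cases hlt : c < st.dist u
    · by_cases hl : st.label u = 0
      · simp only [relaxCmd, Cmd.run, Term.eval, Cond.Holds, pushNode, labelCand, h.arc, h.key,
          h.dist, h.label, h.scale, ← hu, ← hc, hlt, hl, Search.relax, Env.net, Store.setVar_var,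
          Store.setVar_arr, Store.setArr_var, Store.setArr_arr, reduceCtorEq, if_true, if_false]
        constructor <;> simp [h.size, h.scale, h.bound, h.round, h.perm, h.dist, h.label, h.pos,
          h.low, h.arcEnd, h.key, h.top, h.flag, hpush]
        exact hupd
      · simp only [relaxCmd, Cmd.run, Term.eval, Cond.Holds, pushNode, labelCand, h.arc, h.key,
          h.dist, h.label, h.scale, ← hu, ← hc, hlt, hl, Search.relax, Env.net, Store.setVar_var,
          Store.setVar_arr, Store.setArr_var, Store.setArr_arr, reduceCtorEq, if_true, if_false]
        constructor <;> simp [h.size, h.scale, h.bound, h.round, h.perm, h.dist, h.label, h.pos,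
          h.low, h.arcEnd, h.key, h.top, h.flag, hpush]
        exact hupd
    · simp only [relaxCmd, Cmd.run, Term.eval, Cond.Holds, pushNode, labelCand, h.arc, h.key,
        h.dist, h.label, h.scale, ← hu, ← hc, hlt, Search.relax, Env.net, Store.setVar_var,
        Store.setVar_arr, Store.setArr_var, Store.setArr_arr, reduceCtorEq, if_true, if_false]
      constructor <;> simp [h.size, h.scale, h.bound, h.round, h.perm, h.dist, h.label, h.pos,
        h.low, h.arcEnd, h.key, h.top, h.flag, h.fresh, h.queue]
      exact h.head

theorem Holds.place (h : Holds n N T lab P A st) {u c : ℕ} {q : List (ℕ × ℕ)}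
    (hq : st.q = (u, c) :: q) :
    placeCmd.Ok E A ∧ Holds n N T lab P (placeCmd.run E A) (st.place u c q) := by
  obtain ⟨-, -, hu, hc, hl⟩ := hq ▸ h.queue
  simp only at hu hc
  constructor
  · simp [placeCmd, Cmd.Ok, Term.Ok, Cond.Ok, pushNode]
  · by_cases h1 : st.dist u < c
    · simp only [placeCmd, Cmd.run, Term.eval, Cond.Holds, pushNode, h.dist, h.low, h.pos,
          hu, hc, h1, Search.place, Store.setVar_var,
          Store.setVar_arr, Store.setArr_var, Store.setArr_arr, reduceCtorEq, if_true, if_false]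
      constructor <;> simp [h.size, h.scale, h.bound, h.round, h.perm, h.dist, h.label, h.pos,
          h.low, h.arc, h.arcEnd, h.key, h.top, h.flag, h.fresh, hl]
      exact h.head
    · by_cases h2 : c < st.lo (st.pos u)
      · simp only [placeCmd, Cmd.run, Term.eval, Cond.Holds, pushNode, h.dist, h.low, h.pos,
          hu, hc, h1, h2, Search.place, Store.setVar_var,
          Store.setVar_arr, Store.setArr_var, Store.setArr_arr, reduceCtorEq, if_true, if_false]
        constructor <;> simp [h.size, h.scale, h.bound, h.round, h.perm, h.dist, h.label, h.pos,
            h.low, h.arc, h.arcEnd, h.key, h.top, h.flag, h.fresh, h.queue]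
        exact h.head
      · simp only [placeCmd, Cmd.run, Term.eval, Cond.Holds, pushNode, h.dist, h.low, h.pos,
          hu, hc, h1, h2, Search.place, Store.setVar_var,
          Store.setVar_arr, Store.setArr_var, Store.setArr_arr, reduceCtorEq, if_true, if_false]
        have hupd := hl.update u c (A.arr .head (st.pos u))
        constructor <;> simp [h.size, h.scale, h.bound, h.round, h.perm, h.dist, h.label, h.pos,
            h.low, h.arc, h.arcEnd, h.key, h.top, h.flag, hupd]
        intro b hb hb'
        by_cases hbu : b = st.pos u
        · subst hbu
          simp only [Function.update_self]
          exact (h.head _ hb hb').push h.fresh u c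
        · rw [Function.update_of_ne hbu, Function.update_of_ne hbu]
          exact (h.head b hb hb').update u c _

theorem Holds.split (h : Holds n N T lab P A st) (hsp : 1 ≤ st.sp) :
    splitCmd.Ok E A ∧ Holds n N T lab P (splitCmd.run E A) st.split := by
  have hne : st.sp + 1 ≠ st.sp := by omega
  constructor
  · simp [splitCmd, Cmd.Ok, Term.Ok]
  · simp only [splitCmd, Cmd.run, Term.eval, Term.eval_pred, h.low, h.top, Search.split,
      Store.setVar_var, Store.setVar_arr, Store.setArr_var, Store.setArr_arr, reduceCtorEq,
      if_true, if_false]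
    constructor <;> simp [h.size, h.scale, h.bound, h.round, h.perm, h.dist, h.label, h.pos, h.low,
          h.arc, h.arcEnd, h.key, h.flag, h.fresh, h.head _ hsp le_rfl]
    intro b hb hb'
    by_cases h1 : b = st.sp + 1
    · subst h1; simp [IsList]
    · rw [Function.update_of_ne h1, Function.update_of_ne h1]
      by_cases h2 : b = st.sp
      · subst h2; simp [IsList]
      · rw [Function.update_of_ne h2, Function.update_of_ne h2]
        exact h.head b hb (by omega)

theorem Holds.settle (h : Holds n N T lab P A st) (hE : E.Good n) (hsp : 1 ≤ st.sp) {v c : ℕ}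
    {l : List (ℕ × ℕ)} (hB : st.B st.sp = (v, c) :: l) (hv : v < n) :
    settleCmd.Ok E A ∧
      Holds n N T lab P (settleCmd.run E A) (st.settle (E.net n N T src lab) v c l) := by
  obtain ⟨-, -, hv', hc, hl⟩ := hB ▸ h.head _ hsp le_rfl
  simp only at hv' hc
  have hlist : ∀ b, 1 ≤ b → b ≤ st.sp →
      IsList (A.arr .vertex) (A.arr .key) (A.arr .next) (A.var .fresh)
        (Function.update (A.arr .head) st.sp (A.arr .next (A.arr .head st.sp)) b)
        (Function.update st.B st.sp l b) := by
    intro b hb hb'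
    by_cases h2 : b = st.sp
    · subst h2; simpa using hl
    · rw [Function.update_of_ne h2, Function.update_of_ne h2]
      exact h.head b hb hb'
  have hvr := h.round
  obtain ⟨hi1, hi2⟩ := hE.index v hv.le
  obtain ⟨hi3, hi4⟩ := hE.index (v + 1) hv
  constructor
  · by_cases h1 : st.dist v < c
    · simp [settleCmd, Cmd.Ok, Cmd.run, Term.Ok, Term.eval, Cond.Ok, Cond.Holds, h.dist, h.top, hv',
        hc, h1]
    · by_cases h2 : st.label v = lab ∧ T < c + n
      · simp [settleCmd, Cmd.Ok, Cmd.run, Term.Ok, Term.eval, Cond.Ok, Cond.Holds, h.dist, h.top,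
          hv', hc, h1, h.bound, h.size, h.round, h.label, h2.1, h2.2, hi1, hi2, hi3, hi4]
      · simp [settleCmd, Cmd.Ok, Cmd.run, Term.Ok, Term.eval, Cond.Ok, Cond.Holds, h.dist, h.top,
          hv', hc, h1, h.bound, h.size, h.round, h.label, h2, hi1, hi2, hi3, hi4]
  · by_cases h1 : st.dist v < c
    · simp only [settleCmd, Cmd.run, Term.eval, Cond.Holds, h.dist, h.top, hv', hc, h1,
        Search.settle, Store.setVar_var, Store.setVar_arr, Store.setArr_var, Store.setArr_arr,
        reduceCtorEq, if_true, if_false]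
      constructor <;> simp [h.size, h.scale, h.bound, h.round, h.perm, h.dist, h.label, h.pos,
          h.low, h.arc, h.arcEnd, h.key, h.flag, h.fresh, h.queue, h.top]
      exact hlist
    · by_cases h2 : st.label v = lab ∧ T < c + n
      · simp only [settleCmd, Cmd.run, Term.eval, Cond.Holds, h.dist, h.top, hv', hc, h1,
          Search.settle, Store.setVar_var, Store.setVar_arr, Store.setArr_var, Store.setArr_arr,
          reduceCtorEq, if_true, if_false, h.bound, h.size, h.round, h.label, h2.1, h2.2, Env.net,
          and_self]
        constructor <;> simp [h.size, h.scale, h.bound, h.round, h.perm, h.dist, h.label, h.pos,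
          h.low, h.fresh, h.queue, h.top]
        exact hlist
      · simp only [settleCmd, Cmd.run, Term.eval, Cond.Holds, h.dist, h.top, hv', hc, h1,
          Search.settle, Store.setVar_var, Store.setVar_arr, Store.setArr_var, Store.setArr_arr,
          reduceCtorEq, if_true, if_false, h.bound, h.size, h.round, h.label, h2, Env.net]
        constructor <;> simp [h.size, h.scale, h.bound, h.round, h.perm, h.dist, h.label, h.pos,
          h.low, h.flag, h.fresh, h.queue, h.top]
        exact hlist

/-- The command `stepCmd` performs a step of the search. -/
theorem Holds.step (h : Holds n N T lab P A st) (hE : E.Good n) (hsp : 1 ≤ st.sp)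
    {d₀ D l₀ : ℕ → ℕ} {f₀ : ℕ} {S : Finset ℕ} {cur : ℕ}
    (hI : Search.Inv (E.net n N T src lab) d₀ D l₀ f₀ st S cur) :
    stepCmd.Ok E A ∧ Holds n N T lab P (stepCmd.run E A) (st.step (E.net n N T src lab)) := by
  unfold Search.step
  by_cases he : st.e < st.e₁
  · obtain ⟨-, ⟨h1, h2, h3, h4⟩, -⟩ := hI.current he
    obtain ⟨h5, h6, h7⟩ := hE.arc cur st.e h1 h2 h3 h4
    have := h.relax (src := src) h5 h6 h7
    simpa [stepCmd, Cmd.Ok, Cmd.run, Term.Ok, Term.eval, Cond.Ok, Cond.Holds, h.arc, h.arcEnd, he]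
      using this
  · rw [if_neg he]
    split
    · next u c q hq =>
      have h1 : 0 < A.var .queue := (hq ▸ h.queue : IsList _ _ _ _ _ ((u, c) :: q)).1
      have := h.place (E := E) hq
      simpa [stepCmd, Cmd.Ok, Cmd.run, Term.Ok, Term.eval, Cond.Ok, Cond.Holds, h.arc, h.arcEnd, he,
        h1] using this
    · next hq =>
      have h1 : A.var .queue = 0 := h.queue.eq_nil_iff.1 hq
      split
      · next hB =>
        have h2 : A.arr .head st.sp = 0 := (h.head _ hsp le_rfl).eq_nil_iff.1 hB
        simp only [stepCmd, Cmd.Ok, Cmd.run, Term.Ok, Term.eval, Cond.Ok, Cond.Holds, h.arc,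
          h.arcEnd, he, h1, h.top, h2, Term.ok_pred, Term.eval_pred, if_true, if_false,
          lt_self_iff_false, and_self, true_and]
        constructor <;> simp [h.size, h.scale, h.bound, h.round, h.perm, h.dist, h.label, h.pos,
          h.low, h.arc, h.arcEnd, h.key, h.flag, h.fresh, h.queue]
        exact fun b hb hb' => h.head b hb (by omega)
      · next v c l hB =>
        have h2 : A.arr .head st.sp ≠ 0 := fun e => by
          simpa [hB] using (h.head _ hsp le_rfl).eq_nil_iff.2 e
        by_cases h3 : st.lo st.sp + 1 < st.lo (st.sp - 1)
        · have := h.split (E := E) hsp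
          simpa [stepCmd, Cmd.Ok, Cmd.run, Term.Ok, Term.eval, Cond.Ok, Cond.Holds, h.arc,
            h.arcEnd, he, h1, h.top, h2, h.low, h3] using this
        · have hv : v < n := (hI.item (v, c) (Or.inr ⟨st.sp, hsp, le_rfl, by simp [hB]⟩)).1
          have := h.settle (src := src) hE hsp hB hv
          simpa [stepCmd, Cmd.Ok, Cmd.run, Term.Ok, Term.eval, Cond.Ok, Cond.Holds, h.arc,
            h.arcEnd, he, h1, h.top, h2, h.low, h3] using this

end

/-! ### Running a round -/

/-- The program for a round. -/
def roundProg : Prog :=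
  .seq startCmd.compile
    (.while (Cond.lt (.const 0) (.var .top)).compile stepCmd.compile)

/-- An upper bound for the time of one step of the search, including the test of the loop, and of
the start of a round. -/
def stepTime : ℕ := startCmd.cost + (Cond.lt (.const 0) (.var .top)).compile.cost + stepCmd.cost

/-- An upper bound for the time of a round. -/
noncomputable def roundTime (X : Net) (d₀ D : ℕ → ℕ) : ℕ :=
  stepTime * (6 + ∑ v ∈ Search.reached X d₀ D,
    (6 * Search.depth X + 3 + 6 * (X.start (v + 1) - X.start v)))

/-- The values of the variables that do not change during a round. -/
structure Ready (n N T : ℕ) (P : ℕ → ℕ) (i : ℕ) (A : Store) : Prop where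
  size : A.var .size = n
  scale : A.var .scale = N
  bound : A.var .bound = T
  round : A.var .round = i
  perm : A.arr .perm = P
  fresh : 0 < A.var .fresh
  pos : ∀ v, A.arr .pos v = 0

theorem run_startCmd {E : Env} {n N T : ℕ} {P : ℕ → ℕ} {i : ℕ} {A : Store}
    (h : Ready n N T P i A) :
    startCmd.Ok E A ∧ ∃ st : Search, Holds n N T (i + 1) P (startCmd.run E A) st ∧
      st.dist = Function.update (A.arr .dist) (P i) 0 ∧
      st.label = (if A.arr .label (P i) = 0 then Function.update (A.arr .label) (P i) (i + 1)
        else A.arr .label) ∧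
      (∀ v, st.pos v = 0) ∧ st.lo 0 = T + 1 ∧ st.lo 1 = 0 ∧
      st.q = (if 0 < A.arr .dist (P i) then [(P i, 0)] else []) ∧ st.B 1 = [] ∧ st.sp = 1 ∧
      st.e = 0 ∧ st.e₁ = 0 ∧ st.flag = A.var .flag := by
  constructor
  · simp [startCmd, labelCand, pushNode, Cmd.Ok, Term.Ok, Cond.Ok]
  · refine ⟨{
      dist := (startCmd.run E A).arr .dist
      label := (startCmd.run E A).arr .label
      pos := (startCmd.run E A).arr .pos
      lo := (startCmd.run E A).arr .low
      q := if 0 < A.arr .dist (P i) then [(P i, 0)] else []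
      B := fun _ => []
      sp := 1
      e := 0
      e₁ := 0
      k := A.var .dist
      flag := A.var .flag }, ?_⟩
    by_cases h1 : 0 < A.arr .dist (P i) <;> by_cases h2 : A.arr .label (P i) = 0 <;>
    · simp only [startCmd, labelCand, pushNode, Cmd.run, Term.eval, Cond.Holds, h.round, h.perm, h1,
        h2, h.bound, Store.setVar_var, Store.setVar_arr, Store.setArr_var, Store.setArr_arr,
        reduceCtorEq, if_true, if_false]
      refine ⟨?_, ?_⟩
      · constructor <;> simp [h.size, h.scale, h.bound, h.round, h.perm, h.fresh, IsList]
        intro b hb hb'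
        obtain rfl : b = 1 := by omega
        simp
      · simp [h.pos]

/-- The loop of a round terminates when the queue is empty; the potential bounds its running time.
-/
theorem run_roundProg (ω : ℕ → unitInterval) {E : Env} {n N T : ℕ} {P : ℕ → ℕ} {i : ℕ}
    {s : State} {A : Store} (hR : Rep E s A) (hE : E.Good n) (h : Ready n N T P i A)
    (hP : P i < n) {D : ℕ → ℕ} (hX : (E.net n N T (P i) (i + 1)).Valid)
    (hs : Search.Setup (E.net n N T (P i) (i + 1)) (A.arr .dist) D (A.arr .label))
    (hD : Search.IsDist (E.net n N T (P i) (i + 1)) D) :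
    ∃ t s' A', Run ω roundProg s t s' ∧ Rep E s' A' ∧ Ready n N T P i A' ∧
      Search.Done (E.net n N T (P i) (i + 1)) (A.arr .dist) D (A.arr .label) (A.var .flag)
        (A'.arr .dist) (A'.arr .label) (A'.arr .pos) (A'.var .flag) ∧
      t ≤ roundTime (E.net n N T (P i) (i + 1)) (A.arr .dist) D := by
  set X := E.net n N T (P i) (i + 1) with hXdef
  obtain ⟨hok, st, hst, h1, h2, h3, h4, h5, h6, h7, h8, h9, h10, h11⟩ := run_startCmd (E := E) h
  obtain ⟨hI, hpot⟩ := Search.inv_init (f₀ := A.var .flag) hs hD hP st h1 h2 h3 h4 h5 h6 h7 h8 h9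
    h10 h11
  obtain ⟨t, s₁, hr, ht, hR₁⟩ := Cmd.run_compile ω startCmd hR hok
  obtain ⟨⟨st', S', cur'⟩, E', A', t', s', hr', hR', ⟨rfl, hst', hI'⟩, hb, hle⟩ :=
    run_while (ω := ω) (c := .lt (.const 0) (.var .top)) (p := stepCmd.compile)
      (α := Search × Finset ℕ × ℕ)
      (fun a E' A' => E' = E ∧ Holds n N T (i + 1) P A' a.1 ∧
        Search.Inv X (A.arr .dist) D (A.arr .label) (A.var .flag) a.1 a.2.1 a.2.2)
      (fun a => stepTime * Search.pot X (A.arr .dist) D a.1 a.2.1)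
      (fun _ _ _ _ => ⟨trivial, trivial⟩)
      (by
        rintro ⟨st, S, cur⟩ E' B s ⟨rfl, hst, hI⟩ hB hb
        dsimp only at hst hI
        have hsp : 1 ≤ st.sp := by
          simp only [Cond.Holds, Term.eval, hst.top] at hb
          exact hb
        obtain ⟨hok, hst'⟩ := hst.step hE hsp hI
        obtain ⟨S', cur', hI', hpot⟩ := hI.step hX hs hsp
        obtain ⟨t, s', hr, ht, hR'⟩ := Cmd.run_compile ω stepCmd hB hok
        refine ⟨⟨_, S', cur'⟩, _, _, t, s', hr, hR', ⟨rfl, hst', hI'⟩, ?_⟩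
        have h1 := Nat.mul_le_mul_left stepTime (Nat.succ_le_of_lt hpot)
        rw [Nat.mul_succ] at h1
        have h2 : (Cond.lt (.const 0) (.var .top)).compile.cost + t ≤ stepTime := by
          unfold stepTime; omega
        exact le_trans (by rw [add_comm]; exact Nat.add_le_add_left h2 _) h1)
      (a := ⟨st, ∅, 0⟩) ⟨rfl, hst, hI⟩ hR₁
  dsimp only at hst' hI' hle
  have hsp : st'.sp = 0 := by
    simp only [Cond.Holds, Term.eval, hst'.top] at hb
    omega
  have hdone := hI'.done hs hD hsp
  rw [← hst'.dist, ← hst'.label, ← hst'.pos, ← hst'.flag] at hdone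
  refine ⟨_, s', A', hr.seq hr', hR', ⟨hst'.size, hst'.scale, hst'.bound, ?_, hst'.perm,
    hst'.fresh, hdone.pos⟩, hdone, ?_⟩
  · have := hst'.round; omega
  · have h1 := Nat.mul_le_mul_left stepTime hpot
    rw [Nat.mul_add] at h1
    have h2 : t + (Cond.lt (.const 0) (.var .top)).compile.cost ≤ stepTime := by
      unfold stepTime; omega
    unfold roundTime
    rw [Nat.mul_add]
    omega

/-! ### All rounds for one scale -/

/-- The distance of `v` from the first `i` centers `P 0, …, P (i - 1)`, cut off at `T + 1`. -/
def distAfter (T : ℕ) (D : ℕ → ℕ → ℕ) (P : ℕ → ℕ) : ℕ → ℕ → ℕ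
  | 0, _ => T + 1
  | i + 1, v => min (distAfter T D P i v) (D (P i) v)

/-- The label of `v` after `i` rounds: `j + 1` for the first `j < i` with `D (P j) v ≤ T`, and `0`
if there is none. -/
def labelAfter (T : ℕ) (D : ℕ → ℕ → ℕ) (P : ℕ → ℕ) : ℕ → ℕ → ℕ
  | 0, _ => 0
  | i + 1, v => if distAfter T D P i v ≤ T then labelAfter T D P i v
      else if D (P i) v ≤ T then i + 1 else 0

theorem distAfter_le (T : ℕ) (D : ℕ → ℕ → ℕ) (P : ℕ → ℕ) (i v : ℕ) :
    distAfter T D P i v ≤ T + 1 := by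
  induction i with
  | zero => exact le_rfl
  | succ i ih => exact (min_le_left _ _).trans ih

theorem lt_distAfter_iff {T k : ℕ} {D : ℕ → ℕ → ℕ} {P : ℕ → ℕ} {i v : ℕ} :
    k < distAfter T D P i v ↔ k < T + 1 ∧ ∀ j < i, k < D (P j) v := by
  induction i with
  | zero => simp [distAfter]
  | succ i ih =>
    simp only [distAfter, lt_min_iff, ih, Nat.lt_succ_iff_lt_or_eq]
    constructor
    · rintro ⟨⟨h1, h2⟩, h3⟩
      refine ⟨h1, ?_⟩
      rintro j (hj | rfl)
      exacts [h2 j hj, h3]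
    · rintro ⟨h1, h2⟩
      exact ⟨⟨h1, fun j hj => h2 j (Or.inl hj)⟩, h2 i (Or.inr rfl)⟩

theorem labelAfter_eq_zero_iff {T : ℕ} {D : ℕ → ℕ → ℕ} {P : ℕ → ℕ} {i v : ℕ} :
    labelAfter T D P i v = 0 ↔ T < distAfter T D P i v := by
  induction i with
  | zero => simp [labelAfter, distAfter]
  | succ i ih =>
    simp only [labelAfter, distAfter, lt_min_iff]
    split_ifs with h1 h2
    · rw [ih]; exact ⟨fun h => absurd h1 (by omega), fun h => h.1⟩
    · exact ⟨fun h => absurd h id, fun h => absurd h2 (not_le.2 h.2)⟩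
    · exact ⟨fun _ => ⟨by omega, by omega⟩, fun _ => rfl⟩

theorem labelAfter_eq_succ {T : ℕ} {D : ℕ → ℕ → ℕ} {P : ℕ → ℕ} {n j v : ℕ} (hj : j < n)
    (h : D (P j) v ≤ T) (h' : ∀ l < j, T < D (P l) v) : labelAfter T D P n v = j + 1 := by
  have h0 : T < distAfter T D P j v := lt_distAfter_iff.2 ⟨by omega, h'⟩
  induction n, hj using Nat.le_induction with
  | base => simp only [labelAfter]; rw [if_neg (by omega), if_pos h]
  | succ n hj ih =>
    simp only [labelAfter]
    rw [if_pos, ih]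
    by_contra hc
    have := (lt_distAfter_iff.1 (not_le.1 hc)).2 j hj
    omega

/-- The hypotheses on the input under which an attempt with the scale `N` works: the arc lists are
well formed, and `D` are the distances for the rounded lengths. -/
structure Attempt (E : Env) (n N : ℕ) (D : ℕ → ℕ → ℕ) : Prop where
  good : E.Good n
  valid : ∀ T src lab, 0 < lab → (E.net n N T src lab).Valid
  dist : ∀ src lab, src < n → Search.IsDist (E.net n N ⌊E.x * N⌋₊ src lab) (D src)

/-- Some distance `D u v` lies below `T` by less than the rounding error `n`, so that the exact
distance may exceed the radius. -/
def Ambiguous (n T : ℕ) (D : ℕ → ℕ → ℕ) : Prop :=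
  ∃ u < n, ∃ v < n, D u v ≤ T ∧ T < D u v + n

/-- Every vertex gets its label from a center whose distance is not too close to `T`. -/
def Certified (n T : ℕ) (D : ℕ → ℕ → ℕ) (P : ℕ → ℕ) : Prop :=
  ∀ j < n, ∀ v < n, T < distAfter T D P j v → D (P j) v ≤ T → D (P j) v + n ≤ T

section

open Term Var

/-- Initialize the distance and the label of a vertex. -/
def clearCmd : Cmd :=
  .put .dist (var round) (add (var bound) (const 1)) ;; .put .label (var round) (const 0) ;;
  .set round (add (var round) (const 1))

/-- Choose the next scale. -/
def rescaleCmd : Cmd :=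
  .set scale (mul (const 2) (var scale)) ;; .set bound (frac (var scale)) ;;
  .set flag (const 0) ;; .set round (const 0)

/-- The condition of a loop over all vertices. -/
def roundLt : Cond := .lt (var round) (var size)

/-- Compute labels with the next scale; the flag is raised if they may be wrong. -/
def attemptProg : Prog :=
  .seq rescaleCmd.compile <| .seq (.while roundLt.compile clearCmd.compile) <|
  .seq (Cmd.set round (const 0)).compile <|
  .while roundLt.compile <|
    .seq roundProg (Cmd.set round (add (var round) (const 1))).compile

end

/-- An upper bound for the time that an attempt spends per vertex outside the rounds. -/
def loopTime : ℕ :=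
  rescaleCmd.cost + clearCmd.cost + 2 * roundLt.compile.cost +
    (Cmd.set .round (.const 0)).cost + (Cmd.set .round (.add (.var .round) (.const 1))).cost

/-- An upper bound for the time of an attempt with the scale `N`. -/
noncomputable def attemptTime (E : Env) (n N : ℕ) (D : ℕ → ℕ → ℕ) (P : ℕ → ℕ) : ℕ :=
  loopTime * (1 + 2 * n) + ∑ i ∈ Finset.range n,
    roundTime (E.net n N ⌊E.x * N⌋₊ (P i) (i + 1)) (distAfter ⌊E.x * N⌋₊ D P i) (D (P i))

theorem Ready.next {n N T : ℕ} {P : ℕ → ℕ} {i : ℕ} {A : Store} (h : Ready n N T P i A) (j : ℕ) :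
    Ready n N T P j (A.setVar .round j) := by
  constructor <;> simp [h.size, h.scale, h.bound, h.perm, h.fresh, h.pos]

theorem run_clear (ω : ℕ → unitInterval) {E : Env} {n N T : ℕ} {P : ℕ → ℕ} {s : State} {A : Store}
    (hR : Rep E s A) (h : Ready n N T P 0 A) :
    ∃ t s' A', Run ω (.while roundLt.compile clearCmd.compile) s t s' ∧ Rep E s' A' ∧
      Ready n N T P n A' ∧ A'.var .flag = A.var .flag ∧
      (∀ v < n, A'.arr .dist v = T + 1 ∧ A'.arr .label v = 0) ∧
      t ≤ loopTime * n + roundLt.compile.cost := by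
  obtain ⟨a, E', A', t, s', hr, hR', ⟨rfl, ha, hA, hf, hA'⟩, hc, hle⟩ := run_while (ω := ω)
    (c := roundLt) (p := clearCmd.compile) (α := ℕ)
    (fun a E' A' => E' = E ∧ a ≤ n ∧ Ready n N T P a A' ∧ A'.var .flag = A.var .flag ∧
      ∀ v < a, A'.arr .dist v = T + 1 ∧ A'.arr .label v = 0)
    (fun a => loopTime * (n - a)) (fun _ _ _ _ => ⟨trivial, trivial⟩)
    (by
      rintro a E' B s ⟨rfl, ha, hB, hf, hv⟩ hR hc
      simp only [roundLt, Cond.Holds, Term.eval, hB.round, hB.size] at hc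
      obtain ⟨t, s', hr, ht, hR'⟩ := Cmd.run_compile ω clearCmd hR (by
        simp [clearCmd, Cmd.Ok, Term.Ok])
      refine ⟨a + 1, _, _, t, s', hr, hR', ⟨rfl, hc, ?_, ?_, ?_⟩, ?_⟩
      · constructor <;> simp [clearCmd, Cmd.run, Term.eval, hB.size, hB.scale, hB.bound, hB.round,
          hB.perm, hB.fresh, hB.pos]
      · simp [clearCmd, Cmd.run, hf]
      · intro v hva
        simp only [clearCmd, Cmd.run, Term.eval, hB.round, hB.bound,
          Store.setVar_arr, Store.setArr_var, Store.setArr_arr, reduceCtorEq, if_true, if_false,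
          Function.update_apply]
        split_ifs with h1
        · exact ⟨rfl, rfl⟩
        · exact hv v (by omega)
      · have h1 : roundLt.compile.cost + t ≤ loopTime := by unfold loopTime; omega
        obtain ⟨b, hb⟩ : ∃ b, n - a = b + 1 := ⟨n - a - 1, by omega⟩
        rw [hb, show n - (a + 1) = b by omega, Nat.mul_succ]
        omega)
    (a := 0) ⟨rfl, by omega, h, rfl, fun v hv => absurd hv (by omega)⟩ hR
  simp only [roundLt, Cond.Holds, Term.eval, hA.round, hA.size] at hc
  obtain rfl : a = n := by omega
  exact ⟨t, s', A', hr, hR', hA, hf, hA', by rw [Nat.sub_zero] at hle; omega⟩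

theorem reached_congr {X : Net} {d₀ d₁ D : ℕ → ℕ} (h : ∀ v < X.n, d₀ v = d₁ v) :
    Search.reached X d₀ D = Search.reached X d₁ D :=
  Finset.filter_congr fun v hv => by rw [h v (Finset.mem_range.1 hv)]

/-- An attempt computes the labels `labelAfter`. It lowers the flag only if they are certified, and
it does so unless some distance is ambiguous. -/
theorem run_attemptProg (ω : ℕ → unitInterval) {E : Env} {n N T : ℕ} {P : ℕ → ℕ} {i : ℕ}
    {s : State} {A : Store} (hR : Rep E s A) (h : Ready n N T P i A) (hP : ∀ i < n, P i < n)
    {D : ℕ → ℕ → ℕ} (hN : Attempt E n (2 * N) D) :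
    ∃ t s' A', Run ω attemptProg s t s' ∧ Rep E s' A' ∧
      Ready n (2 * N) ⌊E.x * (2 * N : ℕ)⌋₊ P n A' ∧
      (A'.var .flag ≠ 0 → Ambiguous n ⌊E.x * (2 * N : ℕ)⌋₊ D) ∧
      (A'.var .flag = 0 → Certified n ⌊E.x * (2 * N : ℕ)⌋₊ D P) ∧
      (∀ v < n, A'.arr .label v = labelAfter ⌊E.x * (2 * N : ℕ)⌋₊ D P n v) ∧
      t ≤ attemptTime E n (2 * N) D P := by
  obtain ⟨t₁, s₁, hr₁, ht₁, hR₁⟩ := Cmd.run_compile ω rescaleCmd hR (by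
    simp [rescaleCmd, Cmd.Ok, Term.Ok])
  obtain ⟨T', hT'⟩ : ∃ T', T' = ⌊E.x * (2 * N : ℕ)⌋₊ := ⟨_, rfl⟩
  have h₁ : Ready n (2 * N) T' P 0 (rescaleCmd.run E A) := by
    constructor <;> simp [rescaleCmd, Cmd.run, Term.eval, h.size, h.scale, h.perm, h.fresh, h.pos,
      hT']
  have hf₁ : (rescaleCmd.run E A).var .flag = 0 := by simp [rescaleCmd, Cmd.run, Term.eval]
  obtain ⟨t₂, s₂, A₂, hr₂, hR₂, h₂, hf₂, hA₂, ht₂⟩ := run_clear ω hR₁ h₁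
  obtain ⟨t₃, s₃, hr₃, ht₃, hR₃⟩ := Cmd.run_compile ω (.set .round (.const 0)) hR₂ trivial
  have h₃ : Ready n (2 * N) T' P 0 ((Cmd.set .round (.const 0)).run E A₂) := h₂.next 0
  rw [← hT']
  have hdist := hN.dist
  rw [← hT'] at hdist
  obtain ⟨a, E', A', t, s', hr, hR', ⟨rfl, ha, hA, hd, hl, hf, hf'⟩, hc, hle⟩ := run_while (ω := ω)
    (c := roundLt) (p := .seq roundProg (Cmd.set .round (.add (.var .round) (.const 1))).compile)
    (α := ℕ)
    (fun a E' A' => E' = E ∧ a ≤ n ∧ Ready n (2 * N) T' P a A' ∧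
      (∀ v < n, A'.arr .dist v = distAfter T' D P a v) ∧
      (∀ v < n, A'.arr .label v = labelAfter T' D P a v) ∧
      (A'.var .flag ≠ 0 → Ambiguous n T' D) ∧
      (A'.var .flag = 0 → ∀ j < a, ∀ v < n, T' < distAfter T' D P j v → D (P j) v ≤ T' →
        D (P j) v + n ≤ T'))
    (fun a => loopTime * (n - a) + ∑ i ∈ Finset.Ico a n,
      roundTime (E.net n (2 * N) T' (P i) (i + 1)) (distAfter T' D P i) (D (P i)))
    (fun _ _ _ _ => ⟨trivial, trivial⟩)
    (by
      rintro a E' B s ⟨rfl, ha, hB, hd, hl, hf, hf'⟩ hR hc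
      simp only [roundLt, Cond.Holds, Term.eval, hB.round, hB.size] at hc
      have hX := hN.valid T' (P a) (a + 1) (by omega)
      have hdL : ∀ v e, (E'.net n (2 * N) T' (P a) (a + 1)).IsArc v e →
          ∀ i ≤ a, distAfter T' D P i ((E'.net n (2 * N) T' (P a) (a + 1)).tgt e) ≤
            distAfter T' D P i v + (E'.net n (2 * N) T' (P a) (a + 1)).wt e := by
        intro v e he i hi
        induction i with
        | zero => exact Nat.le_add_right _ _
        | succ i ih =>
          have h1 := (hdist (P i) (i + 1) (hP i (by omega))).arc v e he
          have h2 := ih (by omega)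
          simp only [distAfter]
          change D (P i) ((E'.net n (2 * N) T' (P a) (a + 1)).tgt e) ≤
            D (P i) v + (E'.net n (2 * N) T' (P a) (a + 1)).wt e at h1
          omega
      have hs : Search.Setup (E'.net n (2 * N) T' (P a) (a + 1)) (B.arr .dist) (D (P a))
          (B.arr .label) := by
        refine ⟨fun v hv => ?_, fun v e he => ?_, (hdist _ _ (hP a hc)).arc, fun v hv => ?_⟩
        · rw [hd v hv]; exact distAfter_le _ _ _ _ _
        · rw [hd v he.1, hd _ (hX.tgt_lt v e he)]
          exact hdL v e he a le_rfl
        · rw [hd v hv, hl v hv]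
          exact labelAfter_eq_zero_iff
      obtain ⟨t, s', A', hr, hR', hA', hdone, ht⟩ :=
        run_roundProg ω hR hN.good hB (hP a hc) hX hs (hdist _ _ (hP a hc))
      obtain ⟨t', s'', hr', ht', hR''⟩ := Cmd.run_compile ω
        (.set .round (.add (.var .round) (.const 1))) hR' ⟨trivial, trivial⟩
      refine ⟨a + 1, _, _, _, s'', hr.seq hr', hR'', ⟨rfl, hc, ?_, ?_, ?_, ?_, ?_⟩, ?_⟩
      · have := hA'.next (a + 1)
        simpa [Cmd.run, Term.eval, hA'.round] using this
      · intro v hv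
        simp only [Cmd.run, Store.setVar_arr, distAfter]
        rw [hdone.dist v hv, hd v hv]
      · intro v hv
        simp only [Cmd.run, Store.setVar_arr, labelAfter]
        rw [hdone.label v hv, hd v hv, hl v hv]
        rfl
      · intro h1
        rcases hdone.flag_ne (by simpa [Cmd.run] using h1) with h2 | ⟨v, hv, h2⟩
        · exact hf h2
        · exact ⟨P a, hP a hc, v, hv, h2⟩
      · intro h1 j hj v hv h2 h3
        obtain ⟨h4, h5⟩ := hdone.flag_eq (by simpa [Cmd.run] using h1)
        rcases Nat.lt_succ_iff_lt_or_eq.1 hj with hj | rfl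
        · exact hf' h4 j hj v hv h2 h3
        · exact h5 v hv (by rw [hd v hv]; exact h2) h3
      · have h1 : roundLt.compile.cost + t' ≤ loopTime := by unfold loopTime; omega
        obtain ⟨b, hb⟩ : ∃ b, n - a = b + 1 := ⟨n - a - 1, by omega⟩
        have h2 : roundTime (E'.net n (2 * N) T' (P a) (a + 1)) (B.arr .dist) (D (P a)) =
            roundTime (E'.net n (2 * N) T' (P a) (a + 1)) (distAfter T' D P a) (D (P a)) := by
          unfold roundTime
          rw [reached_congr hd]
        rw [hb, show n - (a + 1) = b by omega, Nat.mul_succ, Finset.sum_eq_sum_Ico_succ_bot hc]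
        omega)
    (a := 0) ⟨rfl, by omega, h₃, fun v hv => (hA₂ v hv).1, fun v hv => (hA₂ v hv).2, fun h1 => by
      simp [Cmd.run, hf₂, hf₁] at h1, fun _ j hj => absurd hj (by omega)⟩ hR₃
  simp only [roundLt, Cond.Holds, Term.eval, hA.round, hA.size] at hc
  obtain rfl : a = n := by omega
  refine ⟨_, s', A', hr₁.seq (hr₂.seq (hr₃.seq hr)), hR', hA, hf, hf', hl, ?_⟩
  unfold attemptTime
  rw [← hT', Finset.range_eq_Ico]
  have h1 : t₁ + roundLt.compile.cost + t₃ + roundLt.compile.cost ≤ loopTime := by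
    unfold loopTime; omega
  rw [show loopTime * (1 + 2 * a) = loopTime + loopTime * a + loopTime * a by ring]
  rw [Nat.sub_zero] at hle
  omega

/-! ### Repetition with finer scales -/

/-- The condition of the loop over the scales. -/
def flagPos : Cond := .lt (.const 0) (.var .flag)

/-- When an attempt fails, it is repeated with the scale doubled. The loop ends at the latest with
the first scale for which no distance is ambiguous. -/
theorem run_attempts (ω : ℕ → unitInterval) {E : Env} {n N T : ℕ} {P : ℕ → ℕ} {i : ℕ}
    {s : State} {A : Store} (hR : Rep E s A) (h : Ready n N T P i A) (hP : ∀ i < n, P i < n)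
    {D : ℕ → ℕ → ℕ → ℕ} (hD : ∀ k, Attempt E n (2 ^ (k + 1) * N) (D k)) (hf : A.var .flag ≠ 0)
    {K : ℕ} (hK : ¬ Ambiguous n ⌊E.x * (2 ^ (K + 1) * N : ℕ)⌋₊ (D K)) :
    ∃ t s' A' k, Run ω (.while flagPos.compile attemptProg) s t s' ∧ Rep E s' A' ∧
      A'.var .size = n ∧
      Certified n ⌊E.x * (2 ^ (k + 1) * N : ℕ)⌋₊ (D k) P ∧
      (∀ v < n, A'.arr .label v =
        labelAfter ⌊E.x * (2 ^ (k + 1) * N : ℕ)⌋₊ (D k) P n v) ∧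
      t ≤ ∑ k ∈ Finset.range (K + 1),
        (attemptTime E n (2 ^ (k + 1) * N) (D k) P + flagPos.compile.cost) +
          flagPos.compile.cost := by
  obtain ⟨a, E', A', t, s', hr, hR', ⟨rfl, T', i', hA, hf, hf'⟩, hc, hle⟩ := run_while (ω := ω)
    (c := flagPos) (p := attemptProg) (α := ℕ)
    (fun a E' A' => E' = E ∧ ∃ T' i', Ready n (2 ^ a * N) T' P i' A' ∧
      (A'.var .flag ≠ 0 → a ≤ K) ∧ (A'.var .flag = 0 → ∃ k,
        Certified n ⌊E.x * (2 ^ (k + 1) * N : ℕ)⌋₊ (D k) P ∧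
        ∀ v < n, A'.arr .label v = labelAfter ⌊E.x * (2 ^ (k + 1) * N : ℕ)⌋₊ (D k) P n v))
    (fun a => ∑ k ∈ Finset.Ico a (K + 1),
      (attemptTime E n (2 ^ (k + 1) * N) (D k) P + flagPos.compile.cost))
    (fun _ _ _ _ => ⟨trivial, trivial⟩)
    (by
      rintro a E' B s ⟨rfl, T', i', hB, hf, hf'⟩ hR hc
      simp only [flagPos, Cond.Holds, Term.eval] at hc
      have haK := hf (by omega)
      have h2 : 2 * (2 ^ a * N) = 2 ^ (a + 1) * N := by ring
      have hN := hD a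
      rw [← h2] at hN
      obtain ⟨t, s', A', hr, hR', hA', h3, h4, h5, h6⟩ := run_attemptProg ω hR hB hP hN
      rw [h2] at h3 h4 h5 h6 hA'
      refine ⟨a + 1, _, _, t, s', hr, hR', ⟨rfl, _, _, hA', fun h7 => ?_, fun h7 =>
        ⟨a, h4 h7, h5⟩⟩, ?_⟩
      · have : a ≠ K := by
          rintro rfl
          exact hK (h3 h7)
        omega
      · rw [Finset.sum_eq_sum_Ico_succ_bot (by omega : a < K + 1)]
        omega)
    (a := 0) ⟨rfl, T, i, by simpa using h, fun _ => Nat.zero_le _, fun h0 => absurd h0 hf⟩ hR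
  simp only [flagPos, Cond.Holds, Term.eval] at hc
  obtain ⟨k, h1, h2⟩ := hf' (by omega)
  refine ⟨t, s', A', k, hr, hR', hA.size, h1, h2, ?_⟩
  rw [Finset.range_eq_Ico]
  omega

/-! ### The whole program -/

theorem Rep.setX {E : Env} {s : State} {A : Store} (h : Rep E s A) {x : ℝ} (hx : 0 ≤ x) (d : ℕ) :
    Rep { E with x := x, drawn := d }
      { s with reg := Function.update s.reg 2 x, drawn := d } A := by
  refine ⟨?_, by simp, ?_, fun y => ?_, h.input, h.arr, rfl, h.scale_nonneg, hx⟩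
  · simpa [Function.update_apply] using h.scale
  · simpa [Function.update_apply] using h.base
  · simpa [Function.update_apply, y.idx_ne.2.1] using h.var y

theorem Rep.setInput {E : Env} {s : State} {A : Store} (h : Rep E s A) {a : ℕ} (ha : a < E.base)
    (r : ℝ) : Rep { E with input := Function.update E.input a r }
      { s with mem := Function.update s.mem a r } A := by
  refine ⟨h.scale, h.x, h.base, h.var, fun b hb => ?_, fun f i => ?_, h.drawn, h.scale_nonneg,
    h.x_nonneg⟩
  · by_cases hba : b = a
    · subst hba; simp
    · simpa [hba] using h.input b hb
  · rw [← h.arr f i]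
    refine Function.update_of_ne ?_ _ _
    change E.base + 16 * i + f.idx ≠ a
    omega

/-- The array after `i` steps of the shuffle, where step `i` writes `i` into the cell `j i ≤ i` and
moves the old content of that cell to the cell `i`. -/
def shuffleArr (j : ℕ → ℕ) : ℕ → ℕ → ℕ
  | 0 => fun _ => 0
  | i + 1 => Function.update (Function.update (shuffleArr j i) i (shuffleArr j i (j i))) (j i) i

section

open Term Var

/-- A step of the shuffle. -/
def shuffleCmd : Cmd :=
  .set cand (frac (add (var round) (const 1))) ;;
  .put .perm (var round) (get .perm (var cand)) ;;
  .put .perm (var cand) (var round) ;;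
  .set round (add (var round) (const 1))

/-- Initialize the scale, the flag, and the memory management. -/
def setupCmd : Cmd :=
  .set scale (mul (const 4) (mul (var size) (mul (var size) (var size)))) ;;
  .set flag (const 1) ;; .set fresh (const 1)

/-- Choose a random permutation. -/
def shuffleProg : Prog :=
  .while roundLt.compile (.seq (.random 2) shuffleCmd.compile)

/-- Copy the labels to the first cells of the memory. -/
def outputProg : Prog :=
  .while roundLt.compile <|
    .seq (.store (.reg round.idx) (get .label (var round)).compile)
      (Cmd.set round (add (var round) (const 1))).compile

/-- Choose the random number `x = R / Δ` in `[1 / 4, 1 / 2]`. -/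
def radiusProg : Prog :=
  .seq (.random 2) (.set 2 (.div (.add (.const 1) (.reg 2)) (.const 4)))

/-- The program that samples the partition. -/
def ckrProg : Prog :=
  .seq (.set 3 (.mem (.reg 0))) <| .seq shuffleProg <| .seq radiusProg <|
  .seq setupCmd.compile <| .seq (.while flagPos.compile attemptProg) <|
  .seq (Cmd.set round (const 0)).compile <| .seq outputProg <| .set 0 (.const 0)

end

/-- The constant for the running time of everything but the attempts. -/
def baseTime : ℕ :=
  20 + 2 * roundLt.compile.cost + shuffleCmd.cost + setupCmd.cost + flagPos.compile.cost +
    (Cmd.set .round (.const 0)).cost + (Term.get .label (.var .round)).compile.cost +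
    (Cmd.set .round (.add (.var .round) (.const 1))).cost

theorem run_shuffleProg (ω : ℕ → unitInterval) {E : Env} {s : State} {A : Store} {n : ℕ}
    (hR : Rep E s A) (hn : A.var .size = n) (hr : A.var .round = 0) (hd : E.drawn = 0)
    (hp : A.arr .perm = fun _ => 0) (hpos : ∀ v, A.arr .pos v = 0) :
    ∃ t s' A' x, Run ω shuffleProg s t s' ∧ Rep { E with x := x, drawn := n } s' A' ∧
      A'.var .size = n ∧ (∀ v, A'.arr .pos v = 0) ∧
      A'.arr .perm = shuffleArr (fun i => ⌊(ω i : ℝ) * (i + 1 : ℕ)⌋₊) n ∧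
      t ≤ baseTime * n + roundLt.compile.cost := by
  obtain ⟨a, E', A', t, s', hr, hR', ⟨x, rfl, ha, hs, hr', hpos', hp'⟩, hc, hle⟩ :=
    run_while (ω := ω) (c := roundLt) (p := .seq (.random 2) shuffleCmd.compile) (α := ℕ)
    (fun a E' A' => ∃ x, E' = { E with x := x, drawn := a } ∧ a ≤ n ∧ A'.var .size = n ∧
      A'.var .round = a ∧ (∀ v, A'.arr .pos v = 0) ∧
      A'.arr .perm = shuffleArr (fun i => ⌊(ω i : ℝ) * (i + 1 : ℕ)⌋₊) a)
    (fun a => baseTime * (n - a)) (fun _ _ _ _ => ⟨trivial, trivial⟩)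
    (by
      rintro a E' B s ⟨x, rfl, ha, hB, hr, hpos, hp⟩ hR hc
      simp only [roundLt, Cond.Holds, Term.eval, hB, hr] at hc
      have hR₁ := hR.setX (ω s.drawn).2.1 (s.drawn + 1)
      have hdr : s.drawn = a := hR.drawn
      obtain ⟨t, s', hrun, ht, hR'⟩ := Cmd.run_compile ω shuffleCmd hR₁
        (by simp [shuffleCmd, Cmd.Ok, Term.Ok])
      refine ⟨a + 1, _, _, _, s', (Run.random 2 s).seq hrun, hR',
        ⟨(ω s.drawn : ℝ), ?_, hc, ?_, ?_, ?_, ?_⟩, ?_⟩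
      · simp only [hdr]
      · simp [shuffleCmd, Cmd.run, hB]
      · simp [shuffleCmd, Cmd.run, Term.eval, hr]
      · simp [shuffleCmd, Cmd.run, hpos]
      · simp [shuffleCmd, Cmd.run, Term.eval, hr, hdr, hp, shuffleArr]
      · have h1 : roundLt.compile.cost + (1 + t) ≤ baseTime := by unfold baseTime; omega
        obtain ⟨b, hb⟩ : ∃ b, n - a = b + 1 := ⟨n - a - 1, by omega⟩
        rw [hb, show n - (a + 1) = b by omega, Nat.mul_succ]
        omega)
    (a := 0) ⟨E.x, by rw [← hd], by omega, hn, hr, hpos, by rw [hp]; rfl⟩ hR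
  simp only [roundLt, Cond.Holds, Term.eval, hs, hr'] at hc
  obtain rfl : a = n := by omega
  exact ⟨t, s', A', x, hr, hR', hs, hpos', hp', by rw [Nat.sub_zero] at hle; omega⟩

theorem run_outputProg (ω : ℕ → unitInterval) {E : Env} {s : State} {A : Store} {n : ℕ}
    (hR : Rep E s A) (hn : A.var .size = n) (hr : A.var .round = 0) (hb : n ≤ E.base) :
    ∃ t s', Run ω outputProg s t s' ∧ (∀ v < n, s'.mem v = A.arr .label v) ∧
      t ≤ baseTime * n + roundLt.compile.cost := by
  obtain ⟨a, E', A', t, s', hr, hR', ⟨ha, hb', hs, hr', hl, hv⟩, hc, hle⟩ :=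
    run_while (ω := ω) (c := roundLt)
    (p := .seq (.store (.reg Var.round.idx) (Term.get .label (.var .round)).compile)
      (Cmd.set .round (.add (.var .round) (.const 1))).compile) (α := ℕ)
    (fun a E' A' => a ≤ n ∧ E'.base = E.base ∧ A'.var .size = n ∧ A'.var .round = a ∧
      A'.arr .label = A.arr .label ∧ ∀ v < a, E'.input v = A.arr .label v)
    (fun a => baseTime * (n - a)) (fun _ _ _ _ => ⟨trivial, trivial⟩)
    (by
      rintro a E' B s ⟨ha, hb', hB, hr, hl, hv⟩ hR hc
      simp only [roundLt, Cond.Holds, Term.eval, hB, hr] at hc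
      have hreg : (Expr.reg Var.round.idx).eval s = a := by
        simp only [Expr.eval]; rw [hR.var, hr]
      have hlab : (Term.get .label (.var .round)).compile.eval s = A.arr .label a := by
        rw [Term.eval_compile hR (.get .label (.var .round)) trivial]
        simp [Term.eval, hl, hr]
      have hR₁ := hR.setInput (a := a) (by omega) (A.arr .label a)
      have hst := Run.store (ω := ω) (.reg Var.round.idx)
        (Term.get .label (.var .round)).compile s
      rw [hreg, hlab, Nat.floor_natCast] at hst
      obtain ⟨t, s', hrun, ht, hR'⟩ := Cmd.run_compile ω
        (.set .round (.add (.var .round) (.const 1))) hR₁ ⟨trivial, trivial⟩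
      refine ⟨a + 1, _, _, _, s', hst.seq hrun, hR', ⟨hc, hb', ?_, ?_, ?_, fun v hva => ?_⟩, ?_⟩
      · simp [Cmd.run, hB]
      · simp [Cmd.run, Term.eval, hr]
      · simp [Cmd.run, hl]
      · by_cases h1 : v = a
        · subst h1; simp
        · simpa [h1] using hv v (by omega)
      · have h1 : roundLt.compile.cost + (1 + (Term.get .label (.var .round)).compile.cost + 1 + t)
            ≤ baseTime := by unfold baseTime; omega
        obtain ⟨b, hb⟩ : ∃ b, n - a = b + 1 := ⟨n - a - 1, by omega⟩
        rw [hb, show n - (a + 1) = b by omega, Nat.mul_succ]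
        simp only [Expr.cost]
        omega)
    (a := 0) ⟨by omega, rfl, hn, hr, rfl, fun v hv => absurd hv (by omega)⟩ hR
  simp only [roundLt, Cond.Holds, Term.eval, hs, hr'] at hc
  obtain rfl : a = n := by omega
  refine ⟨t, s', hr, fun v hva => ?_, by rw [Nat.sub_zero] at hle; omega⟩
  rw [hR'.input v (by omega), hv v hva]

/-- The environment during the attempts. -/
def mainEnv (s : State) (n base : ℕ) (x : ℝ) : Env where
  base := base
  input := s.mem
  scale := s.reg 1
  x := x
  drawn := n + 1

/-- A run of the whole program. The output comes from some attempt `k` that is certified, and there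
are at most `K + 1` attempts if the attempt `K` is not ambiguous. The initial scale `4 n³` makes the
probability of ambiguity in the attempt `k` at most `2⁻⁽ᵏ⁺¹⁾`. -/
theorem run_ckrProg (ω : ℕ → unitInterval) {s : State} {n base : ℕ} (h0 : s.reg 0 = n)
    (h1 : 0 ≤ s.reg 1) (h2 : ∀ i, 2 ≤ i → s.reg i = 0) (hb : s.mem n = base) (hnb : n ≤ base)
    (hmem : ∀ a ≥ base, s.mem a = 0) (hd : s.drawn = 0) {P : ℕ → ℕ}
    (hP : P = shuffleArr (fun i => ⌊(ω i : ℝ) * (i + 1 : ℕ)⌋₊) n) (hPn : ∀ i < n, P i < n)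
    {x : ℝ} (hx : x = (1 + ω n) / 4) {D : ℕ → ℕ → ℕ → ℕ}
    (hD : ∀ k, Attempt (mainEnv s n base x) n (2 ^ (k + 1) * (4 * n ^ 3)) (D k)) {K : ℕ}
    (hK : ¬ Ambiguous n ⌊x * (2 ^ (K + 1) * (4 * n ^ 3) : ℕ)⌋₊ (D K)) :
    ∃ t s' k, Run ω ckrProg s t s' ∧ s'.reg 0 = 0 ∧
      Certified n ⌊x * (2 ^ (k + 1) * (4 * n ^ 3) : ℕ)⌋₊ (D k) P ∧
      (∀ v < n, s'.mem v = labelAfter ⌊x * (2 ^ (k + 1) * (4 * n ^ 3) : ℕ)⌋₊ (D k) P n v) ∧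
      t ≤ baseTime * (1 + 2 * n) + ∑ k ∈ Finset.range (K + 1),
        (attemptTime (mainEnv s n base x) n (2 ^ (k + 1) * (4 * n ^ 3)) (D k) P +
          flagPos.compile.cost) := by
  have hr₁ := Run.set (ω := ω) 3 (.mem (.reg 0)) s
  simp only [Expr.eval, h0, Nat.floor_natCast, hb] at hr₁
  have hR₁ : Rep { mainEnv s n base 0 with drawn := 0 }
      { s with reg := Function.update s.reg 3 base }
      { var := fun y => if y = .size then n else 0, arr := fun _ _ => 0 } := by
    refine ⟨?_, ?_, ?_, fun y => ?_, fun a _ => rfl, fun f i => ?_, hd, h1, le_rfl⟩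
    · simp [mainEnv]
    · simp [mainEnv, h2]
    · simp [mainEnv]
    · have hy := y.idx_ne.2.2
      simp only [Function.update_apply, hy, if_false]
      cases y <;> simp [Var.idx, h0, h2]
    · simp only [mainEnv, Nat.cast_zero]
      exact hmem _ (by omega)
  obtain ⟨t₂, s₂, A₂, y, hr₂, hR₂, hs₂, hpos₂, hp₂, ht₂⟩ := run_shuffleProg ω hR₁ (n := n)
    (by simp) (by simp) rfl rfl (fun _ => rfl)
  have hdr : s₂.drawn = n := hR₂.drawn
  have hr₃ : Run ω radiusProg s₂ _ _ := (Run.random 2 s₂).seq (Run.set 2 _ _)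
  simp only [Expr.eval, Function.update_self, hdr, Function.update_idem, Int.cast_one,
    Int.cast_ofNat, ← hx] at hr₃
  have hx0 : 0 ≤ x := by
    have := (ω n).2.1
    rw [hx]
    positivity
  have hR₃ := hR₂.setX hx0 (n + 1)
  obtain ⟨t₄, s₄, hr₄, ht₄, hR₄⟩ := Cmd.run_compile ω setupCmd hR₃
    (by simp [setupCmd, Cmd.Ok, Term.Ok])
  have hA₄ : Ready n (4 * n ^ 3) ((setupCmd.run (mainEnv s n base x) A₂).var .bound) P
      ((setupCmd.run (mainEnv s n base x) A₂).var .round)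
      (setupCmd.run (mainEnv s n base x) A₂) := by
    constructor <;> simp [setupCmd, Cmd.run, Term.eval, hs₂, hp₂, hpos₂, hP]
    ring
  have hE : ({ mainEnv s n base 0 with x := x, drawn := n + 1 } : Env) = mainEnv s n base x := rfl
  simp only at hR₄ hR₃ hr₄
  rw [hE] at hR₄
  obtain ⟨t₅, s₅, A₅, k, hr₅, hR₅, hs₅, hcert, hlab, ht₅⟩ := run_attempts ω hR₄ hA₄ hPn hD
    (by simp [setupCmd, Cmd.run, Term.eval]) hK
  obtain ⟨t₆, s₆, hr₆, ht₆, hR₆⟩ := Cmd.run_compile ω (.set .round (.const 0)) hR₅ trivial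
  obtain ⟨t₇, s₇, hr₇, hm₇, ht₇⟩ := run_outputProg ω hR₆ (n := n) (by simp [Cmd.run, hs₅])
    (by simp [Cmd.run, Term.eval]) hnb
  have hr₈ := Run.set (ω := ω) 0 (.const 0) s₇
  refine ⟨_, _, k, hr₁.seq (hr₂.seq (hr₃.seq (hr₄.seq (hr₅.seq (hr₆.seq (hr₇.seq hr₈)))))), ?_,
    hcert, fun v hv => ?_, ?_⟩
  · simp [Expr.eval]
  · change s₇.mem v = _
    rw [hm₇ v hv]
    exact congrArg _ (hlab v hv)
  · simp only [Expr.cost]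
    have h3 : t₄ + t₆ + 20 + 2 * roundLt.compile.cost + flagPos.compile.cost ≤ baseTime := by
      unfold baseTime; omega
    rw [show baseTime * (1 + 2 * n) = baseTime + baseTime * n + baseTime * n by ring]
    have ht₅' : t₅ ≤ ∑ k ∈ Finset.range (K + 1),
        (attemptTime (mainEnv s n base x) n (2 ^ (k + 1) * (4 * n ^ 3)) (D k) P +
          flagPos.compile.cost) + flagPos.compile.cost := ht₅
    omega

/-! ### The words of the input -/

theorem length_flatMap_range (h : ℕ → List ℝ) (m : ℕ) :
    ((List.range m).flatMap h).length = ∑ i ∈ Finset.range m, (h i).length := by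
  induction m with
  | zero => simp
  | succ m ih => simp [List.range_succ, Finset.sum_range_succ, ih]

theorem getD_flatMap_range (h : ℕ → List ℝ) {m v t : ℕ} (hv : v < m) (ht : t < (h v).length) :
    ((List.range m).flatMap h).getD (∑ i ∈ Finset.range v, (h i).length + t) 0 =
      (h v).getD t 0 := by
  induction m with
  | zero => omega
  | succ m ih =>
    rw [List.range_succ, List.flatMap_append]
    rcases Nat.lt_succ_iff_lt_or_eq.1 hv with hv | rfl
    · rw [List.getD_append, ih hv]
      rw [length_flatMap_range]
      have h1 : ∑ i ∈ Finset.range (v + 1), (h i).length ≤ ∑ i ∈ Finset.range m, (h i).length :=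
        Finset.sum_le_sum_of_subset (Finset.range_mono hv)
      rw [Finset.sum_range_succ] at h1
      omega
    · rw [List.getD_append_right, length_flatMap_range]
      · simp
      · rw [length_flatMap_range]; omega

theorem length_flatMap_pair {α : Type*} (f g : α → ℝ) (l : List α) :
    (l.flatMap fun u => [f u, g u]).length = 2 * l.length := by
  induction l with
  | nil => rfl
  | cons a l ih => simp only [List.flatMap_cons, List.length_append, ih, List.length_cons,
      List.length_nil]; omega

theorem getD_flatMap_pair {α : Type*} (f g : α → ℝ) (l : List α) (t : ℕ) (ht : t < l.length) :
    (l.flatMap fun u => [f u, g u]).getD (2 * t) 0 = f l[t] ∧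
      (l.flatMap fun u => [f u, g u]).getD (2 * t + 1) 0 = g l[t] := by
  induction l generalizing t with
  | nil => simp at ht
  | cons a l ih =>
    cases t with
    | zero => simp
    | succ t =>
      have := ih t (by simpa using ht)
      rw [show 2 * (t + 1) = 2 * t + 1 + 1 by ring]
      simpa using this

section
variable {n : ℕ} (adj : Fin n → List (Fin n)) (w : Sym2 (Fin n) → ℝ)

/-- The words of the adjacency list of the vertex `i`. -/
def arcWords (i : ℕ) : List ℝ :=
  if h : i < n then (adj ⟨i, h⟩).flatMap fun u : Fin n => [(u.1 : ℝ), w s(⟨i, h⟩, u)] else []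

theorem length_arcWords (v : Fin n) : (arcWords adj w v).length = 2 * (adj v).length := by
  rw [arcWords, dif_pos v.2, length_flatMap_pair]

theorem graphWords_eq : graphWords adj w =
    ((List.range (n + 1)).map fun v => (listStart adj v : ℝ)) ++
      (List.range n).flatMap (arcWords adj w) := by
  rw [graphWords, ← List.map_coe_finRange_eq_range (n := n), List.flatMap_map]
  congr 2
  funext v
  rw [arcWords, dif_pos v.2]

theorem listStart_eq {v : ℕ} (hv : v ≤ n) :
    listStart adj v = n + 1 + ∑ i ∈ Finset.range v, (arcWords adj w i).length := by
  rw [listStart, Finset.mul_sum, Finset.sum_filter]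
  congr 1
  have h1 : ∀ u : Fin n, (if u.1 < v then 2 * (adj u).length else 0) =
      (fun i => if i < v then (arcWords adj w i).length else 0) u.1 := fun u => by
    simp only [length_arcWords]
  rw [Finset.sum_congr rfl fun u _ => h1 u,
    Fin.sum_univ_eq_sum_range (fun i => if i < v then (arcWords adj w i).length else 0) n,
    ← Finset.sum_filter]
  congr 1
  ext i
  simp only [Finset.mem_filter, Finset.mem_range]
  omega

theorem listStart_succ (v : Fin n) :
    listStart adj (v + 1) = listStart adj v + 2 * (adj v).length := by
  rw [listStart_eq adj (fun _ => 0) v.2, listStart_eq adj (fun _ => 0) v.2.le,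
    Finset.sum_range_succ, length_arcWords, ← add_assoc]

theorem listStart_le {v : ℕ} (hv : v ≤ n) : listStart adj v ≤ listStart adj n := by
  unfold listStart
  gcongr

theorem length_graphWords : (graphWords adj w).length = listStart adj n := by
  rw [graphWords_eq, List.length_append, length_flatMap_range, listStart_eq adj w le_rfl]
  simp

theorem inputState_mem_start (Δ : ℝ) {v : ℕ} (hv : v ≤ n) :
    (inputState adj w Δ).mem v = listStart adj v := by
  change (graphWords adj w).getD v 0 = _
  rw [graphWords_eq, List.getD_append _ _ _ _ (by simp; omega)]
  rw [List.getD_eq_getElem _ _ (by simp; omega)]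
  simp

theorem inputState_mem_arc (Δ : ℝ) (v : Fin n) (t : ℕ) (ht : t < (adj v).length) :
    (inputState adj w Δ).mem (listStart adj v + 2 * t) = ((adj v)[t] : ℕ) ∧
      (inputState adj w Δ).mem (listStart adj v + 2 * t + 1) = w s(v, (adj v)[t]) := by
  have key : ∀ r < 2 * (adj v).length, (inputState adj w Δ).mem (listStart adj v + r) =
      (arcWords adj w v).getD r 0 := by
    intro r hr
    change (graphWords adj w).getD _ 0 = _
    rw [listStart_eq adj w v.2.le, graphWords_eq, List.getD_append_right _ _ _ _ (by simp; omega),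
      ← getD_flatMap_range (arcWords adj w) v.2 (by rw [length_arcWords]; exact hr)]
    congr 1
    simp
    omega
  have h1 := getD_flatMap_pair (fun u : Fin n => (u.1 : ℝ)) (fun u => w s(v, u)) (adj v) t ht
  rw [key _ (by omega), add_assoc, key _ (by omega), arcWords, dif_pos v.2]
  exact h1

theorem inputState_mem_of_ge (Δ : ℝ) {a : ℕ} (ha : listStart adj n ≤ a) :
    (inputState adj w Δ).mem a = 0 := by
  change (graphWords adj w).getD a 0 = _
  rw [List.getD_eq_default _ _ (by rw [length_graphWords]; exact ha)]

end

/-! ### Distances with rounded lengths -/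

section
variable {n : ℕ} {G : SimpleGraph (Fin n)} {w : Sym2 (Fin n) → ℝ} {adj : Fin n → List (Fin n)}
  {Δ : ℝ}

/-- The edge weights in units of `Δ / N`, rounded down. -/
noncomputable def roundedWeight (w : Sym2 (Fin n) → ℝ) (Δ : ℝ) (N : ℕ) (e : Sym2 (Fin n)) : ℕ :=
  ⌊w e * N / Δ⌋₊

/-- The shortest-path metric for integer lengths `ℓ`. -/
noncomputable def walkDist (G : SimpleGraph (Fin n)) (ℓ : Sym2 (Fin n) → ℕ) (u v : Fin n) : ℕ∞ :=
  ⨅ p : G.Walk u v, ((p.edges.map ℓ).sum : ℕ∞)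

theorem walkDist_le_iff {ℓ : Sym2 (Fin n) → ℕ} {u v : Fin n} {k : ℕ} :
    walkDist G ℓ u v ≤ k ↔ ∃ p : G.Walk u v, (p.edges.map ℓ).sum ≤ k := by
  constructor
  · intro h
    have h1 : walkDist G ℓ u v < ((k + 1 : ℕ) : ℕ∞) :=
      lt_of_le_of_lt h (by exact_mod_cast Nat.lt_succ_self k)
    obtain ⟨p, hp⟩ := iInf_lt_iff.1 h1
    exact ⟨p, Nat.lt_succ_iff.1 (by exact_mod_cast hp)⟩
  · rintro ⟨p, hp⟩
    exact (iInf_le _ p).trans (by exact_mod_cast hp)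

/-- The metric `walkDist`, cut off at `T + 1`, on natural numbers. -/
noncomputable def capDist (G : SimpleGraph (Fin n)) (ℓ : Sym2 (Fin n) → ℕ) (T : ℕ) (u v : ℕ) : ℕ :=
  if h : u < n ∧ v < n then (min ((T + 1 : ℕ) : ℕ∞) (walkDist G ℓ ⟨u, h.1⟩ ⟨v, h.2⟩)).toNat else 0

theorem coe_capDist (ℓ : Sym2 (Fin n) → ℕ) (T : ℕ) (u v : Fin n) :
    (capDist G ℓ T u v : ℕ∞) = min ((T + 1 : ℕ) : ℕ∞) (walkDist G ℓ u v) := by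
  rw [capDist, dif_pos ⟨u.2, v.2⟩, ENat.natCast_toNat]
  exact ne_top_of_le_ne_top (ENat.natCast_ne_top _) (min_le_left _ _)

theorem capDist_le_iff {ℓ : Sym2 (Fin n) → ℕ} {T : ℕ} {u v : Fin n} {k : ℕ} :
    capDist G ℓ T u v ≤ k ↔ T + 1 ≤ k ∨ ∃ p : G.Walk u v, (p.edges.map ℓ).sum ≤ k := by
  rw [← walkDist_le_iff, ← Nat.cast_le (α := ℕ∞), coe_capDist, min_le_iff, Nat.cast_le]

theorem capDist_self (ℓ : Sym2 (Fin n) → ℕ) (T : ℕ) (u : Fin n) : capDist G ℓ T u u = 0 :=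
  Nat.le_zero.1 (capDist_le_iff.2 (Or.inr ⟨.nil, by simp⟩))

/-- The environment during the attempts, for the input graph. -/
noncomputable def graphEnv (adj : Fin n → List (Fin n)) (w : Sym2 (Fin n) → ℝ) (Δ x : ℝ) : Env :=
  mainEnv (inputState adj w Δ) n (listStart adj n) x

theorem graphEnv_start {x : ℝ} {v : ℕ} (hv : v ≤ n) :
    ⌊(graphEnv adj w Δ x).input v⌋₊ = listStart adj v := by
  change ⌊(inputState adj w Δ).mem v⌋₊ = _
  rw [inputState_mem_start adj w Δ hv, Nat.floor_natCast]

theorem isArc_graphEnv {x : ℝ} {N T src lab v e : ℕ} :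
    ((graphEnv adj w Δ x).net n N T src lab).IsArc v e ↔
      ∃ (hv : v < n) (t : ℕ), t < (adj ⟨v, hv⟩).length ∧ e = listStart adj v + 2 * t := by
  constructor
  · rintro ⟨hv, h1, h2, h3⟩
    change v < n at hv
    change ⌊(graphEnv adj w Δ x).input v⌋₊ ≤ e at h1
    change e < ⌊(graphEnv adj w Δ x).input (v + 1 : ℕ)⌋₊ at h2
    change 2 ∣ e - ⌊(graphEnv adj w Δ x).input v⌋₊ at h3
    rw [graphEnv_start hv.le] at h1 h3
    rw [graphEnv_start hv, listStart_succ adj ⟨v, hv⟩] at h2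
    obtain ⟨t, ht⟩ := h3
    exact ⟨hv, t, by simp only at h2; omega, by omega⟩
  · rintro ⟨hv, t, ht, rfl⟩
    refine ⟨hv, ?_, ?_, ?_⟩
    · change ⌊(graphEnv adj w Δ x).input v⌋₊ ≤ _
      rw [graphEnv_start hv.le]
      omega
    · change _ < ⌊(graphEnv adj w Δ x).input (v + 1 : ℕ)⌋₊
      rw [graphEnv_start hv, listStart_succ adj ⟨v, hv⟩]
      simp only
      omega
    · change 2 ∣ _ - ⌊(graphEnv adj w Δ x).input v⌋₊
      rw [graphEnv_start hv.le]
      simp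

theorem tgt_graphEnv {x : ℝ} {N T src lab : ℕ} (v : Fin n) {t : ℕ} (ht : t < (adj v).length) :
    ((graphEnv adj w Δ x).net n N T src lab).tgt (listStart adj v + 2 * t) = (adj v)[t] := by
  change ⌊(inputState adj w Δ).mem _⌋₊ = _
  rw [(inputState_mem_arc adj w Δ v t ht).1, Nat.floor_natCast]

theorem wt_graphEnv {x : ℝ} {N T src lab : ℕ} (v : Fin n) {t : ℕ} (ht : t < (adj v).length) :
    ((graphEnv adj w Δ x).net n N T src lab).wt (listStart adj v + 2 * t) =
      roundedWeight w Δ N s(v, (adj v)[t]) := by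
  change ⌊(inputState adj w Δ).mem _ * N / (inputState adj w Δ).reg 1⌋₊ = _
  rw [(inputState_mem_arc adj w Δ v t ht).2]
  simp [inputState, roundedWeight]

theorem adj_getElem (hadj : IsAdjacencyList G adj) (v : Fin n) {t : ℕ}
    (ht : t < (adj v).length) : G.Adj v (adj v)[t] :=
  ((hadj v).2 _).1 (List.getElem_mem ht)

theorem good_graphEnv (hw : ∀ e ∈ G.edgeSet, 0 < w e) (hadj : IsAdjacencyList G adj) (x : ℝ) :
    (graphEnv adj w Δ x).Good n := by
  refine ⟨fun v hv => ⟨?_, ?_⟩, fun v e hv h1 h2 h3 => ?_⟩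
  · change v < listStart adj n
    unfold listStart; omega
  · change 0 ≤ (inputState adj w Δ).mem v
    rw [inputState_mem_start adj w Δ hv]
    positivity
  · obtain ⟨hv, t, ht, rfl⟩ := isArc_graphEnv.1
      (show ((graphEnv adj w Δ x).net n 0 0 0 0).IsArc v e from ⟨hv, h1, h2, h3⟩)
    obtain ⟨h4, h5⟩ := inputState_mem_arc adj w Δ ⟨v, hv⟩ t ht
    refine ⟨?_, ?_, ?_⟩
    · change _ < listStart adj n
      have h6 := listStart_succ adj ⟨v, hv⟩
      have h7 := listStart_le adj (v := v + 1) hv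
      simp only at h6
      omega
    · change 0 ≤ (inputState adj w Δ).mem _
      rw [h4]
      positivity
    · change 0 ≤ (inputState adj w Δ).mem _
      rw [h5]
      exact (hw _ (adj_getElem hadj _ ht)).le

theorem valid_graphEnv (x : ℝ) {N T src lab : ℕ} (hlab : 0 < lab) :
    ((graphEnv adj w Δ x).net n N T src lab).Valid := by
  refine ⟨fun v e he => ?_, fun v hv => ?_, hlab⟩
  · obtain ⟨hv, t, ht, rfl⟩ := isArc_graphEnv.1 he
    rw [tgt_graphEnv ⟨v, hv⟩ ht]
    exact Fin.is_lt _
  · change 2 ∣ ⌊(graphEnv adj w Δ x).input (v + 1 : ℕ)⌋₊ - ⌊(graphEnv adj w Δ x).input v⌋₊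
    change v < n at hv
    rw [graphEnv_start hv.le, graphEnv_start hv, listStart_succ adj ⟨v, hv⟩]
    simp

theorem isDist_graphEnv (hadj : IsAdjacencyList G adj) (x : ℝ) {N T lab : ℕ} (src : Fin n) :
    Search.IsDist ((graphEnv adj w Δ x).net n N T src lab)
      (capDist G (roundedWeight w Δ N) T src) := by
  refine ⟨capDist_self _ _ _, fun v e he => ?_, fun f hf hT harc v hv => ?_⟩
  · obtain ⟨hv, t, ht, rfl⟩ := isArc_graphEnv.1 he
    rw [tgt_graphEnv ⟨v, hv⟩ ht, wt_graphEnv ⟨v, hv⟩ ht]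
    refine capDist_le_iff.2 ?_
    rcases (capDist_le_iff (v := ⟨v, hv⟩)).1
      (le_refl (capDist G (roundedWeight w Δ N) T src v)) with h | ⟨p, hp⟩
    · left; omega
    · right
      refine ⟨p.concat (adj_getElem hadj _ ht), ?_⟩
      rw [SimpleGraph.Walk.edges_concat, List.concat_eq_append, List.map_append, List.sum_append]
      simpa using hp
  · have hwalk : ∀ (a b : Fin n) (p : G.Walk a b),
        f b ≤ f a + (p.edges.map (roundedWeight w Δ N)).sum := by
      intro a b p
      induction p with
      | nil => simp
      | @cons a b c hab p ih =>
        obtain ⟨t, ht, hb⟩ := List.getElem_of_mem (((hadj a).2 b).2 hab)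
        have h1 := harc a (listStart adj a + 2 * t) (isArc_graphEnv.2 ⟨a.2, t, ht, rfl⟩)
        rw [tgt_graphEnv a ht, wt_graphEnv a ht, hb] at h1
        simp only [SimpleGraph.Walk.edges_cons, List.map_cons, List.sum_cons]
        omega
    change v < n at hv
    rcases (capDist_le_iff (v := ⟨v, hv⟩)).1
      (le_refl (capDist G (roundedWeight w Δ N) T src v)) with h | ⟨p, hp⟩
    · exact (hT v hv).trans h
    · have h1 := hwalk _ _ p
      have h2 : f src = 0 := hf
      simp only at h1
      omega

theorem attempt_graphEnv (hw : ∀ e ∈ G.edgeSet, 0 < w e) (hadj : IsAdjacencyList G adj) (x : ℝ)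
    (N : ℕ) :
    Attempt (graphEnv adj w Δ x) n N (capDist G (roundedWeight w Δ N) ⌊x * N⌋₊) :=
  ⟨good_graphEnv hw hadj x, fun _ _ _ hlab => valid_graphEnv x hlab,
    fun src _ hsrc => isDist_graphEnv hadj x ⟨src, hsrc⟩⟩

theorem walkDist_symm (ℓ : Sym2 (Fin n) → ℕ) (u v : Fin n) :
    walkDist G ℓ u v = walkDist G ℓ v u := by
  have h : ∀ u v : Fin n, walkDist G ℓ u v ≤ walkDist G ℓ v u := fun u v =>
    le_iInf fun p => (iInf_le _ p.reverse).trans (by simp [SimpleGraph.Walk.edges_reverse])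
  exact le_antisymm (h u v) (h v u)

/-- Rounding down a sum of lengths loses less than one unit per edge. -/
theorem sum_roundedWeight_le (hw : ∀ e ∈ G.edgeSet, 0 < w e) (hΔ : 0 < Δ) (N : ℕ)
    {u v : Fin n} (p : G.Walk u v) :
    ((p.edges.map (roundedWeight w Δ N)).sum : ℝ) ≤ (p.edges.map w).sum * N / Δ ∧
      (p.edges.map w).sum * N / Δ ≤ (p.edges.map (roundedWeight w Δ N)).sum + p.length := by
  induction p with
  | nil => simp
  | @cons a b c h p ih =>
    have h0 := hw _ (G.mem_edgeSet.2 h)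
    have h1 : 0 ≤ w s(a, b) * N / Δ := by positivity
    have h2 := Nat.floor_le h1
    have h3 := (Nat.lt_floor_add_one (w s(a, b) * N / Δ)).le
    simp only [SimpleGraph.Walk.edges_cons, List.map_cons, List.sum_cons, Nat.cast_add,
      SimpleGraph.Walk.length_cons, Nat.cast_one, add_mul, add_div, roundedWeight] at ih ⊢
    constructor <;> linarith [ih.1, ih.2]

/-- A distance at most `R = x Δ` is rounded to at most `⌊x N⌋`. -/
theorem walkDist_le_of_dist_le (hw : ∀ e ∈ G.edgeSet, 0 < w e) (hΔ : 0 < Δ) {x : ℝ}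
    {N : ℕ} (hN : 0 < N) {u v : Fin n}
    (h : shortestPathDist G w u v ≤ ENNReal.ofReal (Δ * x)) :
    walkDist G (roundedWeight w Δ N) u v ≤ (⌊x * N⌋₊ : ℕ) := by
  have hN' : (0 : ℝ) < N := by exact_mod_cast hN
  -- The infimum in the distance need not be attained a priori, but there is a walk of length
  -- less than `(⌊x N⌋ + 1) Δ / N`, since this number exceeds `R`.
  have hlt : Δ * x < (⌊x * N⌋₊ + 1) * Δ / N := by
    rw [lt_div_iff₀ hN']
    have := Nat.lt_floor_add_one (x * N)
    nlinarith
  have h1 : shortestPathDist G w u v < ENNReal.ofReal ((⌊x * N⌋₊ + 1) * Δ / N) :=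
    lt_of_le_of_lt h ((ENNReal.ofReal_lt_ofReal_iff (by positivity)).2 hlt)
  obtain ⟨p, hp⟩ := iInf_lt_iff.1 h1
  rw [ENNReal.ofReal_lt_ofReal_iff (by positivity), lt_div_iff₀ hN'] at hp
  refine walkDist_le_iff.2 ⟨p, Nat.lt_succ_iff.1 ?_⟩
  have h2 := (sum_roundedWeight_le hw hΔ N p).1
  have h3 : ((p.edges.map (roundedWeight w Δ N)).sum : ℝ) < ⌊x * N⌋₊ + 1 :=
    lt_of_le_of_lt h2 (by rw [div_lt_iff₀ hΔ]; exact hp)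
  exact_mod_cast h3

/-- If the rounded distance is at most `⌊x N⌋ - n`, then the distance is at most `R = x Δ`, since a
shortest walk has less than `n` edges. -/
theorem dist_le_of_walkDist_le (hw : ∀ e ∈ G.edgeSet, 0 < w e) (hΔ : 0 < Δ) {x : ℝ}
    {N : ℕ} (hN : 0 < N) {u v : Fin n} {k : ℕ} (hx : 0 ≤ x)
    (h : walkDist G (roundedWeight w Δ N) u v ≤ k) (hk : k + n ≤ ⌊x * N⌋₊) :
    shortestPathDist G w u v ≤ ENNReal.ofReal (Δ * x) := by
  classical
  have hN' : (0 : ℝ) < N := by exact_mod_cast hN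
  obtain ⟨p, hp⟩ := walkDist_le_iff.1 h
  have hsub : (p.bypass.edges.map (roundedWeight w Δ N)).sum ≤
      (p.edges.map (roundedWeight w Δ N)).sum :=
    (p.bypass_isPath.isTrail.edges_nodup.subperm p.edges_bypass_subset_edges).elim
      fun l ⟨h1, h2⟩ => by
      rw [← (h1.map _).sum_eq]
      exact (h2.map _).sum_le_sum (by simp)
  have hlen : p.bypass.length ≤ n := by
    have := p.bypass_isPath.length_lt
    rw [Fintype.card_fin] at this
    exact this.le
  refine (iInf_le _ p.bypass).trans (ENNReal.ofReal_le_ofReal ?_)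
  have h1 := (sum_roundedWeight_le hw hΔ N p.bypass).2
  have h2 : ((p.bypass.edges.map (roundedWeight w Δ N)).sum : ℝ) + p.bypass.length ≤ x * N := by
    refine le_trans ?_ (Nat.floor_le (by positivity : 0 ≤ x * N))
    exact_mod_cast (by omega)
  have h3 := h1.trans h2
  rw [div_le_iff₀ hΔ] at h3
  nlinarith

end

/-! ### The labels represent the CKR partition -/

/-- A labelling represents the CKR partition if the label of each vertex is the number of a cluster
that contains it. -/
theorem represents_of_mem_ckrCluster {n : ℕ} {ρ : Fin n → Fin n → ℝ≥0∞} {π : Equiv.Perm (Fin n)}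
    {R : ℝ} {s : State} (h0 : s.reg 0 = 0)
    (h : ∀ v : Fin n, ∃ j : Fin n, v ∈ ckrCluster ρ π R j ∧ s.mem v = (j + 1 : ℕ)) :
    s.Represents (ckrPartition ρ π R) := by
  choose c hc hmem using h
  have huniq : ∀ {i j v : Fin n}, v ∈ ckrCluster ρ π R i → v ∈ ckrCluster ρ π R j → i = j := by
    intro i j v hi hj
    rw [mem_ckrCluster] at hi hj
    exact le_antisymm (not_lt.1 fun hlt => hi.2 j hlt hj.1) (not_lt.1 fun hlt => hj.2 i hlt hi.1)
  have hblock : ∀ v, (Finset.univ.filter fun u => (c u : ℕ) + 1 = c v + 1) =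
      ckrCluster ρ π R (c v) := by
    intro v
    ext u
    simp only [Finset.mem_filter, Finset.mem_univ, true_and, Nat.add_right_cancel_iff, Fin.val_inj]
    exact ⟨fun h => h ▸ hc u, fun h => huniq (hc u) h⟩
  refine ⟨0, fun v => c v + 1, by simpa using h0, fun v => ⟨Nat.le_add_left _ _, (c v).2, ?_⟩, ?_⟩
  · rw [zero_add, hmem v]
  · simp only [hblock]
    ext Q
    simp only [ckrPartition, Finset.mem_erase, Finset.mem_image, Finset.mem_univ, true_and]
    constructor
    · rintro ⟨hne, i, rfl⟩
      obtain ⟨v, hv⟩ := Finset.nonempty_iff_ne_empty.2 hne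
      exact ⟨v, by rw [huniq (hc v) hv]⟩
    · rintro ⟨v, rfl⟩
      exact ⟨Finset.nonempty_iff_ne_empty.1 ⟨v, hc v⟩, c v, rfl⟩

/-- A state represents at most one partition. -/
theorem Represents.unique {n : ℕ} {s : State} {P Q : Finset (Finset (Fin n))}
    (hP : s.Represents P) (hQ : s.Represents Q) : P = Q := by
  obtain ⟨a, l, ha, hl, rfl⟩ := hP
  obtain ⟨b, k, hb, hk, rfl⟩ := hQ
  obtain rfl : a = b := by exact_mod_cast ha.symm.trans hb
  obtain rfl : l = k := funext fun v => by
    exact_mod_cast ((hl v).2.2).symm.trans (hk v).2.2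
  rfl

section
variable {n : ℕ} {G : SimpleGraph (Fin n)} {w : Sym2 (Fin n) → ℝ} {Δ : ℝ}

/-- Certified labels are those of the CKR partition for the exact metric: every vertex is within
distance `R = x Δ` of the center that labels it, and not of any earlier center. -/
theorem represents_of_certified (hw : ∀ e ∈ G.edgeSet, 0 < w e) (hΔ : 0 < Δ) {x : ℝ}
    (hx : 0 ≤ x) {N : ℕ} (hN : 0 < N) {π : Equiv.Perm (Fin n)} {P : ℕ → ℕ}
    (hP : ∀ i : Fin n, P i = π i)
    (hC : Certified n ⌊x * N⌋₊ (capDist G (roundedWeight w Δ N) ⌊x * N⌋₊) P) {s : State}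
    (h0 : s.reg 0 = 0) (hs : ∀ v < n, s.mem v =
      labelAfter ⌊x * N⌋₊ (capDist G (roundedWeight w Δ N) ⌊x * N⌋₊) P n v) :
    s.Represents (ckrPartition (shortestPathDist G w) π (Δ * x)) := by
  set T := ⌊x * N⌋₊ with hT
  set D := capDist G (roundedWeight w Δ N) T with hD
  refine represents_of_mem_ckrCluster h0 fun v => ?_
  have hex : ∃ j, D (P j) v ≤ T := ⟨(π.symm v : Fin n), by
    rw [hP, Equiv.apply_symm_apply, hD, capDist_self]
    exact Nat.zero_le _⟩
  classical
  set j := Nat.find hex with hj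
  have hjT : D (P j) v ≤ T := Nat.find_spec hex
  have hlt : ∀ l < j, T < D (P l) v := fun l hl => not_le.1 (Nat.find_min hex hl)
  have hjn : j < n := lt_of_le_of_lt (Nat.find_min' hex (m := (π.symm v : Fin n)) (by
    rw [hP, Equiv.apply_symm_apply, hD, capDist_self]
    exact Nat.zero_le _)) (Fin.is_lt _)
  refine ⟨⟨j, hjn⟩, (mem_ckrCluster _ _ _ _ _).2 ⟨?_, fun l hl hle => ?_⟩, ?_⟩
  · have h1 := hC j hjn v v.2 (lt_distAfter_iff.2 ⟨by omega, hlt⟩) hjT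
    refine dist_le_of_walkDist_le hw hΔ hN hx (k := D (P j) v) ?_ h1
    rw [walkDist_symm, walkDist_le_iff]
    have h2 := hP ⟨j, hjn⟩
    simp only at h2
    rw [h2] at hjT ⊢
    exact (capDist_le_iff.1 le_rfl).resolve_left (not_le.2 (Nat.lt_succ_of_le hjT))
  · have h1 := walkDist_le_of_dist_le hw hΔ hN hle
    rw [walkDist_symm, walkDist_le_iff] at h1
    have h2 := hlt l hl
    rw [hP l] at h2
    exact absurd (capDist_le_iff.2 (Or.inr h1)) (not_le.2 h2)
  · rw [hs v v.2, labelAfter_eq_succ hjn hjT hlt]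

end

/-! ### The shuffle is a bijection -/

/-- The permutation that the shuffle produces: the product of the transpositions `(i, j i)`. -/
def shufflePerm {n : ℕ} (j : ∀ i : Fin n, Fin (i + 1)) : ℕ → Equiv.Perm (Fin n)
  | 0 => 1
  | i + 1 => if h : i < n then
      shufflePerm j i * Equiv.swap ⟨i, h⟩ ((j ⟨i, h⟩).castLE h) else shufflePerm j i

section
variable {n : ℕ} (j : ∀ i : Fin n, Fin (i + 1))

theorem shufflePerm_of_le {i : ℕ} {v : Fin n} (hv : i ≤ v) : shufflePerm j i v = v := by
  induction i with
  | zero => rfl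
  | succ i ih =>
    have hi : i < n := by have := v.2; omega
    rw [shufflePerm, dif_pos hi, Equiv.Perm.mul_apply, Equiv.swap_apply_of_ne_of_ne, ih (by omega)]
    · intro hc
      have := congrArg Fin.val hc
      simp only at this
      omega
    · intro hc
      have := congrArg Fin.val hc
      have h2 := (j ⟨i, hi⟩).2
      simp only [Fin.val_castLE] at this h2
      omega

theorem shufflePerm_succ_apply (i : Fin n) :
    shufflePerm j (i + 1) ((j i).castLE i.2) = i := by
  rw [shufflePerm, dif_pos i.2, Equiv.Perm.mul_apply, Equiv.swap_apply_right,
    shufflePerm_of_le j le_rfl]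

theorem shuffleArr_eq {j' : ℕ → ℕ} (hj : ∀ i : Fin n, j' i = j i) {i : ℕ} (hi : i ≤ n) {v : Fin n}
    (hv : v < i) : shuffleArr j' i v = shufflePerm j i v := by
  induction i generalizing v with
  | zero => omega
  | succ i ih =>
    replace hi : i < n := hi
    have h1 := hj ⟨i, hi⟩
    have h2 := (j ⟨i, hi⟩).2
    simp only at h1 h2
    have h3 : ((j ⟨i, hi⟩).castLE hi : Fin n).1 = j' i := h1.symm
    by_cases hvj : v = (j ⟨i, hi⟩).castLE hi
    · have h4 := shufflePerm_succ_apply j ⟨i, hi⟩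
      rw [hvj, h4, shuffleArr, h3, Function.update_self]
    · have h5 : v.1 ≠ j' i := fun hc => hvj (Fin.ext (hc.trans h3.symm))
      rw [shuffleArr, Function.update_of_ne h5, shufflePerm, dif_pos hi, Equiv.Perm.mul_apply]
      by_cases hvi : v.1 = i
      · have h6 : v = ⟨i, hi⟩ := Fin.ext hvi
        rw [h6, Function.update_self, Equiv.swap_apply_left]
        have h7 : j' i < i := by omega
        rw [← ih (by omega) (by rw [h3]; exact h7), h3]
      · rw [Function.update_of_ne hvi, Equiv.swap_apply_of_ne_of_ne
          (fun hc => hvi (congrArg Fin.val hc)) hvj, ih (by omega) (by omega)]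

end

theorem shufflePerm_bijective (n : ℕ) :
    Function.Bijective fun j : (∀ i : Fin n, Fin (i + 1)) => shufflePerm j n := by
  rw [Fintype.bijective_iff_injective_and_card]
  constructor
  · intro j j' h
    have key : ∀ i ≤ n, shufflePerm j i = shufflePerm j' i → ∀ l : Fin n, l < i → j l = j' l := by
      intro i hi
      induction i with
      | zero => intro _ l hl; omega
      | succ i ih =>
        intro h
        replace hi : i < n := hi
        have h1 := shufflePerm_succ_apply j ⟨i, hi⟩
        have h2 := shufflePerm_succ_apply j' ⟨i, hi⟩
        simp only at h1 h2
        have h3 : j ⟨i, hi⟩ = j' ⟨i, hi⟩ := Fin.castLE_injective hi <|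
          (shufflePerm j (i + 1)).injective (h1.trans (h2.symm.trans (by rw [h])))
        rw [shufflePerm, shufflePerm, dif_pos hi, dif_pos hi, h3, mul_left_inj] at h
        intro l hl
        rcases Nat.lt_succ_iff_lt_or_eq.1 hl with hl | hl
        · exact ih (by omega) h l hl
        · obtain rfl : l = ⟨i, hi⟩ := Fin.ext hl
          exact h3
    exact funext fun l => key n le_rfl h l l.2
  · rw [Fintype.card_pi, Fintype.card_perm, Fintype.card_fin]
    simp only [Fintype.card_fin]
    rw [Fin.prod_univ_eq_prod_range (fun i => i + 1) n, Finset.prod_range_add_one_eq_factorial]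

/-! ### Records of random permutations -/

/-- The `i`-th value of a random permutation is the strict minimum of the first `i + 1` values with
probability at most `1 / (i + 1)`, since swapping the positions of `i` and `l ≤ i` makes each of
the first `i + 1` values the minimum equally often. -/
theorem card_record_le {n : ℕ} {α : Type*} [LinearOrder α] (f : Fin n → α) (i : Fin n) :
    (i.1 + 1) * (Finset.univ.filter fun π : Equiv.Perm (Fin n) =>
      ∀ j < i, f (π i) < f (π j)).card ≤ n.factorial := by
  set A := Finset.univ.filter fun π : Equiv.Perm (Fin n) => ∀ j < i, f (π i) < f (π j) with hA
  have hinj : Set.InjOn (fun p : Fin n × Equiv.Perm (Fin n) => p.2 * Equiv.swap p.1 i)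
      (Finset.Iic i ×ˢ A : Finset _) := by
    have key : ∀ l ≤ i, ∀ π ∈ A, ∀ k ≤ i, k ≠ l →
        f ((π * Equiv.swap l i) l) < f ((π * Equiv.swap l i) k) := by
      intro l hl π hπ k hk hkl
      have hπ' := (Finset.mem_filter.1 hπ).2
      rw [Equiv.Perm.mul_apply, Equiv.Perm.mul_apply, Equiv.swap_apply_left]
      by_cases hki : k = i
      · rw [hki, Equiv.swap_apply_right]
        exact hπ' l (lt_of_le_of_ne hl fun h => hkl (hki.trans h.symm))
      · rw [Equiv.swap_apply_of_ne_of_ne hkl hki]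
        exact hπ' k (lt_of_le_of_ne hk hki)
    rintro ⟨l, π⟩ h ⟨l', π'⟩ h' heq
    simp only [Finset.coe_product, Set.mem_prod, Finset.mem_coe, Finset.mem_Iic] at h h'
    simp only at heq
    have hl : l = l' := by
      by_contra hne
      have h1 := key l h.1 π h.2 l' h'.1 (Ne.symm hne)
      have h2 := key l' h'.1 π' h'.2 l h.1 hne
      rw [← heq] at h2
      exact lt_asymm h1 h2
    subst hl
    rw [mul_left_inj] at heq
    rw [heq]
  have := Finset.card_le_card_of_injOn _ (fun _ _ => Finset.mem_univ _) hinj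
  rwa [Finset.card_product, Fin.card_Iic, Finset.card_univ, Fintype.card_perm,
    Fintype.card_fin] at this

/-- Summed over all permutations, the weights of the points for which the `i`-th center is nearer
than all earlier centers amount to at most `n! H_n` times the total weight. -/
theorem sum_record_le {n : ℕ} {α : Type*} [LinearOrder α] (d : Fin n → Fin n → α) (c : Fin n → ℕ) :
    ((∑ π : Equiv.Perm (Fin n), ∑ i, ∑ v with ∀ j < i, d (π i) v < d (π j) v, c v : ℕ) : ℝ) ≤
      n.factorial * (harmonic n * ∑ v, c v) := by
  have h1 : ∀ i v : Fin n, ((Finset.univ.filter fun π : Equiv.Perm (Fin n) =>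
      ∀ j < i, d (π i) v < d (π j) v).card : ℝ) ≤ n.factorial * ((i : ℝ) + 1)⁻¹ := by
    intro i v
    rw [← div_eq_mul_inv, le_div_iff₀ (by positivity), mul_comm]
    exact_mod_cast card_record_le (fun u => d u v) i
  have h2 : (∑ π : Equiv.Perm (Fin n), ∑ i, ∑ v with ∀ j < i, d (π i) v < d (π j) v, c v) =
      ∑ i, ∑ v, (Finset.univ.filter fun π : Equiv.Perm (Fin n) =>
        ∀ j < i, d (π i) v < d (π j) v).card * c v := by
    simp only [Finset.sum_filter]
    rw [Finset.sum_comm]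
    refine Finset.sum_congr rfl fun i _ => ?_
    rw [Finset.sum_comm]
    refine Finset.sum_congr rfl fun v _ => ?_
    rw [← Finset.sum_filter, Finset.sum_const, smul_eq_mul]
  have h3 : (harmonic n : ℝ) = ∑ i : Fin n, ((i : ℝ) + 1)⁻¹ := by
    rw [harmonic, Fin.sum_univ_eq_sum_range (fun i => ((i : ℝ) + 1)⁻¹) n]
    push_cast
    rfl
  rw [h2, h3, Nat.cast_sum, Finset.sum_mul, Finset.mul_sum]
  refine Finset.sum_le_sum fun i _ => ?_
  rw [Nat.cast_sum, Nat.cast_sum, Finset.mul_sum, Finset.mul_sum]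
  refine Finset.sum_le_sum fun v _ => ?_
  rw [Nat.cast_mul, ← mul_assoc]
  exact mul_le_mul_of_nonneg_right (h1 i v) (Nat.cast_nonneg _)

/-! ### The time of an attempt -/

/-- An upper bound for the number of steps of the `k`-th attempt on behalf of the vertex `v`, each
time that it is reached. -/
def visitTime {n : ℕ} (adj : Fin n → List (Fin n)) (k : ℕ) (v : Fin n) : ℕ :=
  6 * (k + 5 + 3 * Nat.clog 2 n) + 3 + 12 * (adj v).length

section
variable {n : ℕ} {G : SimpleGraph (Fin n)} {w : Sym2 (Fin n) → ℝ} {adj : Fin n → List (Fin n)}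
  {Δ : ℝ}

/-- The cut-off, which depends on the radius, does not matter for strict inequalities. Thus the
number of vertices reached can be bounded independently of the radius. -/
theorem walkDist_lt_of_capDist_lt {ℓ : Sym2 (Fin n) → ℕ} {T : ℕ} {u u' v v' : Fin n}
    (h : capDist G ℓ T u v < capDist G ℓ T u' v') : walkDist G ℓ u v < walkDist G ℓ u' v' := by
  rw [← Nat.cast_lt (α := ℕ∞), coe_capDist, coe_capDist] at h
  exact not_le.1 fun hle => not_lt.2 (min_le_min_left _ hle) h

theorem clog_floor_le {x : ℝ} (hx : x ≤ 1) (hn : 0 < n) (k : ℕ) :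
    Nat.clog 2 (⌊x * (2 ^ (k + 1) * (4 * n ^ 3) : ℕ)⌋₊ + 1) ≤ k + 4 + 3 * Nat.clog 2 n := by
  refine Nat.clog_le_of_le_pow ?_
  have h1 : ⌊x * (2 ^ (k + 1) * (4 * n ^ 3) : ℕ)⌋₊ ≤ 2 ^ (k + 1) * (4 * n ^ 3) := by
    refine Nat.floor_le_of_le (mul_le_of_le_one_left (Nat.cast_nonneg _) hx)
  have h2 : n ^ 3 ≤ 2 ^ (3 * Nat.clog 2 n) := by
    rw [mul_comm, pow_mul]
    exact Nat.pow_le_pow_left (Nat.le_pow_clog one_lt_two n) 3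
  have h3 : 0 < n ^ 3 := by positivity
  have h4 : 0 < 2 ^ k := by positivity
  calc _ ≤ 2 ^ (k + 1) * (4 * n ^ 3) + 2 ^ (k + 1) * (4 * n ^ 3) := by
          have : 0 < 2 ^ (k + 1) * (4 * n ^ 3) := by positivity
          omega
    _ = 2 ^ (k + 4) * n ^ 3 := by ring
    _ ≤ 2 ^ (k + 4) * 2 ^ (3 * Nat.clog 2 n) := Nat.mul_le_mul_left _ h2
    _ = _ := by rw [← pow_add]

/-- In round `i`, only those vertices are reached for which the center `π i` is nearer than all
earlier centers. -/
theorem attemptTime_le {x : ℝ} (hx : x ≤ 1) {π : Equiv.Perm (Fin n)}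
    {P : ℕ → ℕ} (hP : ∀ i : Fin n, P i = π i) (k : ℕ) :
    attemptTime (graphEnv adj w Δ x) n (2 ^ (k + 1) * (4 * n ^ 3))
      (capDist G (roundedWeight w Δ (2 ^ (k + 1) * (4 * n ^ 3)))
        ⌊x * (2 ^ (k + 1) * (4 * n ^ 3) : ℕ)⌋₊) P ≤
    loopTime * (1 + 2 * n) + stepTime * (6 * n + ∑ i, ∑ v with ∀ j < i,
      walkDist G (roundedWeight w Δ (2 ^ (k + 1) * (4 * n ^ 3))) (π i) v <
        walkDist G (roundedWeight w Δ (2 ^ (k + 1) * (4 * n ^ 3))) (π j) v, visitTime adj k v) := by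
  have hclog := fun hn : 0 < n => clog_floor_le hx hn k
  set N := 2 ^ (k + 1) * (4 * n ^ 3)
  set T := ⌊x * (N : ℕ)⌋₊
  set D := capDist G (roundedWeight w Δ N) T
  have hround : ∀ i : Fin n, roundTime ((graphEnv adj w Δ x).net n N T (P i) (i + 1))
      (distAfter T D P i) (D (P i)) ≤ stepTime * (6 + ∑ v with ∀ j < i,
        walkDist G (roundedWeight w Δ N) (π i) v < walkDist G (roundedWeight w Δ N) (π j) v,
          visitTime adj k v) := by
    intro i
    have hclog := hclog i.pos
    refine Nat.mul_le_mul_left _ (Nat.add_le_add_left ?_ _)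
    rw [Search.reached, Finset.sum_filter, Finset.sum_filter]
    change ∑ v ∈ Finset.range n, _ ≤ _
    rw [← Fin.sum_univ_eq_sum_range (n := n)]
    refine Finset.sum_le_sum fun v _ => ?_
    by_cases hr : D (P i) v < distAfter T D P i v
    · rw [if_pos hr, if_pos fun j hj => ?_]
      · change 6 * (Nat.clog 2 (T + 1) + 1) + 3 +
          6 * (⌊(graphEnv adj w Δ x).input (v + 1 : ℕ)⌋₊ - ⌊(graphEnv adj w Δ x).input v⌋₊) ≤ _
        rw [graphEnv_start v.2, graphEnv_start v.2.le, listStart_succ, visitTime]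
        omega
      · have h1 := (lt_distAfter_iff.1 hr).2 j hj
        rw [hP, hP] at h1
        exact walkDist_lt_of_capDist_lt h1
    · rw [if_neg hr]
      exact Nat.zero_le _
  refine Nat.add_le_add_left ?_ _
  change ∑ i ∈ Finset.range n, roundTime ((graphEnv adj w Δ x).net n N T (P i) (i + 1))
    (distAfter T D P i) (D (P i)) ≤ _
  rw [← Fin.sum_univ_eq_sum_range (fun i => roundTime ((graphEnv adj w Δ x).net n N T (P i) (i + 1))
    (distAfter T D P i) (D (P i))) n]
  refine (Finset.sum_le_sum fun i _ => hround i).trans ?_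
  rw [← Finset.mul_sum, Finset.sum_add_distrib]
  simp [mul_comm]

theorem sum_length_eq (hadj : IsAdjacencyList G adj) :
    ∑ v, (adj v).length = 2 * G.edgeSet.ncard := by
  classical
  rw [Set.ncard_eq_toFinset_card', ← SimpleGraph.edgeFinset, ← G.sum_degrees_eq_twice_card_edges]
  refine Finset.sum_congr rfl fun v _ => ?_
  rw [← SimpleGraph.card_neighborFinset_eq_degree, ← List.toFinset_card_of_nodup (hadj v).1]
  congr 1
  ext u
  simp [(hadj v).2 u]

theorem sum_visitTime (hadj : IsAdjacencyList G adj) (k : ℕ) :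
    ∑ v, visitTime adj k v =
      n * (6 * (k + 5 + 3 * Nat.clog 2 n) + 3) + 24 * G.edgeSet.ncard := by
  simp only [visitTime]
  rw [Finset.sum_add_distrib, ← Finset.mul_sum, sum_length_eq hadj]
  simp
  ring

end

/-! ### The law of the random choices -/

/-- The random choices of the shuffle. The cut-off at `i` matters only if `ω i = 1`. -/
noncomputable def shuffleChoice (n : ℕ) (ω : ℕ → unitInterval) (i : Fin n) : Fin (i + 1) :=
  ⟨min ⌊(ω i : ℝ) * (i + 1 : ℕ)⌋₊ i, by omega⟩

/-- The random permutation that the shuffle produces. -/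
noncomputable def randomPerm (n : ℕ) (ω : ℕ → unitInterval) : Equiv.Perm (Fin n) :=
  shufflePerm (shuffleChoice n ω) n

theorem shuffleArr_eq_randomPerm {n : ℕ} {ω : ℕ → unitInterval} (hω : ∀ i < n, (ω i : ℝ) < 1)
    (i : Fin n) :
    shuffleArr (fun i => ⌊(ω i : ℝ) * (i + 1 : ℕ)⌋₊) n i = randomPerm n ω i := by
  refine shuffleArr_eq _ (fun l => ?_) le_rfl i.2
  have h1 : ⌊(ω l : ℝ) * (l + 1 : ℕ)⌋₊ < l + 1 := by
    rw [Nat.floor_lt (mul_nonneg (ω l).2.1 (Nat.cast_nonneg _))]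
    exact mul_lt_of_lt_one_left (by positivity) (hω l l.2)
  simp only [shuffleChoice]
  omega

instance : IsProbabilityMeasure randomness := by unfold randomness; infer_instance

theorem measurePreserving_eval_randomness (i : ℕ) :
    MeasurePreserving (fun ω : ℕ → unitInterval => ω i) randomness volume :=
  measurePreserving_eval_infinitePi _ i

theorem volume_shuffleChoice {i : ℕ} (j : Fin (i + 1)) :
    (volume : Measure unitInterval) {u | min ⌊(u : ℝ) * (i + 1 : ℕ)⌋₊ i = j} =
      ((i + 1 : ℕ) : ℝ≥0∞)⁻¹ := by
  have hi : (0 : ℝ) < (i + 1 : ℕ) := by positivity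
  have hj : ((j : ℕ) : ℝ) + 1 ≤ (i + 1 : ℕ) := by exact_mod_cast j.2
  have hval : ENNReal.ofReal (((j : ℕ) + 1 : ℝ) / (i + 1 : ℕ) - (j : ℕ) / (i + 1 : ℕ)) =
      ((i + 1 : ℕ) : ℝ≥0∞)⁻¹ := by
    rw [← sub_div, add_sub_cancel_left, one_div, ENNReal.ofReal_inv_of_pos hi,
      ENNReal.ofReal_natCast]
  rw [unitInterval.volume_apply]
  refine le_antisymm ?_ ?_
  · rw [← hval, ← Real.volume_Icc]
    refine measure_mono ?_
    rintro _ ⟨u, hu, rfl⟩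
    simp only [Set.mem_ofPred_eq] at hu
    have h0 : 0 ≤ (u : ℝ) * (i + 1 : ℕ) := mul_nonneg u.2.1 hi.le
    rw [Set.mem_Icc, div_le_iff₀ hi, le_div_iff₀ hi]
    constructor
    · exact (Nat.cast_le.2 (by omega)).trans (Nat.floor_le h0)
    · rcases eq_or_ne (j : ℕ) i with h | h
      · rw [h]
        push_cast
        exact mul_le_of_le_one_left (by positivity) u.2.2
      · have h1 : ⌊(u : ℝ) * (i + 1 : ℕ)⌋₊ = j := by omega
        rw [← h1]
        exact (Nat.lt_floor_add_one _).le
  · rw [← hval, ← Real.volume_Ico]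
    refine measure_mono fun r hr => ?_
    rw [Set.mem_Ico, div_le_iff₀ hi, lt_div_iff₀ hi] at hr
    have hr0 : 0 ≤ r := nonneg_of_mul_nonneg_left ((Nat.cast_nonneg _).trans hr.1) hi
    have hr1 : r ≤ 1 := by
      by_contra hc
      nlinarith [hr.2]
    refine ⟨⟨r, hr0, hr1⟩, ?_, rfl⟩
    have h1 : ⌊r * (i + 1 : ℕ)⌋₊ = j :=
      (Nat.floor_eq_iff (mul_nonneg hr0 hi.le)).2 ⟨hr.1, hr.2⟩
    simp only [Set.mem_ofPred_eq, h1]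
    omega

theorem measurableSet_shuffleChoice {i : ℕ} (j : Fin (i + 1)) :
    MeasurableSet {u : unitInterval | min ⌊(u : ℝ) * (i + 1 : ℕ)⌋₊ i = j} := by
  have : Measurable fun u : unitInterval => min ⌊(u : ℝ) * (i + 1 : ℕ)⌋₊ i :=
    (Nat.measurable_floor.comp (measurable_subtype_coe.mul_const _)).min measurable_const
  exact this (measurableSet_singleton _)

/-- A permutation is the result of the shuffle for exactly one sequence of choices, and hence for a
box of random numbers of volume `1 / n!`. -/
theorem randomPerm_eq_box (n : ℕ) (π : Equiv.Perm (Fin n)) :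
    ∃ A : ℕ → Set unitInterval, (∀ i < n, MeasurableSet (A i)) ∧
      ∏ i ∈ Finset.range n, (volume : Measure unitInterval) (A i) = (n.factorial : ℝ≥0∞)⁻¹ ∧
      ∀ ω, randomPerm n ω = π ↔ ∀ i < n, ω i ∈ A i := by
  obtain ⟨j, rfl⟩ := (shufflePerm_bijective n).2 π
  refine ⟨fun i => if h : i < n then
    {u : unitInterval | min ⌊(u : ℝ) * (i + 1 : ℕ)⌋₊ i = j ⟨i, h⟩} else ∅, fun i hi => ?_, ?_,
    fun ω => ?_⟩
  · simp only [dif_pos hi]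
    exact measurableSet_shuffleChoice (j ⟨i, hi⟩)
  · have h1 : ∀ i ∈ Finset.range n, (volume : Measure unitInterval) (if h : i < n then
        {u : unitInterval | min ⌊(u : ℝ) * (i + 1 : ℕ)⌋₊ i = j ⟨i, h⟩} else ∅) =
        ((i + 1 : ℕ) : ℝ≥0∞)⁻¹ := fun i hi => by
      rw [dif_pos (Finset.mem_range.1 hi)]
      exact volume_shuffleChoice (j ⟨i, Finset.mem_range.1 hi⟩)
    rw [Finset.prod_congr rfl h1, ← Finset.prod_range_add_one_eq_factorial, Nat.cast_prod,
      ENNReal.prod_inv_distrib]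
    exact fun i _ _ _ _ => Or.inr (ENNReal.natCast_ne_top _)
  · rw [randomPerm, (shufflePerm_bijective n).1.eq_iff]
    constructor
    · intro h i hi
      simp only [dif_pos hi, Set.mem_ofPred_eq, ← h]
      rfl
    · intro h
      funext i
      have := h i i.2
      simp only [dif_pos i.2] at this
      exact Fin.ext this

theorem measurableSet_randomPerm (n : ℕ) (π : Equiv.Perm (Fin n)) :
    MeasurableSet {ω | randomPerm n ω = π} := by
  obtain ⟨A, hA, -, h⟩ := randomPerm_eq_box n π
  simp only [h, Set.ofPred_forall]
  exact MeasurableSet.iInter fun i => MeasurableSet.iInter fun hi =>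
    measurable_pi_apply i (hA i hi)

/-- The permutation is uniformly distributed and independent of the next random number. -/
theorem randomness_randomPerm (n : ℕ) (π : Equiv.Perm (Fin n)) {B : Set unitInterval}
    (hB : MeasurableSet B) :
    randomness {ω | randomPerm n ω = π ∧ ω n ∈ B} = (n.factorial : ℝ≥0∞)⁻¹ * volume B := by
  obtain ⟨A, hA, hprod, h⟩ := randomPerm_eq_box n π
  have hset : {ω | randomPerm n ω = π ∧ ω n ∈ B} =
      Set.pi (Finset.range (n + 1)) fun i => if i < n then A i else B := by
    ext ω
    simp only [Set.mem_ofPred_eq, h, Set.mem_pi, Finset.coe_range, Set.mem_Iio]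
    constructor
    · rintro ⟨h1, h2⟩ i hi
      split_ifs with h3
      · exact h1 i h3
      · rwa [show i = n by omega]
    · intro h1
      refine ⟨fun i hi => by simpa [hi] using h1 i (by omega), by simpa using h1 n (by omega)⟩
  rw [hset, randomness, Measure.infinitePi_pi]
  · rw [Finset.prod_range_succ, if_neg (lt_irrefl n), ← hprod]
    congr 1
    exact Finset.prod_congr rfl fun i hi => by rw [if_pos (Finset.mem_range.1 hi)]
  · intro i hi
    split_ifs with h3
    · exact hA i h3
    · exact hB

/-- Expectations of functions of the permutation and of the next random number. -/
theorem lintegral_randomPerm (n : ℕ) {F : Equiv.Perm (Fin n) → unitInterval → ℝ≥0∞}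
    (hF : ∀ π, Measurable (F π)) :
    ∫⁻ ω, F (randomPerm n ω) (ω n) ∂randomness =
      (n.factorial : ℝ≥0∞)⁻¹ * ∑ π, ∫⁻ u, F π u := by
  have hmap : ∀ π : Equiv.Perm (Fin n),
      (randomness.restrict {ω | randomPerm n ω = π}).map (fun ω => ω n) =
        (n.factorial : ℝ≥0∞)⁻¹ • (volume : Measure unitInterval) := by
    intro π
    ext B hB
    rw [Measure.map_apply (measurable_pi_apply n) hB,
      Measure.restrict_apply (measurable_pi_apply n hB), Measure.smul_apply, smul_eq_mul,
      ← randomness_randomPerm n π hB]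
    congr 1
    ext ω
    exact and_comm
  have hsum : ∀ ω, F (randomPerm n ω) (ω n) =
      ∑ π, Set.indicator {ω | randomPerm n ω = π} (fun ω => F π (ω n)) ω := by
    intro ω
    simp [Set.indicator_apply]
  simp only [hsum]
  have hmeas : ∀ π : Equiv.Perm (Fin n), Measurable fun ω : ℕ → unitInterval =>
      Set.indicator {ω | randomPerm n ω = π} (fun ω => F π (ω n)) ω := fun π =>
    ((hF π).comp (measurable_pi_apply n)).indicator (measurableSet_randomPerm n π)
  rw [lintegral_finsetSum _ fun π _ => hmeas π, Finset.mul_sum]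
  refine Finset.sum_congr rfl fun π _ => ?_
  rw [lintegral_indicator (measurableSet_randomPerm n π),
    ← lintegral_map (hF π) (measurable_pi_apply n), hmap, lintegral_smul_measure, smul_eq_mul]

/-- The law of `R = Δ (1 + U) / 4` for a uniformly distributed number `U ∈ [0, 1]`. -/
theorem volume_radius {Δ : ℝ} (hΔ : 0 < Δ) (S : Set ℝ) :
    (volume : Measure unitInterval) {u | Δ * ((1 + u) / 4) ∈ S} =
      ProbabilityTheory.cond volume (Set.Icc (Δ / 4) (Δ / 2)) S := by
  have hpos : (0 : ℝ) < Δ / 4 := by positivity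
  have hset : Subtype.val '' {u : unitInterval | Δ * ((1 + (u : ℝ)) / 4) ∈ S} =
      (fun r => Δ / 4 * r) ⁻¹' ((fun r => Δ / 4 + r) ⁻¹' (Set.Icc (Δ / 4) (Δ / 2) ∩ S)) := by
    ext r
    simp only [Set.mem_image, Set.mem_ofPred_eq, Set.mem_preimage, Set.mem_inter_iff, Set.mem_Icc]
    constructor
    · rintro ⟨u, hu, rfl⟩
      have h0 := u.2.1
      have h1 := u.2.2
      refine ⟨⟨by nlinarith, by nlinarith⟩, ?_⟩
      rwa [show Δ / 4 + Δ / 4 * (u : ℝ) = Δ * ((1 + u) / 4) by ring]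
    · rintro ⟨⟨h1, h2⟩, h3⟩
      refine ⟨⟨r, ?_, ?_⟩, ?_, rfl⟩
      · by_contra hc; nlinarith
      · by_contra hc; nlinarith
      · rwa [show Δ * ((1 + r) / 4) = Δ / 4 + Δ / 4 * r by ring]
  rw [unitInterval.volume_apply, hset, Real.volume_preimage_mul_left hpos.ne',
    measure_preimage_add, ProbabilityTheory.cond_apply measurableSet_Icc, Real.volume_Icc,
    abs_of_pos (inv_pos.2 hpos), ENNReal.ofReal_inv_of_pos hpos]
  congr 3
  ring

/-! ### The probability of ambiguity -/

section
variable {n : ℕ} {G : SimpleGraph (Fin n)} {w : Sym2 (Fin n) → ℝ} {adj : Fin n → List (Fin n)}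
  {Δ : ℝ}

/-- The random numbers `u` for which the scale `N` may be too coarse for the radius
`R = Δ (1 + u) / 4`. -/
def ambiguousSet (G : SimpleGraph (Fin n)) (w : Sym2 (Fin n) → ℝ) (Δ : ℝ) (N : ℕ) :
    Set unitInterval :=
  ⋃ (a : Fin n) (b : Fin n), {u | ((walkDist G (roundedWeight w Δ N) a b).toNat : ℝ) ≤
    (1 + u) / 4 * N ∧ (1 + u : ℝ) / 4 * N < (walkDist G (roundedWeight w Δ N) a b).toNat + n}

theorem measurableSet_ambiguousSet (N : ℕ) : MeasurableSet (ambiguousSet G w Δ N) := by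
  have h : Measurable fun u : unitInterval => (1 + (u : ℝ)) / 4 * N := by fun_prop
  exact MeasurableSet.iUnion fun a => MeasurableSet.iUnion fun b =>
    (measurableSet_le measurable_const h).inter (measurableSet_lt h measurable_const)

theorem Ambiguous.mem_ambiguousSet {N : ℕ} {u : unitInterval}
    (h : Ambiguous n ⌊(1 + u : ℝ) / 4 * N⌋₊
      (capDist G (roundedWeight w Δ N) ⌊(1 + u : ℝ) / 4 * N⌋₊)) : u ∈ ambiguousSet G w Δ N := by
  obtain ⟨a, ha, b, hb, h1, h2⟩ := h
  have h0 : (0 : ℝ) ≤ (1 + u) / 4 * N := by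
    have := u.2.1
    positivity
  set T := ⌊(1 + u : ℝ) / 4 * N⌋₊ with hT
  have h3 : (walkDist G (roundedWeight w Δ N) ⟨a, ha⟩ ⟨b, hb⟩).toNat =
      capDist G (roundedWeight w Δ N) T a b := by
    have h4 := coe_capDist (G := G) (roundedWeight w Δ N) T ⟨a, ha⟩ ⟨b, hb⟩
    have h5 : (capDist G (roundedWeight w Δ N) T a b : ℕ∞) < (T + 1 : ℕ) := by
      exact_mod_cast Nat.lt_succ_of_le h1
    simp only at h4
    rw [h4] at h5
    rw [min_eq_right (le_of_not_ge fun hle => by rw [min_eq_left hle] at h5; exact h5.false)] at h4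
    rw [← h4, ENat.toNat_natCast]
  refine Set.mem_iUnion₂.2 ⟨⟨a, ha⟩, ⟨b, hb⟩, ?_⟩
  simp only [Set.mem_ofPred_eq, h3]
  refine ⟨le_trans (by exact_mod_cast h1) (Nat.floor_le h0), (Nat.lt_floor_add_one _).trans_le ?_⟩
  rw [← hT]
  exact_mod_cast h2

theorem volume_interval_le {N : ℕ} (hN : 0 < N) (d n : ℕ) :
    (volume : Measure unitInterval) {u | (d : ℝ) ≤ (1 + u) / 4 * N ∧ (1 + u : ℝ) / 4 * N < d + n} ≤
      ENNReal.ofReal (4 * n / N) := by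
  have hN' : (0 : ℝ) < N := by exact_mod_cast hN
  rw [unitInterval.volume_apply,
    show (4 * n / N : ℝ) = (4 * (d + n) / N - 1) - (4 * d / N - 1) by ring, ← Real.volume_Ico]
  refine measure_mono ?_
  rintro _ ⟨u, ⟨h1, h2⟩, rfl⟩
  rw [Set.mem_Ico, sub_le_iff_le_add, lt_sub_iff_add_lt, div_le_iff₀ hN', lt_div_iff₀ hN']
  constructor <;> nlinarith

/-- Each of the `n²` distances is too close to the radius with probability at most `4 n / N`. -/
theorem volume_ambiguousSet_le (k : ℕ) :
    volume (ambiguousSet G w Δ (2 ^ (k + 1) * (4 * n ^ 3))) ≤ (1 / 2 : ℝ≥0∞) ^ (k + 1) := by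
  rcases Nat.eq_zero_or_pos n with rfl | hn
  · simp [ambiguousSet]
  have hN : 0 < 2 ^ (k + 1) * (4 * n ^ 3) := by positivity
  have hn' : (0 : ℝ) < n := by exact_mod_cast hn
  calc _ ≤ ∑ a : Fin n, ∑ b : Fin n,
        ENNReal.ofReal (4 * n / (2 ^ (k + 1) * (4 * n ^ 3) : ℕ)) :=
      (measure_iUnion_fintype_le _ _).trans <| Finset.sum_le_sum fun a _ =>
        (measure_iUnion_fintype_le _ _).trans <| Finset.sum_le_sum fun b _ =>
          volume_interval_le hN _ n
    _ = ENNReal.ofReal (n * (n * (4 * n / (2 ^ (k + 1) * (4 * n ^ 3) : ℕ)))) := by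
      simp only [Finset.sum_const, Finset.card_univ, Fintype.card_fin, nsmul_eq_mul]
      rw [ENNReal.ofReal_mul hn'.le, ENNReal.ofReal_mul hn'.le, ENNReal.ofReal_natCast]
    _ = ENNReal.ofReal ((1 / 2) ^ (k + 1)) := by
      congr 1
      push_cast
      rw [div_pow, one_pow]
      field_simp
    _ = _ := by
      rw [ENNReal.ofReal_pow (by positivity), one_div, one_div, ENNReal.ofReal_inv_of_pos two_pos,
        ENNReal.ofReal_ofNat]

theorem ae_exists_notMem_ambiguousSet :
    ∀ᵐ u : unitInterval, ∃ k, u ∉ ambiguousSet G w Δ (2 ^ (k + 1) * (4 * n ^ 3)) := by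
  rw [ae_iff]
  refine le_antisymm ?_ bot_le
  have h1 : Filter.Tendsto (fun k : ℕ => (1 / 2 : ℝ≥0∞) ^ (k + 1)) Filter.atTop (nhds 0) :=
    (ENNReal.tendsto_pow_atTop_nhds_zero_of_lt_one (by simp)).comp
      (Filter.tendsto_add_atTop_nat 1)
  refine ge_of_tendsto' h1 fun k => (measure_mono fun u hu => ?_).trans
    (volume_ambiguousSet_le (G := G) (w := w) (Δ := Δ) k)
  simp only [not_exists, not_not, Set.mem_ofPred_eq] at hu
  exact hu k

theorem ae_lt_one (n : ℕ) : ∀ᵐ ω ∂randomness, ∀ i < n, (ω i : ℝ) < 1 := by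
  have h : ∀ᵐ u : unitInterval, (u : ℝ) < 1 := by
    rw [ae_iff, unitInterval.volume_apply]
    refine measure_mono_null ?_ (measure_singleton (1 : ℝ))
    rintro _ ⟨u, hu, rfl⟩
    exact le_antisymm u.2.2 (not_lt.1 hu)
  rw [ae_all_iff]
  intro i
  filter_upwards [(measurePreserving_eval_randomness i).quasiMeasurePreserving.ae h] with ω hω _
  exact hω

/-! ### The law of the output -/

/-- An upper bound for the time of the `k`-th attempt with the permutation `π`. -/
noncomputable def attemptBound (G : SimpleGraph (Fin n)) (w : Sym2 (Fin n) → ℝ)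
    (adj : Fin n → List (Fin n)) (Δ : ℝ) (k : ℕ) (π : Equiv.Perm (Fin n)) : ℕ :=
  loopTime * (1 + 2 * n) + flagPos.compile.cost + stepTime * (6 * n + ∑ i, ∑ v with ∀ j < i,
    walkDist G (roundedWeight w Δ (2 ^ (k + 1) * (4 * n ^ 3))) (π i) v <
      walkDist G (roundedWeight w Δ (2 ^ (k + 1) * (4 * n ^ 3))) (π j) v, visitTime adj k v)

/-- Apart from the null set where the shuffle draws a `1`, the output is the CKR partition for the
random choices made. -/
theorem exists_run (hw : ∀ e ∈ G.edgeSet, 0 < w e) (hadj : IsAdjacencyList G adj) (hΔ : 0 < Δ)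
    {ω : ℕ → unitInterval} (hω : ∀ i < n, (ω i : ℝ) < 1) {K : ℕ}
    (hK : ω n ∉ ambiguousSet G w Δ (2 ^ (K + 1) * (4 * n ^ 3))) :
    ∃ t s', Run ω ckrProg (inputState adj w Δ) t s' ∧
      s'.Represents
        (ckrPartition (shortestPathDist G w) (randomPerm n ω) (Δ * ((1 + ω n) / 4))) ∧
      t ≤ baseTime * (1 + 2 * n) +
        ∑ k ∈ Finset.range (K + 1), attemptBound G w adj Δ k (randomPerm n ω) := by
  have hx0 : (0 : ℝ) ≤ (1 + ω n) / 4 := by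
    have := (ω n).2.1
    positivity
  have hx1 : (1 + (ω n : ℝ)) / 4 ≤ 1 := by
    have := (ω n).2.2
    linarith
  have hP := shuffleArr_eq_randomPerm hω
  obtain ⟨t, s', k, hrun, h0, hC, hl, ht⟩ := run_ckrProg ω (s := inputState adj w Δ) (n := n)
    (base := listStart adj n) (x := (1 + ω n) / 4) (K := K)
    (D := fun k => capDist G (roundedWeight w Δ (2 ^ (k + 1) * (4 * n ^ 3)))
      ⌊(1 + ω n : ℝ) / 4 * (2 ^ (k + 1) * (4 * n ^ 3) : ℕ)⌋₊)
    (by simp [inputState]) (by simp [inputState, hΔ.le])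
    (fun i hi => by simp [inputState, show i ≠ 0 by omega, show i ≠ 1 by omega])
    (inputState_mem_start adj w Δ le_rfl) (by unfold listStart; omega)
    (fun a ha => inputState_mem_of_ge adj w Δ ha) rfl rfl
    (fun i hi => by rw [hP ⟨i, hi⟩]; exact Fin.is_lt _) rfl
    (fun k => attempt_graphEnv hw hadj _ _) (fun h => hK h.mem_ambiguousSet)
  refine ⟨t, s', hrun, ?_, ht.trans (Nat.add_le_add_left (Finset.sum_le_sum fun k _ => ?_) _)⟩
  · rcases Nat.eq_zero_or_pos n with rfl | hn
    · exact represents_of_mem_ckrCluster h0 fun v => v.elim0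
    · exact represents_of_certified hw hΔ hx0 (by positivity) hP hC h0 hl
  · have := attemptTime_le (G := G) (w := w) (adj := adj) (Δ := Δ) hx1 hP k
    unfold attemptBound
    change attemptTime (graphEnv adj w Δ _) _ _ _ _ + _ ≤ _
    omega

/-- The partition depends on the radius only through the finitely many comparisons between
distances and the radius. -/
theorem measurableSet_ckrPartition (ρ : Fin n → Fin n → ℝ≥0∞) (π : Equiv.Perm (Fin n))
    (P : Finset (Finset (Fin n))) : MeasurableSet {R : ℝ | ckrPartition ρ π R = P} := by
  classical
  have hmeas : Measurable fun (R : ℝ) (y c : Fin n) => (ρ y c ≤ ENNReal.ofReal R : Prop) :=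
    measurable_pi_lambda _ fun y => measurable_pi_lambda _ fun c =>
      measurableSet_setOfPred.1 (measurableSet_le measurable_const ENNReal.measurable_ofReal)
  have hρ : ∀ R : ℝ, ckrPartition ρ π R =
      ckrPartition (fun y c => if ρ y c ≤ ENNReal.ofReal R then 0 else 1) π 0 := by
    intro R
    unfold ckrPartition
    congr 2
    funext i
    ext y
    simp only [mem_ckrCluster, ENNReal.ofReal_zero, nonpos_iff_eq_zero, ite_eq_left_iff,
      one_ne_zero, imp_false, not_not]
  have hset : {R : ℝ | ckrPartition ρ π R = P} =
      (fun (R : ℝ) (y c : Fin n) => (ρ y c ≤ ENNReal.ofReal R : Prop)) ⁻¹'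
        {Q | ckrPartition (fun y c => if Q y c then 0 else 1) π 0 = P} := by
    ext R
    simp only [Set.mem_preimage, Set.mem_ofPred_eq, hρ R]
    congr!
  rw [hset]
  exact hmeas (Set.toFinite _).measurableSet

theorem outputProb_ckrProg (hw : ∀ e ∈ G.edgeSet, 0 < w e) (hadj : IsAdjacencyList G adj)
    (hΔ : 0 < Δ) (P : Finset (Finset (Fin n))) :
    outputProb ckrProg (inputState adj w Δ) P = ckrProb (shortestPathDist G w) Δ P := by
  classical
  set ρ := shortestPathDist G w
  set S : Set (ℕ → unitInterval) :=
    {ω | ckrPartition ρ (randomPerm n ω) (Δ * ((1 + ω n) / 4)) = P} with hS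
  have hB : ∀ π : Equiv.Perm (Fin n),
      MeasurableSet {u : unitInterval | ckrPartition ρ π (Δ * ((1 + (u : ℝ)) / 4)) = P} :=
    fun π => (show Measurable fun u : unitInterval => Δ * ((1 + (u : ℝ)) / 4) by fun_prop)
      (measurableSet_ckrPartition ρ π P)
  have hSm : MeasurableSet S := by
    have : S = ⋃ π, {ω | randomPerm n ω = π} ∩ (fun ω => ω n) ⁻¹'
        {u : unitInterval | ckrPartition ρ π (Δ * ((1 + (u : ℝ)) / 4)) = P} := by
      ext ω
      simp [hS]
    rw [this]
    exact MeasurableSet.iUnion fun π =>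
      (measurableSet_randomPerm n π).inter (measurable_pi_apply n (hB π))
  have h1 : outputProb ckrProg (inputState adj w Δ) P = randomness S := by
    refine measure_congr ?_
    filter_upwards [ae_lt_one n, (measurePreserving_eval_randomness n).quasiMeasurePreserving.ae
      (ae_exists_notMem_ambiguousSet (G := G) (w := w) (Δ := Δ))] with ω hω ⟨K, hK⟩
    obtain ⟨t, s', hr, hs', -⟩ := exists_run hw hadj hΔ hω hK
    refine propext ⟨fun ⟨t₁, s₁, hr₁, hs₁⟩ => ?_, fun h => ⟨t, s', hr, ?_⟩⟩
    · obtain ⟨-, rfl⟩ := hr.unique hr₁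
      exact Represents.unique hs' hs₁
    · have h2 : ckrPartition ρ (randomPerm n ω) (Δ * ((1 + ω n) / 4)) = P := h
      rwa [← h2]
  have h2 := lintegral_randomPerm n (F := fun π => Set.indicator
    {u : unitInterval | ckrPartition ρ π (Δ * ((1 + (u : ℝ)) / 4)) = P} 1)
    fun π => measurable_one.indicator (hB π)
  have h3 : ∀ ω, Set.indicator {u : unitInterval |
      ckrPartition ρ (randomPerm n ω) (Δ * ((1 + (u : ℝ)) / 4)) = P}
        (1 : unitInterval → ℝ≥0∞) (ω n) =
        Set.indicator S 1 ω := fun ω => by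
    simp [Set.indicator_apply, hS]
  simp only [h3, lintegral_indicator_one hSm, lintegral_indicator_one (hB _)] at h2
  rw [h1, h2, ckrProb, ENNReal.div_eq_inv_mul, Fintype.card_perm, Fintype.card_fin]
  congr 1
  exact Finset.sum_congr rfl fun π _ => volume_radius hΔ {R : ℝ | ckrPartition ρ π R = P}

end

/-! ### The expected running time -/

section
variable {n : ℕ} {G : SimpleGraph (Fin n)} {w : Sym2 (Fin n) → ℝ} {adj : Fin n → List (Fin n)}
  {Δ : ℝ}

/-- An upper bound for the expected time of the first attempt, for a graph with `n` vertices and `m`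
edges. -/
noncomputable def meanBound (n m : ℕ) : ℝ :=
  loopTime * (1 + 2 * n) + flagPos.compile.cost +
    stepTime * (6 * n + harmonic n * (n * (33 + 18 * Nat.clog 2 n) + 24 * m))

theorem harmonic_nonneg (n : ℕ) : (0 : ℝ) ≤ harmonic n := by
  rw [harmonic]
  push_cast
  positivity

theorem meanBound_nonneg (n m : ℕ) : 0 ≤ meanBound n m := by
  have := harmonic_nonneg n
  unfold meanBound
  positivity

/-- The sum over all permutations of the bounds for the `k`-th attempt. The precision, and with it
the depth of the queue, grows linearly with `k`. -/
theorem sum_attemptBound_le (hadj : IsAdjacencyList G adj) (k : ℕ) :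
    ∑ π, (attemptBound G w adj Δ k π : ℝ≥0∞) ≤
      n.factorial * ((k + 1 : ℕ) * ENNReal.ofReal (meanBound n G.edgeSet.ncard)) := by
  have h1 := sum_record_le (walkDist G (roundedWeight w Δ (2 ^ (k + 1) * (4 * n ^ 3))))
    (visitTime adj k)
  have h2 : ((∑ v, visitTime adj k v : ℕ) : ℝ) ≤
      (k + 1) * (n * (33 + 18 * Nat.clog 2 n) + 24 * G.edgeSet.ncard) := by
    rw [sum_visitTime hadj]
    push_cast
    have h3 : (0 : ℝ) ≤ k * (n * (27 + 18 * Nat.clog 2 n) + 24 * G.edgeSet.ncard) := by positivity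
    nlinarith
  set Y := ∑ π : Equiv.Perm (Fin n), ∑ i, ∑ v with ∀ j < i,
    walkDist G (roundedWeight w Δ (2 ^ (k + 1) * (4 * n ^ 3))) (π i) v <
      walkDist G (roundedWeight w Δ (2 ^ (k + 1) * (4 * n ^ 3))) (π j) v, visitTime adj k v with hY
  have h3 : ∑ π, attemptBound G w adj Δ k π =
      n.factorial * (loopTime * (1 + 2 * n) + flagPos.compile.cost + stepTime * (6 * n)) +
        stepTime * Y := by
    simp only [attemptBound, mul_add, Finset.sum_add_distrib, ← Finset.mul_sum, Finset.sum_const,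
      Finset.card_univ, Fintype.card_perm, Fintype.card_fin, smul_eq_mul, ← hY]
    ring
  have h4 : ((∑ π, attemptBound G w adj Δ k π : ℕ) : ℝ) ≤
      n.factorial * ((k + 1 : ℕ) * meanBound n G.edgeSet.ncard) := by
    have h5 : (0 : ℝ) ≤
        k * (loopTime * (1 + 2 * n) + flagPos.compile.cost + stepTime * (6 * n)) := by
      positivity
    have h6 : (Y : ℝ) ≤ n.factorial * (harmonic n *
        ((k + 1) * (n * (33 + 18 * Nat.clog 2 n) + 24 * G.edgeSet.ncard))) :=
      h1.trans (mul_le_mul_of_nonneg_left (mul_le_mul_of_nonneg_left (by exact_mod_cast h2)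
        (harmonic_nonneg n)) (Nat.cast_nonneg _))
    have h7 : (0 : ℝ) ≤ n.factorial := Nat.cast_nonneg _
    have h8 := mul_le_mul_of_nonneg_left h6 (Nat.cast_nonneg stepTime : (0 : ℝ) ≤ stepTime)
    have h9 := mul_nonneg h7 h5
    rw [h3, meanBound]
    push_cast
    nlinarith
  calc ∑ π, (attemptBound G w adj Δ k π : ℝ≥0∞)
      = ENNReal.ofReal ((∑ π, attemptBound G w adj Δ k π : ℕ) : ℝ) := by
        rw [ENNReal.ofReal_natCast, Nat.cast_sum]
    _ ≤ ENNReal.ofReal (n.factorial * ((k + 1 : ℕ) * meanBound n G.edgeSet.ncard)) :=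
        ENNReal.ofReal_le_ofReal h4
    _ = _ := by
        rw [ENNReal.ofReal_mul (Nat.cast_nonneg _), ENNReal.ofReal_mul (Nat.cast_nonneg _),
          ENNReal.ofReal_natCast, ENNReal.ofReal_natCast]

/-- The random numbers for which the attempt `k` may take place, because the attempt before it may
have been ambiguous; the attempt `0` always takes place. -/
def attemptSet (G : SimpleGraph (Fin n)) (w : Sym2 (Fin n) → ℝ) (Δ : ℝ) : ℕ → Set unitInterval
  | 0 => Set.univ
  | k + 1 => ambiguousSet G w Δ (2 ^ (k + 1) * (4 * n ^ 3))

theorem measurableSet_attemptSet (k : ℕ) : MeasurableSet (attemptSet G w Δ k) := by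
  cases k with
  | zero => exact MeasurableSet.univ
  | succ k => exact measurableSet_ambiguousSet _

theorem volume_attemptSet_le (k : ℕ) : volume (attemptSet G w Δ k) ≤ (1 / 2 : ℝ≥0∞) ^ k := by
  cases k with
  | zero => simp [attemptSet]
  | succ k => exact volume_ambiguousSet_le k

theorem runningTime_le {p : Prog} {s s' : State} {ω : ℕ → unitInterval} {t : ℕ}
    (h : Run ω p s t s') : runningTime p s ω ≤ t :=
  iInf₂_le t ⟨s', h⟩

theorem ae_runningTime_le (hw : ∀ e ∈ G.edgeSet, 0 < w e) (hadj : IsAdjacencyList G adj)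
    (hΔ : 0 < Δ) : ∀ᵐ ω ∂randomness, runningTime ckrProg (inputState adj w Δ) ω ≤
      (baseTime * (1 + 2 * n) : ℕ) + ∑' k, Set.indicator (attemptSet G w Δ k)
        (fun _ => (attemptBound G w adj Δ k (randomPerm n ω) : ℝ≥0∞)) (ω n) := by
  classical
  filter_upwards [ae_lt_one n, (measurePreserving_eval_randomness n).quasiMeasurePreserving.ae
    (ae_exists_notMem_ambiguousSet (G := G) (w := w) (Δ := Δ))] with ω hω hex
  obtain ⟨t, s', hr, -, ht⟩ := exists_run hw hadj hΔ hω (Nat.find_spec hex)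
  have hmem : ∀ k ∈ Finset.range (Nat.find hex + 1), ω n ∈ attemptSet G w Δ k := by
    intro k hk
    cases k with
    | zero => trivial
    | succ k =>
      exact not_not.1 (Nat.find_min hex (Nat.lt_of_succ_lt_succ (Finset.mem_range.1 hk)))
  refine (runningTime_le hr).trans ((Nat.cast_le.2 ht).trans ?_)
  rw [Nat.cast_add, Nat.cast_sum]
  refine add_le_add_right ?_ _
  refine le_trans (le_of_eq (Finset.sum_congr rfl fun k hk => ?_))
    (ENNReal.sum_le_tsum (Finset.range (Nat.find hex + 1)))
  rw [Set.indicator_of_mem (hmem k hk)]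

theorem tsum_half_pow_mul_le : ∑' k : ℕ, (1 / 2 : ℝ≥0∞) ^ k * (k + 1 : ℕ) ≤ 8 := by
  have h : ∀ k : ℕ, (1 / 2 : ℝ≥0∞) ^ k * (k + 1 : ℕ) ≤ 2 * ENNReal.ofReal (3 / 4) ^ k := by
    intro k
    have hk : ((k : ℝ) + 1) ≤ 2 * (3 / 2) ^ k := by
      induction k with
      | zero => norm_num
      | succ k ih =>
        have : (1 : ℝ) ≤ (3 / 2) ^ k := one_le_pow₀ (by norm_num)
        push_cast
        rw [pow_succ]
        linarith
    have h2 : (1 / 2 : ℝ≥0∞) = ENNReal.ofReal (1 / 2) := by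
      rw [one_div, one_div, ENNReal.ofReal_inv_of_pos two_pos, ENNReal.ofReal_ofNat]
    rw [h2, ← ENNReal.ofReal_pow (by norm_num), ← ENNReal.ofReal_pow (by norm_num),
      ← ENNReal.ofReal_natCast (k + 1), ← ENNReal.ofReal_ofNat 2,
      ← ENNReal.ofReal_mul (by positivity), ← ENNReal.ofReal_mul (by norm_num)]
    refine ENNReal.ofReal_le_ofReal ?_
    have h3 : ((3 : ℝ) / 4) ^ k = (1 / 2) ^ k * (3 / 2) ^ k := by rw [← mul_pow]; norm_num
    have h4 := mul_le_mul_of_nonneg_left hk (by positivity : (0 : ℝ) ≤ (1 / 2) ^ k)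
    push_cast
    rw [h3]
    linarith
  refine (ENNReal.tsum_le_tsum h).trans (le_of_eq ?_)
  rw [ENNReal.tsum_mul_left, ENNReal.tsum_geometric, ← ENNReal.ofReal_one,
    ← ENNReal.ofReal_sub _ (by norm_num), ← ENNReal.ofReal_inv_of_pos (by norm_num),
    ← ENNReal.ofReal_ofNat 2, ← ENNReal.ofReal_mul (by norm_num), ← ENNReal.ofReal_ofNat 8]
  norm_num

/-- The `k`-th attempt takes place only with probability `2⁻ᵏ`, independently of the permutation. -/
theorem expectedTime_ckrProg (hw : ∀ e ∈ G.edgeSet, 0 < w e) (hadj : IsAdjacencyList G adj)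
    (hΔ : 0 < Δ) : expectedTime ckrProg (inputState adj w Δ) ≤
      ENNReal.ofReal (baseTime * (1 + 2 * n) + 8 * meanBound n G.edgeSet.ncard) := by
  have hfac : (n.factorial : ℝ≥0∞) ≠ 0 := by exact_mod_cast n.factorial_ne_zero
  have hfac' : (n.factorial : ℝ≥0∞) ≠ ⊤ := ENNReal.natCast_ne_top _
  set b : ℝ≥0∞ := ((baseTime * (1 + 2 * n) : ℕ) : ℝ≥0∞) with hb
  set M := ENNReal.ofReal (meanBound n G.edgeSet.ncard) with hM
  have hmeas : ∀ (π : Equiv.Perm (Fin n)) (k : ℕ), Measurable <|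
      Set.indicator (attemptSet G w Δ k)
        (fun _ => (attemptBound G w adj Δ k π : ℝ≥0∞)) :=
    fun π k => measurable_const.indicator (measurableSet_attemptSet k)
  have h1 := lintegral_randomPerm n (F := fun π u => b + ∑' k, Set.indicator (attemptSet G w Δ k)
    (fun _ => (attemptBound G w adj Δ k π : ℝ≥0∞)) u)
    fun π => measurable_const.add (Measurable.tsum fun k => hmeas π k)
  refine (lintegral_mono_ae (ae_runningTime_le hw hadj hΔ)).trans ?_
  rw [h1]
  have h2 : ∀ π : Equiv.Perm (Fin n), ∫⁻ u : unitInterval, b + ∑' k,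
      Set.indicator (attemptSet G w Δ k) (fun _ => (attemptBound G w adj Δ k π : ℝ≥0∞)) u ≤
        b + ∑' k : ℕ, (1 / 2 : ℝ≥0∞) ^ k * attemptBound G w adj Δ k π := by
    intro π
    rw [lintegral_add_left measurable_const, lintegral_const, measure_univ, mul_one,
      lintegral_tsum fun k => (hmeas π k).aemeasurable]
    refine add_le_add_right (ENNReal.tsum_le_tsum fun k => ?_) _
    rw [lintegral_indicator_const (measurableSet_attemptSet k), mul_comm]
    exact mul_le_mul_left (volume_attemptSet_le k) _
  calc _ ≤ (n.factorial : ℝ≥0∞)⁻¹ * ∑ π : Equiv.Perm (Fin n),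
        (b + ∑' k : ℕ, (1 / 2 : ℝ≥0∞) ^ k * attemptBound G w adj Δ k π) := by
        gcongr with π
        exact h2 π
    _ = (n.factorial : ℝ≥0∞)⁻¹ * (n.factorial * b +
        ∑' k : ℕ, (1 / 2 : ℝ≥0∞) ^ k * ∑ π, (attemptBound G w adj Δ k π : ℝ≥0∞)) := by
        simp only [Finset.sum_add_distrib, Finset.sum_const, Finset.card_univ, Fintype.card_perm,
          Fintype.card_fin, nsmul_eq_mul, Finset.mul_sum]
        rw [Summable.tsum_finsetSum fun _ _ => ENNReal.summable]
    _ ≤ (n.factorial : ℝ≥0∞)⁻¹ * (n.factorial * b +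
        ∑' k : ℕ, n.factorial * M * ((1 / 2 : ℝ≥0∞) ^ k * (k + 1 : ℕ))) := by
        refine mul_le_mul_right (add_le_add_right (ENNReal.tsum_le_tsum fun k => ?_) _) _
        refine (mul_le_mul_right (sum_attemptBound_le hadj k) _).trans (le_of_eq ?_)
        rw [mul_left_comm, mul_assoc, mul_left_comm _ _ M, mul_comm M]
        ring
    _ ≤ (n.factorial : ℝ≥0∞)⁻¹ * (n.factorial * b + n.factorial * M * 8) := by
        rw [ENNReal.tsum_mul_left]
        gcongr
        exact tsum_half_pow_mul_le
    _ = b + 8 * M := by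
        rw [mul_assoc, ← mul_add, ← mul_assoc, ENNReal.inv_mul_cancel hfac hfac', one_mul,
          mul_comm M]
    _ = _ := by
        rw [ENNReal.ofReal_add (by positivity) (mul_nonneg (by norm_num) (meanBound_nonneg _ _)),
          ENNReal.ofReal_mul (p := 8) (by norm_num), ENNReal.ofReal_ofNat, hb,
          ← ENNReal.ofReal_natCast]
        push_cast
        rfl

/-- The constant in the bound for the expected running time. -/
noncomputable def timeConst : ℝ :=
  12 * baseTime + 8 * (12 * loopTime + 4 * flagPos.compile.cost + 510 * stepTime) + 1

theorem time_le (hn : 2 ≤ n) (m : ℕ) : baseTime * (1 + 2 * n) + 8 * meanBound n m ≤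
    timeConst * (m * Real.log n + n * Real.log n ^ 2) := by
  have hn' : (2 : ℝ) ≤ n := by exact_mod_cast hn
  set l := Real.log n with hl
  have h2 : (1 / 2 : ℝ) < Real.log 2 := by linarith [Real.log_two_gt_d9]
  have hl2 : Real.log 2 ≤ l := Real.log_le_log two_pos hn'
  have hH : (harmonic n : ℝ) ≤ 3 * l := by
    have := harmonic_le_one_add_log n
    linarith
  have hL : (Nat.clog 2 n : ℝ) ≤ 4 * l := by
    have h3 : 2 ^ (Nat.clog 2 n - 1) ≤ n := (Nat.pow_pred_clog_lt_self one_lt_two hn).le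
    have h4 := Real.log_le_log (by positivity)
      (show ((2 : ℝ) ^ (Nat.clog 2 n - 1)) ≤ n by exact_mod_cast h3)
    rw [Real.log_pow] at h4
    have h5 : (Nat.clog 2 n : ℝ) ≤ ((Nat.clog 2 n - 1 : ℕ) : ℝ) + 1 := by
      exact_mod_cast (by omega)
    have h6 : (0 : ℝ) ≤ ((Nat.clog 2 n - 1 : ℕ) : ℝ) := Nat.cast_nonneg _
    nlinarith
  have hm : (0 : ℝ) ≤ m := Nat.cast_nonneg _
  have hl0 : 0 < l := by linarith
  set Q := m * l + n * l ^ 2 with hQ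
  have hml : 0 ≤ m * l := by positivity
  -- All terms are compared with `Q`, by `1 ≤ 2 l`.
  have hl1 : 0 ≤ 2 * l - 1 := by linarith
  have hnl : n * l ≤ 2 * Q := by
    have := mul_nonneg (by positivity : (0 : ℝ) ≤ n * l) hl1
    linarith
  have hnQ : (n : ℝ) ≤ 4 * Q := by
    have := mul_nonneg (by positivity : (0 : ℝ) ≤ n) hl1
    linarith
  have hrec : harmonic n * (n * (33 + 18 * Nat.clog 2 n) + 24 * m) ≤ 486 * Q := by
    calc _ ≤ 3 * l * (n * (33 + 18 * (4 * l)) + 24 * m) := by gcongr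
      _ = 99 * (n * l) + 216 * (n * l ^ 2) + 72 * (m * l) := by ring
      _ ≤ _ := by linarith [(by positivity : (0 : ℝ) ≤ n * l ^ 2)]
  have hb : (baseTime : ℝ) * (1 + 2 * n) ≤ baseTime * (12 * Q) := by gcongr; linarith
  have hlo : (loopTime : ℝ) * (1 + 2 * n) ≤ loopTime * (12 * Q) := by gcongr; linarith
  have hf : (flagPos.compile.cost : ℝ) * 1 ≤ flagPos.compile.cost * (4 * Q) := by
    gcongr; linarith
  have hs : (stepTime : ℝ) * (6 * n + harmonic n * (n * (33 + 18 * Nat.clog 2 n) + 24 * m)) ≤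
      stepTime * (510 * Q) := by gcongr; linarith
  have hQ0 : 0 ≤ Q := by positivity
  unfold meanBound timeConst
  linarith

end

end CKR

/-- There are one program for the randomized real-word RAM and one constant such that, for every
undirected graph with positive edge weights, given by adjacency lists, and every scale `Δ > 0`, the
output of the program is distributed as the `Δ`-bounded CKR partition of the shortest-path metric,
and the expected running time is `O(m log n + n log² n)`. -/
theorem theorem1 :
    ∃ (p : RAM.Prog) (C : ℝ), 0 < C ∧
      ∀ (n : ℕ) (G : SimpleGraph (Fin n)) (w : Sym2 (Fin n) → ℝ)
        (adj : Fin n → List (Fin n)) (Δ : ℝ),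
        (∀ e ∈ G.edgeSet, 0 < w e) → RAM.IsAdjacencyList G adj → 0 < Δ →
          (∀ P : Finset (Finset (Fin n)),
            RAM.outputProb p (RAM.inputState adj w Δ) P = ckrProb (shortestPathDist G w) Δ P) ∧
          (2 ≤ n →
            RAM.expectedTime p (RAM.inputState adj w Δ) ≤
              ENNReal.ofReal (C * ((G.edgeSet.ncard : ℝ) * Real.log n + n * Real.log n ^ 2))) := by
  refine ⟨CKR.ckrProg, CKR.timeConst, by unfold CKR.timeConst; positivity,
    fun n G w adj Δ hw hadj hΔ => ⟨CKR.outputProb_ckrProg hw hadj hΔ, fun hn => ?_⟩⟩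
  exact (CKR.expectedTime_ckrProg hw hadj hΔ).trans
    (ENNReal.ofReal_le_ofReal (CKR.time_le hn _))
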